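/- Let $d\ge 2$ and let $\Omega\subset\mathbb R^d$ be a bounded, connected Lipschitz domain, i.e. a nonempty bounded connected open set which near each of its boundary points is, in suitable Cartesian coordinates, the set of points lying on one side of the graph of a Lipschitz function. Let $\Gamma=\Gamma_{\rm D}$ and $\Gamma_{\rm N}$ be disjoint, nonempty, relatively open subsets of $\partial\Omega$ such that $\partial\Omega\setminus(\Gamma_{\rm D}\cup\Gamma_{\rm N})$ has surface measure zero. At almost every $x\in\partial\Omega$ there is an outer unit normal $\nu(x)$; where it exists, let $T_x=\{\tau\in\mathbb R^d:\tau\cdot\nu(x)=0\}$ be the tangential hyperplane, and put $$\mathcal S(\Gamma_{\rm N})=\bigcap\{T_x : x\in\Gamma_{\rm N},\ T_x \text{ exists}\}.$$ All functions are complex-valued. For $u\in H^1(\Omega)$ with $\Delta u\in L^2(\Omega)$ in the sense of distributions and $v\in H^1(\Omega)$ write $$(\partial_\nu u|_{\partial\Omega},v|_{\partial\Omega})_{\partial\Omega}=\int_\Omega\nabla u\cdot\overline{\nabla v}\,dx+\int_\Omega\Delta u\,\overline v\,dx .$$ The mixed Laplacian $-\Delta_\Gamma$ in $L^2(\Omega)$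 acts as $u\mapsto-\Delta u$ on those $u\in H^1(\Omega)$ with $\Delta u\in L^2(\Omega)$ whose trace vanishes almost everywhere on $\Gamma_{\rm D}$ and which satisfy $\partial_\nu u|_{\Gamma_{\rm N}}=0$, meaning that $(\partial_\nu u|_{\partial\Omega},v|_{\partial\Omega})_{\partial\Omega}=0$ for all $v\in H^1(\Omega)$ whose trace vanishes almost everywhere on $\partial\Omega\setminus\overline{\Gamma_{\rm N}}$. The Neumann Laplacian acts as $u\mapsto-\Delta u$ on those $u\in H^1(\Omega)$ with $\Delta u\in L^2(\Omega)$ for which $(\partial_\nu u|_{\partial\Omega},v|_{\partial\Omega})_{\partial\Omega}=0$ for all $v\in H^1(\Omega)$. Suppose that $\dim\mathcal S(\Gamma_{\rm N})\ge 1$. Then the eigenvalues of the Neumann Laplacian and those of $-\Delta_\Gamma$, counted with multiplicities, can be listed as infinite nondecreasing sequences of real numbers $\mu_1\le\mu_2\le\cdots$ and $\lambda_1^\Gamma\le\lambda_2^\Gamma\le\cdots$, respectively, and $$\mu_{k+1}\le\lambda_k^\Gamma\qquad\text{for all } k\in\{1,2,3,\dots\}.$$ -/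

import Mathlib

open MeasureTheory Filter Topology
open scoped ENNReal NNReal ContDiff InnerProductSpace

noncomputable section

namespace MixedLaplacian

/-- Euclidean space `ℝᵈ`. -/
abbrev Space (d : ℕ) : Type := EuclideanSpace ℝ (Fin d)

variable {d : ℕ}

/-! ### Lipschitz domains, surface measure, tangential hyperplanes -/

/-- `Ω` is a bounded, connected Lipschitz domain: a bounded, connected (in particular nonempty)
open set such that every boundary point `x` has a neighbourhood `U` in which, in suitable Cartesian
coordinates `y ↦ (y', ⟪e, y⟫) ∈ e^⊥ × ℝ` with `|e| = 1`, the set `Ω` consists of the points strictly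
below the graph of a Lipschitz function `h` on the hyperplane `e^⊥`. -/
structure IsBoundedLipschitzDomain (Ω : Set (Space d)) : Prop where
  isOpen : IsOpen Ω
  isBounded : Bornology.IsBounded Ω
  isConnected : IsConnected Ω
  locally_graph : ∀ x ∈ frontier Ω, ∃ U : Set (Space d), IsOpen U ∧ x ∈ U ∧
    ∃ e : Space d, ‖e‖ = 1 ∧ ∃ (K : ℝ≥0) (h : (ℝ ∙ e)ᗮ → ℝ), LipschitzWith K h ∧
      ∀ y ∈ U, (y ∈ Ω ↔ ⟪e, y⟫_ℝ < h ((ℝ ∙ e)ᗮ.orthogonalProjectionOnto y))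

/-- The surface measure on `∂Ω`, i.e. the `(d-1)`-dimensional Hausdorff measure on `∂Ω`. (The
Hausdorff measure is not normalized; a constant factor plays no role for null sets and for
convergence in `L²(∂Ω)`.) -/
def surfaceMeasure (Ω : Set (Space d)) : Measure (Space d) :=
  (Measure.hausdorffMeasure ((d : ℝ) - 1)).restrict (frontier Ω)

/-- `ν` is the outer unit normal vector of `Ω` at the boundary point `x`: the hyperplane through `x`
orthogonal to the unit vector `ν` is tangent to `∂Ω` at `x`, and `ν` points out of `Ω`. If `∂Ω` is
near `x` the graph of a Lipschitz function, then such a `ν` exists exactly if this function is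
differentiable at the point corresponding to `x`. -/
structure IsOuterUnitNormal (Ω : Set (Space d)) (x ν : Space d) : Prop where
  mem_frontier : x ∈ frontier Ω
  norm_eq_one : ‖ν‖ = 1
  tangent : (fun y => ⟪ν, y - x⟫_ℝ) =o[𝓝[frontier Ω] x] (fun y => y - x)
  outer : ∀ᶠ s in 𝓝[>] (0 : ℝ), x - s • ν ∈ Ω ∧ x + s • ν ∉ closure Ω

/-- The tangential hyperplane `T_x`: all vectors orthogonal to the outer unit normal vector at `x`
(meaningful, and used, only at points `x` where the normal vector exists). -/
def tangentHyperplane (Ω : Set (Space d)) (x : Space d) : Submodule ℝ (Space d) :=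
  (Submodule.span ℝ {ν : Space d | IsOuterUnitNormal Ω x ν})ᗮ

/-- The space `S(Γ)` of joint tangential vectors: the intersection of the tangential hyperplanes
`T_x` over all `x ∈ Γ` at which the tangential hyperplane exists. -/
def jointTangentSpace (Ω Γ : Set (Space d)) : Submodule ℝ (Space d) :=
  ⨅ x ∈ {x ∈ Γ | ∃ ν, IsOuterUnitNormal Ω x ν}, tangentHyperplane Ω x

/-- `Γ` is a relatively open subset of `∂Ω`. -/
def IsRelOpenInBoundary (Ω Γ : Set (Space d)) : Prop :=
  ∃ U : Set (Space d), IsOpen U ∧ Γ = U ∩ frontier Ω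

/-- `Γ_D` and `Γ_N` are disjoint, nonempty, relatively open subsets of `∂Ω` which cover `∂Ω` up to
a set of surface measure zero. -/
structure IsBoundaryDecomposition (Ω ΓD ΓN : Set (Space d)) : Prop where
  isRelOpen_D : IsRelOpenInBoundary Ω ΓD
  isRelOpen_N : IsRelOpenInBoundary Ω ΓN
  nonempty_D : ΓD.Nonempty
  nonempty_N : ΓN.Nonempty
  disjoint : Disjoint ΓD ΓN
  measure_rest : surfaceMeasure Ω (frontier Ω \ (ΓD ∪ ΓN)) = 0

/-! ### Sobolev functions and traces -/

/-- The complex Hilbert space `L²(Ω)`. -/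
abbrev L2 (Ω : Set (Space d)) : Type := Lp ℂ 2 (volume.restrict Ω)

/-- The classical partial derivative `∂ᵢφ`. -/
def partialDeriv (i : Fin d) (φ : Space d → ℂ) (x : Space d) : ℂ :=
  fderiv ℝ φ x (EuclideanSpace.single i 1)

/-- `φ ∈ C_c^∞(Ω)`. -/
structure IsTestFunction (Ω : Set (Space d)) (φ : Space d → ℂ) : Prop where
  contDiff : ContDiff ℝ ∞ φ
  hasCompactSupport : HasCompactSupport φ
  tsupport_subset : tsupport φ ⊆ Ω

/-- `u ∈ H¹(Ω)` with weak gradient `g = (∂₁u, …, ∂_d u) ∈ L²(Ω)ᵈ`. -/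
def HasWeakGradient (Ω : Set (Space d)) (u : L2 Ω) (g : Fin d → L2 Ω) : Prop :=
  ∀ φ, IsTestFunction Ω φ → ∀ i,
    ∫ x in Ω, u x * partialDeriv i φ x = -∫ x in Ω, g i x * φ x

/-- `Δu = f` in the sense of distributions on `Ω`. -/
def HasWeakLaplacian (Ω : Set (Space d)) (u f : L2 Ω) : Prop :=
  ∀ φ, IsTestFunction Ω φ →
    ∫ x in Ω, u x * Laplacian.laplacian φ x = ∫ x in Ω, f x * φ x

/-- `u ∈ H¹(Ω)` has the trace `u|_∂Ω = w ∈ L²(∂Ω)`. The trace operator is the continuous extension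
to `H¹(Ω)` of the restriction `φ ↦ φ|_∂Ω` of functions `φ` which are smooth up to the boundary:
there are such functions `φₙ` with `φₙ → u` in `H¹(Ω)` and `φₙ|_∂Ω → w` in `L²(∂Ω)`. -/
def HasTrace (Ω : Set (Space d)) (u : L2 Ω) (w : Lp ℂ 2 (surfaceMeasure Ω)) : Prop :=
  ∃ g : Fin d → L2 Ω, HasWeakGradient Ω u g ∧
    ∃ φ : ℕ → Space d → ℂ, (∀ n, ContDiff ℝ ∞ (φ n)) ∧
      Tendsto (fun n => eLpNorm (φ n - ⇑u) 2 (volume.restrict Ω)) atTop (𝓝 0) ∧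
      (∀ i, Tendsto (fun n => eLpNorm (partialDeriv i (φ n) - ⇑(g i)) 2 (volume.restrict Ω))
        atTop (𝓝 0)) ∧
      Tendsto (fun n => eLpNorm (φ n - ⇑w) 2 (surfaceMeasure Ω)) atTop (𝓝 0)

/-- `u ∈ H¹(Ω)` and `u|_Γ = 0`, i.e. the trace of `u` vanishes almost everywhere on `Γ ⊆ ∂Ω`. -/
def TraceVanishesOn (Ω Γ : Set (Space d)) (u : L2 Ω) : Prop :=
  ∃ w : Lp ℂ 2 (surfaceMeasure Ω), HasTrace Ω u w ∧ ∀ᵐ x ∂(surfaceMeasure Ω), x ∈ Γ → w x = 0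

/-- The duality `(∂_ν u|_∂Ω, v|_∂Ω)_∂Ω`, defined through Green's identity as
`∫_Ω ∇u · conj(∇v) dx + ∫_Ω Δu conj(v) dx`, where `∇u = gu`, `Δu = f` and `∇v = gv`. -/
def normalDerivPairing {Ω : Set (Space d)} (gu : Fin d → L2 Ω) (f v : L2 Ω)
    (gv : Fin d → L2 Ω) : ℂ :=
  (∑ i, ⟪gv i, gu i⟫_ℂ) + ⟪v, f⟫_ℂ

/-! ### The Laplace operators -/

/-- `(u, f)` belongs to the graph of the mixed Laplacian `-Δ_Γ`: `u ∈ H¹(Ω)`, `u|_{Γ_D} = 0`,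
`∂_ν u|_{Γ_N} = 0` and `-Δu = f ∈ L²(Ω)`. Here `∂_ν u|_{Γ_N} = 0` means that
`(∂_ν u|_∂Ω, v|_∂Ω)_∂Ω = 0` for all `v ∈ H¹(Ω)` which vanish on `∂Ω \ closure Γ_N`. -/
def IsMixedLaplacian (Ω ΓD ΓN : Set (Space d)) (u f : L2 Ω) : Prop :=
  TraceVanishesOn Ω ΓD u ∧ HasWeakLaplacian Ω u (-f) ∧
    ∃ g, HasWeakGradient Ω u g ∧
      ∀ v gv, HasWeakGradient Ω v gv → TraceVanishesOn Ω (frontier Ω \ closure ΓN) v →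
        normalDerivPairing g (-f) v gv = 0

/-- `(u, f)` belongs to the graph of the Neumann Laplacian: `u ∈ H¹(Ω)`, `∂_ν u|_∂Ω = 0` and
`-Δu = f ∈ L²(Ω)`. -/
def IsNeumannLaplacian (Ω : Set (Space d)) (u f : L2 Ω) : Prop :=
  HasWeakLaplacian Ω u (-f) ∧
    ∃ g, HasWeakGradient Ω u g ∧
      ∀ v gv, HasWeakGradient Ω v gv → normalDerivPairing g (-f) v gv = 0

/-! ### Both graphs are linear subspaces of `L²(Ω) × L²(Ω)` -/

section Linear

variable {Ω : Set (Space d)}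

lemma integral_add_mul {μ : Measure (Space d)} {ψ : Space d → ℂ} (hψ : MemLp ψ 2 μ)
    (u v : Lp ℂ 2 μ) :
    ∫ x, (u + v : Lp ℂ 2 μ) x * ψ x ∂μ = ∫ x, u x * ψ x ∂μ + ∫ x, v x * ψ x ∂μ := by
  refine Eq.trans ?_ (integral_add ((Lp.memLp u).integrable_mul hψ)
    ((Lp.memLp v).integrable_mul hψ))
  refine integral_congr_ae ?_
  filter_upwards [Lp.coeFn_add u v] with x hx
  simp only [hx, Pi.add_apply, add_mul]

lemma integral_smul_mul {μ : Measure (Space d)} (ψ : Space d → ℂ) (c : ℂ) (u : Lp ℂ 2 μ) :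
    ∫ x, (c • u : Lp ℂ 2 μ) x * ψ x ∂μ = c * ∫ x, u x * ψ x ∂μ := by
  rw [← integral_const_mul]
  refine integral_congr_ae ?_
  filter_upwards [Lp.coeFn_smul c u] with x hx
  rw [hx, Pi.smul_apply, smul_eq_mul, mul_assoc]

lemma IsTestFunction.memLp {φ : Space d → ℂ} (h : IsTestFunction Ω φ) :
    MemLp φ 2 (volume.restrict Ω) :=
  (h.contDiff.continuous.memLp_of_hasCompactSupport h.hasCompactSupport).restrict Ω

lemma IsTestFunction.memLp_partialDeriv {φ : Space d → ℂ} (h : IsTestFunction Ω φ) (i : Fin d) :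
    MemLp (partialDeriv i φ) 2 (volume.restrict Ω) := by
  have hc : Continuous (partialDeriv i φ) :=
    (h.contDiff.continuous_fderiv (by simp)).clm_apply continuous_const
  exact (hc.memLp_of_hasCompactSupport (h.hasCompactSupport.fderiv_apply ℝ _)).restrict Ω

lemma IsTestFunction.memLp_laplacian {φ : Space d → ℂ} (h : IsTestFunction Ω φ) :
    MemLp (Laplacian.laplacian φ) 2 (volume.restrict Ω) := by
  have h2 : Continuous (iteratedFDeriv ℝ 2 φ) :=
    h.contDiff.continuous_iteratedFDeriv (WithTop.coe_le_coe.2 le_top)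
  rw [InnerProductSpace.laplacian_eq_iteratedFDeriv_stdOrthonormalBasis]
  refine memLp_finsetSum _ fun i _ => ?_
  refine (Continuous.memLp_of_hasCompactSupport (by fun_prop) ?_).restrict Ω
  exact (h.hasCompactSupport.iteratedFDeriv (𝕜 := ℝ) 2).comp_left
    (g := fun L : ContinuousMultilinearMap ℝ (fun _ : Fin 2 => Space d) ℂ => L ![_, _]) rfl

lemma HasWeakGradient.add {u v : L2 Ω} {g k : Fin d → L2 Ω} (hu : HasWeakGradient Ω u g)
    (hv : HasWeakGradient Ω v k) : HasWeakGradient Ω (u + v) (g + k) := by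
  intro φ hφ i
  rw [integral_add_mul (hφ.memLp_partialDeriv i), Pi.add_apply, integral_add_mul hφ.memLp,
    hu φ hφ i, hv φ hφ i]
  ring

lemma HasWeakGradient.smul (c : ℂ) {u : L2 Ω} {g : Fin d → L2 Ω} (hu : HasWeakGradient Ω u g) :
    HasWeakGradient Ω (c • u) (c • g) := by
  intro φ hφ i
  rw [integral_smul_mul, Pi.smul_apply, integral_smul_mul, hu φ hφ i]
  ring

lemma HasWeakLaplacian.add {u v f k : L2 Ω} (hu : HasWeakLaplacian Ω u f)
    (hv : HasWeakLaplacian Ω v k) : HasWeakLaplacian Ω (u + v) (f + k) := by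
  intro φ hφ
  rw [integral_add_mul hφ.memLp_laplacian, integral_add_mul hφ.memLp, hu φ hφ, hv φ hφ]

lemma HasWeakLaplacian.smul (c : ℂ) {u f : L2 Ω} (hu : HasWeakLaplacian Ω u f) :
    HasWeakLaplacian Ω (c • u) (c • f) := by
  intro φ hφ
  rw [integral_smul_mul, integral_smul_mul, hu φ hφ]

lemma tendsto_eLpNorm_add {μ : Measure (Space d)} {a b : ℕ → Space d → ℂ} {u v : Lp ℂ 2 μ}
    (ha : ∀ n, Continuous (a n)) (hb : ∀ n, Continuous (b n))
    (hu : Tendsto (fun n => eLpNorm (a n - ⇑u) 2 μ) atTop (𝓝 0))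
    (hv : Tendsto (fun n => eLpNorm (b n - ⇑v) 2 μ) atTop (𝓝 0)) :
    Tendsto (fun n => eLpNorm (a n + b n - ⇑(u + v)) 2 μ) atTop (𝓝 0) := by
  have h := hu.add hv
  rw [add_zero] at h
  refine tendsto_of_tendsto_of_tendsto_of_le_of_le tendsto_const_nhds h (fun _ => bot_le) ?_
  intro n
  have e : a n + b n - ⇑(u + v) =ᵐ[μ] (a n - ⇑u) + (b n - ⇑v) := by
    filter_upwards [Lp.coeFn_add u v] with x hx
    simp only [Pi.add_apply, Pi.sub_apply, hx]
    ring
  refine (eLpNorm_congr_ae e).trans_le (eLpNorm_add_le ?_ ?_ one_le_two)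
  · exact (ha n).aestronglyMeasurable.sub (Lp.aestronglyMeasurable u)
  · exact (hb n).aestronglyMeasurable.sub (Lp.aestronglyMeasurable v)

lemma tendsto_eLpNorm_smul {μ : Measure (Space d)} {a : ℕ → Space d → ℂ} {u : Lp ℂ 2 μ} (c : ℂ)
    (hu : Tendsto (fun n => eLpNorm (a n - ⇑u) 2 μ) atTop (𝓝 0)) :
    Tendsto (fun n => eLpNorm (c • a n - ⇑(c • u)) 2 μ) atTop (𝓝 0) := by
  have h := ENNReal.Tendsto.const_mul (a := ‖c‖ₑ) hu (Or.inr enorm_ne_top)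
  rw [mul_zero] at h
  refine h.congr fun n => ?_
  rw [← eLpNorm_const_smul]
  refine eLpNorm_congr_ae ?_
  filter_upwards [Lp.coeFn_smul c u] with x hx
  simp only [Pi.sub_apply, Pi.smul_apply, hx, smul_sub]

lemma continuous_partialDeriv {φ : Space d → ℂ} (h : ContDiff ℝ ∞ φ) (i : Fin d) :
    Continuous (partialDeriv i φ) :=
  (h.continuous_fderiv (by simp)).clm_apply continuous_const

lemma partialDeriv_add {φ ψ : Space d → ℂ} (hφ : ContDiff ℝ ∞ φ) (hψ : ContDiff ℝ ∞ ψ)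
    (i : Fin d) : partialDeriv i (φ + ψ) = partialDeriv i φ + partialDeriv i ψ := by
  funext x
  simp only [partialDeriv, Pi.add_apply]
  rw [fderiv_add (hφ.differentiable (by simp) x) (hψ.differentiable (by simp) x)]
  rfl

lemma partialDeriv_smul (c : ℂ) {φ : Space d → ℂ} (hφ : ContDiff ℝ ∞ φ) (i : Fin d) :
    partialDeriv i (c • φ) = c • partialDeriv i φ := by
  funext x
  simp only [partialDeriv, Pi.smul_apply]
  rw [fderiv_const_smul (hφ.differentiable (by simp) x) c]
  rfl

lemma HasTrace.add {u v : L2 Ω} {w z : Lp ℂ 2 (surfaceMeasure Ω)} (hu : HasTrace Ω u w)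
    (hv : HasTrace Ω v z) : HasTrace Ω (u + v) (w + z) := by
  obtain ⟨g, hg, a, ha, ha1, ha2, ha3⟩ := hu
  obtain ⟨k, hk, b, hb, hb1, hb2, hb3⟩ := hv
  refine ⟨g + k, hg.add hk, fun n => a n + b n, fun n => (ha n).add (hb n),
    tendsto_eLpNorm_add (fun n => (ha n).continuous) (fun n => (hb n).continuous) ha1 hb1,
    fun i => ?_,
    tendsto_eLpNorm_add (fun n => (ha n).continuous) (fun n => (hb n).continuous) ha3 hb3⟩
  simp only [fun n => partialDeriv_add (ha n) (hb n) i]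
  exact tendsto_eLpNorm_add (fun n => continuous_partialDeriv (ha n) i)
    (fun n => continuous_partialDeriv (hb n) i) (ha2 i) (hb2 i)

lemma HasTrace.smul (c : ℂ) {u : L2 Ω} {w : Lp ℂ 2 (surfaceMeasure Ω)} (hu : HasTrace Ω u w) :
    HasTrace Ω (c • u) (c • w) := by
  obtain ⟨g, hg, a, ha, ha1, ha2, ha3⟩ := hu
  refine ⟨c • g, hg.smul c, fun n => c • a n, fun n => contDiff_const.smul (ha n),
    tendsto_eLpNorm_smul c ha1, fun i => ?_, tendsto_eLpNorm_smul c ha3⟩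
  simp only [fun n => partialDeriv_smul c (ha n) i]
  exact tendsto_eLpNorm_smul c (ha2 i)

lemma TraceVanishesOn.add {Γ : Set (Space d)} {u v : L2 Ω} (hu : TraceVanishesOn Ω Γ u)
    (hv : TraceVanishesOn Ω Γ v) : TraceVanishesOn Ω Γ (u + v) := by
  obtain ⟨w, hw, hw0⟩ := hu
  obtain ⟨z, hz, hz0⟩ := hv
  refine ⟨w + z, hw.add hz, ?_⟩
  filter_upwards [hw0, hz0, Lp.coeFn_add w z] with x h1 h2 h3 hx
  rw [h3, Pi.add_apply, h1 hx, h2 hx, add_zero]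

lemma TraceVanishesOn.smul (c : ℂ) {Γ : Set (Space d)} {u : L2 Ω}
    (hu : TraceVanishesOn Ω Γ u) : TraceVanishesOn Ω Γ (c • u) := by
  obtain ⟨w, hw, hw0⟩ := hu
  refine ⟨c • w, hw.smul c, ?_⟩
  filter_upwards [hw0, Lp.coeFn_smul c w] with x h1 h3 hx
  rw [h3, Pi.smul_apply, h1 hx, smul_zero]

lemma hasWeakGradient_zero : HasWeakGradient Ω 0 0 := by
  intro φ _ i
  have := integral_smul_mul (μ := volume.restrict Ω) φ 0 0
  have h2 := integral_smul_mul (μ := volume.restrict Ω) (partialDeriv i φ) 0 0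
  simp only [zero_smul, zero_mul] at this h2
  rw [Pi.zero_apply, this, h2, neg_zero]

lemma hasWeakLaplacian_zero : HasWeakLaplacian Ω 0 0 := by
  intro φ _
  have := integral_smul_mul (μ := volume.restrict Ω) φ 0 0
  have h2 := integral_smul_mul (μ := volume.restrict Ω) (Laplacian.laplacian φ) 0 0
  simp only [zero_smul, zero_mul] at this h2
  rw [this, h2]

lemma traceVanishesOn_zero (Γ : Set (Space d)) : TraceVanishesOn Ω Γ 0 := by
  have aux : ∀ μ : Measure (Space d), eLpNorm (0 - ⇑(0 : Lp ℂ 2 μ)) 2 μ = 0 := by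
    intro μ
    rw [eLpNorm_congr_ae (g := 0), eLpNorm_zero]
    filter_upwards [Lp.coeFn_zero ℂ 2 μ] with x hx
    rw [Pi.sub_apply, hx, Pi.zero_apply, sub_zero]
  have hd : ∀ i : Fin d, partialDeriv i (0 : Space d → ℂ) = 0 := by
    intro i
    funext x
    simp [partialDeriv]
  refine ⟨0, ⟨0, hasWeakGradient_zero, fun _ => 0, fun _ => contDiff_zero_fun, ?_, ?_, ?_⟩, ?_⟩
  · simp only [aux, tendsto_const_nhds]
  · intro i
    simp only [hd, Pi.zero_apply, aux, tendsto_const_nhds]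
  · simp only [aux, tendsto_const_nhds]
  · filter_upwards [Lp.coeFn_zero ℂ 2 (surfaceMeasure Ω)] with x hx _
    rw [hx, Pi.zero_apply]

lemma normalDerivPairing_add (g k : Fin d → L2 Ω) (f l v : L2 Ω) (gv : Fin d → L2 Ω) :
    normalDerivPairing (g + k) (f + l) v gv =
      normalDerivPairing g f v gv + normalDerivPairing k l v gv := by
  simp only [normalDerivPairing, Pi.add_apply, inner_add_right, Finset.sum_add_distrib]
  ring

lemma normalDerivPairing_smul (c : ℂ) (g : Fin d → L2 Ω) (f v : L2 Ω) (gv : Fin d → L2 Ω) :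
    normalDerivPairing (c • g) (c • f) v gv = c * normalDerivPairing g f v gv := by
  simp only [normalDerivPairing, Pi.smul_apply, inner_smul_right, mul_add, Finset.mul_sum]

end Linear

/-- The (graph of the) mixed Laplacian `-Δ_Γ` in `L²(Ω)`. -/
def mixedLaplacian (Ω ΓD ΓN : Set (Space d)) : Submodule ℂ (L2 Ω × L2 Ω) where
  carrier := {p | IsMixedLaplacian Ω ΓD ΓN p.1 p.2}
  zero_mem' := by
    refine ⟨traceVanishesOn_zero ΓD, ?_, 0, hasWeakGradient_zero, fun v gv _ _ => ?_⟩
    · simpa using hasWeakLaplacian_zero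
    · simp [normalDerivPairing]
  add_mem' := by
    rintro ⟨u, f⟩ ⟨v, l⟩ ⟨h1, h2, g, h3, h4⟩ ⟨k1, k2, k, k3, k4⟩
    refine ⟨h1.add k1, ?_, g + k, h3.add k3, fun z gz hz hz0 => ?_⟩
    · simpa only [Prod.mk_add_mk, neg_add] using h2.add k2
    · simp only [Prod.mk_add_mk, neg_add]
      rw [normalDerivPairing_add, h4 z gz hz hz0, k4 z gz hz hz0, add_zero]
  smul_mem' := by
    rintro c ⟨u, f⟩ ⟨h1, h2, g, h3, h4⟩
    refine ⟨h1.smul c, ?_, c • g, h3.smul c, fun z gz hz hz0 => ?_⟩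
    · simpa only [Prod.smul_mk, smul_neg] using h2.smul c
    · simp only [Prod.smul_mk, ← smul_neg]
      rw [normalDerivPairing_smul, h4 z gz hz hz0, mul_zero]

/-- The (graph of the) Neumann Laplacian in `L²(Ω)`. -/
def neumannLaplacian (Ω : Set (Space d)) : Submodule ℂ (L2 Ω × L2 Ω) where
  carrier := {p | IsNeumannLaplacian Ω p.1 p.2}
  zero_mem' := by
    refine ⟨?_, 0, hasWeakGradient_zero, fun v gv _ => ?_⟩
    · simpa using hasWeakLaplacian_zero
    · simp [normalDerivPairing]
  add_mem' := by
    rintro ⟨u, f⟩ ⟨v, l⟩ ⟨h2, g, h3, h4⟩ ⟨k2, k, k3, k4⟩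
    refine ⟨?_, g + k, h3.add k3, fun z gz hz => ?_⟩
    · simpa only [Prod.mk_add_mk, neg_add] using h2.add k2
    · simp only [Prod.mk_add_mk, neg_add]
      rw [normalDerivPairing_add, h4 z gz hz, k4 z gz hz, add_zero]
  smul_mem' := by
    rintro c ⟨u, f⟩ ⟨h2, g, h3, h4⟩
    refine ⟨?_, c • g, h3.smul c, fun z gz hz => ?_⟩
    · simpa only [Prod.smul_mk, smul_neg] using h2.smul c
    · simp only [Prod.smul_mk, ← smul_neg]
      rw [normalDerivPairing_smul, h4 z gz hz, mul_zero]

/-- For an operator with graph `G`, the space `ker(G - t)` of all `u` in its domain with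
`G u = t u`. -/
def eigenspace {Ω : Set (Space d)} (G : Submodule ℂ (L2 Ω × L2 Ω)) (t : ℂ) :
    Submodule ℂ (L2 Ω) :=
  G.comap (LinearMap.prod LinearMap.id (t • LinearMap.id))

/-- `lam 0 ≤ lam 1 ≤ lam 2 ≤ …` is the sequence of the eigenvalues of `G`, counted with
multiplicities: each complex number `t` occurs in it exactly `dim ker(G - t)` times. (In particular
all eigenvalues are real and there are infinitely many. There is at most one such sequence.) -/
structure IsEigenvalueSequence {Ω : Set (Space d)} (G : Submodule ℂ (L2 Ω × L2 Ω))
    (lam : ℕ → ℝ) : Prop where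
  monotone : Monotone lam
  multiplicity : ∀ t : ℂ,
    Cardinal.mk {k : ℕ // (lam k : ℂ) = t} = Module.rank ℂ (eigenspace G t)

end MixedLaplacian

end

set_option linter.unusedSectionVars false

/-! ### Discrete enumeration of the spectrum of a compactly embedded form -/

namespace MixedLaplacian

/-! Both operators come from the Dirichlet form ∫ ∇u · conj(∇v): the Neumann Laplacian from the form
on H¹(Ω), the mixed Laplacian from its restriction to the subspace V of functions with vanishing
trace on Γ_D. By min-max it suffices, for each k, to add to the span of the mixed eigenfunctions up
to λ_k one vector outside V without raising the Rayleigh quotient above λ_k.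

That vector is a plane wave w(x) = exp(i τ·x) with τ ∈ S(Γ_N) and |τ|² = λ_k; it exists because λ_k
≥ 0 and S(Γ_N) ≠ 0. As ∂ⱼw = iτⱼw, its Rayleigh quotient is λ_k (`inner_planeWave_self`). For p ∈ V,
integrating by parts in the direction τ leaves the boundary term ∫ p conj(w) (τ·ν), which vanishes
because p = 0 on Γ_D and τ·ν = 0 on Γ_N. Hence the form of w and p is λ_k times their L² product
(`inner_planeWave`), and the cross terms in the Rayleigh quotient balance as well. Finally |w| = 1
on Γ_D, which has positive surface measure, so w ∉ V (`planeWave_notMem_traceVanishingSpace`) and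
the dimension does go up by one. The dimension count is `formEigenvalue_succ_le`.

The analysis underneath has two sources. The uniform cone condition gives compactness of H¹(Ω) →
L²(Ω) (`isCompactOperator_sobolev_embedding`), hence discrete spectra and eigenbases. The divergence
theorem below a Lipschitz graph (`exists_integral_fderiv_subgraph`) gives the trace inequality
(`exists_lintegral_surfaceMeasure_le`) and the tangential integration by parts
(`sum_inner_add_inner_eq_zero`). Surface measure is needed only up to constants, so two-sided
Lipschitz bounds for Hausdorff measure replace the area formula. Sobolev functions are treated as
jets (u, ∇u) in L² × (L²)ᵈ; with the H¹ inner product a form eigenvalue t appears as 1 + t. -/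

lemma exists_monotone_enumeration {ι : Type*} [Infinite ι] (f : ι → ℝ)
    (hf : ∀ c, {i | f i ≤ c}.Finite) : ∃ e : ℕ ≃ ι, Monotone (f ∘ e) := by
  have hcount : Countable ι := by
    have : (Set.univ : Set ι) = ⋃ n : ℕ, {i | f i ≤ n} := by
      ext i
      simpa using exists_nat_ge (f i)
    rw [← Set.countable_univ_iff, this]
    exact Set.countable_iUnion fun n => (hf n).countable
  obtain ⟨g, hg⟩ := exists_injective_nat ι
  -- The injection `g` breaks ties, so the lexicographic key is a linear order for which `f` is
  -- monotone. Its initial segments are finite and it has no maximum, which forces order type ℕ.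
  let key : ι → ℝ ×ₗ ℕ := fun i => toLex (f i, g i)
  have hkey : Function.Injective key := fun i j h => hg (congrArg (fun p => (ofLex p).2) h)
  let _ : LinearOrder ι := LinearOrder.lift' key hkey
  have hmono : Monotone f := fun i j h => by
    have h' : key i ≤ key j := h
    rcases Prod.Lex.le_iff.1 h' with h1 | h1
    · exact h1.le
    · exact h1.1.le
  have hIic : ∀ i : ι, (Set.Iic i).Finite := fun i =>
    (hf (f i)).subset fun j hj => hmono hj
  let _ : LocallyFiniteOrder ι :=
    LocallyFiniteOrder.ofFiniteIcc fun a b => (hIic b).subset Set.Icc_subset_Iic_self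
  have : NoMaxOrder ι := ⟨fun a => by
    by_contra! h
    exact Set.infinite_univ ((hIic a).subset fun x _ => h x)⟩
  obtain ⟨i₀⟩ : Nonempty ι := inferInstance
  obtain ⟨m, hm, hmin⟩ := (hIic i₀).exists_minimal ⟨i₀, Set.mem_Iic.2 le_rfl⟩
  let _ : OrderBot ι :=
    { bot := m
      bot_le := fun a => by
        rcases le_total a i₀ with h | h
        · rcases le_total a m with h' | h'
          · exact hmin h h'
          · exact h'
        · exact le_trans hm h }
  let _ : SuccOrder ι := LinearLocallyFiniteOrder.succOrder ι
  let _ : PredOrder ι := LinearLocallyFiniteOrder.predOrder ι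
  let e : ι ≃o ℕ := orderIsoNatOfLinearSuccPredArch
  exact ⟨e.symm.toEquiv, hmono.comp e.symm.monotone⟩

/-! ### Eigenspaces of a form with compact embedding -/

section FormEigenspace

variable {V H : Type} [NormedAddCommGroup V] [InnerProductSpace ℂ V] [CompleteSpace V]
  [NormedAddCommGroup H] [InnerProductSpace ℂ H] [CompleteSpace H]

/-- For an embedding `J : V → H` of a form domain, the eigenspace for the eigenvalue `t` of the
operator associated with the form `⟪u, v⟫_V - ⟪J u, J v⟫_H`. -/
noncomputable def formEigenspace (J : V →L[ℂ] H) (t : ℂ) : Submodule ℂ V where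
  carrier := {u | ∀ v, ⟪v, u⟫_ℂ = (1 + t) * ⟪J v, J u⟫_ℂ}
  zero_mem' := by simp
  add_mem' := fun {a b} ha hb v => by
    rw [inner_add_right, ha v, hb v, map_add, inner_add_right]; ring
  smul_mem' := fun c a ha v => by
    rw [inner_smul_right, ha v, map_smul, inner_smul_right]; ring

variable {J : V →L[ℂ] H}

/-- `J.adjoint ∘L J` represents the `H`-product inside `V`. It translates the form eigenvalue
problem into one for a compact self-adjoint operator, with `s = 1 / (1 + t)`. -/
lemma mem_formEigenspace_of_adjoint {s : ℂ} (hs : s ≠ 0) {u : V}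
    (hu : (J.adjoint ∘L J) u = s • u) : u ∈ formEigenspace J (s⁻¹ - 1) := by
  intro v
  have : ⟪J v, J u⟫_ℂ = s * ⟪v, u⟫_ℂ := by
    rw [← ContinuousLinearMap.adjoint_inner_right, ← inner_smul_right, ← hu]
    rfl
  rw [this]
  field_simp
  ring

lemma adjoint_apply_of_mem_formEigenspace {t : ℂ} {u : V} (hu : u ∈ formEigenspace J t) :
    u = (1 + t) • (J.adjoint ∘L J) u := by
  refine ext_inner_left ℂ fun v => ?_
  rw [hu v, inner_smul_right, ContinuousLinearMap.comp_apply,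
    ContinuousLinearMap.adjoint_inner_right]

/-- Testing with `v = u` gives `1 + t = ‖u‖² / ‖J u‖²`, which is at least 1 since `J` is a
contraction. -/
lemma formEigenspace_eigenvalue (hn : ∀ u, ‖J u‖ ≤ ‖u‖) {t : ℂ} {u : V}
    (hu : u ∈ formEigenspace J t) (h0 : u ≠ 0) : ∃ r : ℝ, 0 ≤ r ∧ t = r := by
  have h := hu u
  rw [inner_self_eq_norm_sq_to_K, inner_self_eq_norm_sq_to_K] at h
  have hJ : J u ≠ 0 := fun hJ => by
    rw [hJ] at h
    simp at h
    exact h0 h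
  have hJ' : 0 < ‖J u‖ := norm_pos_iff.2 hJ
  have hJ2 : ((‖J u‖ : ℝ) : ℂ) ≠ 0 := by exact_mod_cast hJ'.ne'
  refine ⟨‖u‖ ^ 2 / ‖J u‖ ^ 2 - 1, ?_, ?_⟩
  · rw [sub_nonneg, le_div_iff₀ (by positivity), one_mul]
    exact pow_le_pow_left₀ hJ'.le (hn u) 2
  · push_cast
    have h' : ((‖u‖ : ℝ) : ℂ) ^ 2 = (1 + t) * ((‖J u‖ : ℝ) : ℂ) ^ 2 := h
    rw [h']
    field_simp
    ring

lemma formEigenspace_finiteDimensional (hJ : IsCompactOperator J) (t : ℂ) :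
    FiniteDimensional ℂ (formEigenspace J t) := by
  by_cases ht : 1 + t = 0
  · have : formEigenspace J t = ⊥ := by
      rw [eq_bot_iff]
      intro u hu
      have := adjoint_apply_of_mem_formEigenspace hu
      rw [ht, zero_smul] at this
      exact this
    rw [this]
    infer_instance
  · have hS : IsCompactOperator (J.adjoint ∘L J) := by
      rw [ContinuousLinearMap.coe_comp]
      exact hJ.clm_comp _
    have := ContinuousLinearMap.finite_dimensional_eigenspace hS (1 + t)⁻¹ (inv_ne_zero ht)
    refine Submodule.finiteDimensional_of_le (S₂ := Module.End.eigenspace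
      (J.adjoint ∘L J).toLinearMap (1 + t)⁻¹) fun u hu => ?_
    rw [Module.End.mem_eigenspace_iff]
    have := adjoint_apply_of_mem_formEigenspace hu
    conv_rhs => rw [this]
    rw [smul_smul, inv_mul_cancel₀ ht, one_smul]
    rfl

/-- Eigenvalues are real, so comparing the two eigenvalue equations gives `(a - b) * ⟪J u, J v⟫ =
0`. Orthogonality in `H` then yields orthogonality in `V`. -/
lemma inner_of_mem_formEigenspace (hn : ∀ u, ‖J u‖ ≤ ‖u‖) {s t : ℂ} (hst : s ≠ t) {u v : V}
    (hu : u ∈ formEigenspace J s) (hv : v ∈ formEigenspace J t) : ⟪u, v⟫_ℂ = 0 := by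
  by_cases hu0 : u = 0
  · simp [hu0]
  by_cases hv0 : v = 0
  · simp [hv0]
  obtain ⟨a, ha, rfl⟩ := formEigenspace_eigenvalue hn hu hu0
  obtain ⟨b, hb, rfl⟩ := formEigenspace_eigenvalue hn hv hv0
  have h1 := hv u
  have h2 := congrArg (starRingEnd ℂ) (hu v)
  rw [map_mul, inner_conj_symm, inner_conj_symm] at h2
  simp only [map_add, map_one, Complex.conj_ofReal] at h2
  have h3 : ((a : ℂ) - b) * ⟪J u, J v⟫_ℂ = 0 := by
    linear_combination h1 - h2
  rcases mul_eq_zero.1 h3 with h | h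
  · exact absurd (sub_eq_zero.1 h) hst
  · rw [h1, h, mul_zero]

/-- The images `J (b i)` with `f i ≤ c` are pairwise orthogonal with squared norm at least `1 / (1 +
c)`. Infinitely many of them would have no convergent subsequence, against compactness. -/
lemma finite_setOf_formEigenvalue_le (hJ : IsCompactOperator J) {ι : Type*} {b : ι → V}
    (hb : Orthonormal ℂ b) {f : ι → ℝ} (hbf : ∀ i, b i ∈ formEigenspace J (f i))
    (hf : ∀ i, 0 ≤ f i) (c : ℝ) : {i | f i ≤ c}.Finite := by
  by_contra hinf
  have hinf : {i | f i ≤ c}.Infinite := hinf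
  let n := hinf.natEmbedding
  have hc : 0 ≤ c := (hf _).trans (n 0).2
  have hcomp := hJ.isCompact_closure_image_closedBall (𝕜₁ := ℂ) 1
  have hmem : ∀ k, J (b (n k)) ∈ closure (J '' Metric.closedBall 0 1) := fun k =>
    subset_closure ⟨_, by simp [hb.1], rfl⟩
  obtain ⟨x, -, φ, hφ, hlim⟩ := hcomp.tendsto_subseq hmem
  have hdist : ∀ i j : ι, f i ≤ c → i ≠ j → (1 + c)⁻¹ ≤ dist (J (b i)) (J (b j)) ^ 2 := by
    intro i j hi hij
    have h1 : ⟪J (b i), J (b j)⟫_ℂ = 0 := by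
      have h := hbf j (b i)
      rw [hb.2 hij] at h
      rcases mul_eq_zero.1 h.symm with h | h
      · have : (1 : ℝ) + f j = 0 := by exact_mod_cast h
        linarith [hf j]
      · exact h
    have h2 : 1 = (1 + f i) * ‖J (b i)‖ ^ 2 := by
      have h := hbf i (b i)
      rw [inner_self_eq_norm_sq_to_K, inner_self_eq_norm_sq_to_K, hb.1, RCLike.ofReal_one,
        one_pow] at h
      apply Complex.ofReal_injective
      push_cast
      exact h
    rw [dist_eq_norm, @norm_sub_sq ℂ, h1]
    have : (1 + c)⁻¹ ≤ ‖J (b i)‖ ^ 2 := by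
      rw [inv_le_iff_one_le_mul₀ (by linarith), h2]
      nlinarith [sq_nonneg ‖J (b i)‖]
    simp only [map_zero, mul_zero, sub_zero]
    nlinarith [sq_nonneg ‖J (b j)‖]
  have hcau := hlim.cauchySeq
  rw [Metric.cauchySeq_iff'] at hcau
  have hpos : 0 < (1 + c)⁻¹ := by positivity
  obtain ⟨N, hN⟩ := hcau (Real.sqrt (1 + c)⁻¹) (Real.sqrt_pos.2 hpos)
  have h1 := hN (N + 1) (by omega)
  have h2 := hdist (n (φ (N + 1))) (n (φ N)) (n _).2 (fun h => by
    have := hφ.injective (n.injective (Subtype.ext h))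
    omega)
  have h3 := (Real.lt_sqrt dist_nonneg).1 h1
  simp only [Function.comp] at h3
  linarith

/-- The multiplicity condition lets each index be matched with a vector of an orthonormal basis of
its eigenspace. Completeness is the spectral theorem for the compact operator `J.adjoint ∘L J`. The
index type is left free: the lemma serves both to construct an eigenvalue sequence and to attach an
eigenbasis to an arbitrary given one. -/
lemma exists_hilbertBasis_of_formEigenvalues (hJ : IsCompactOperator J)
    (hinj : Function.Injective J) (hn : ∀ u, ‖J u‖ ≤ ‖u‖) {ι : Type} {f : ι → ℝ}
    (hf : ∀ t : ℂ, Cardinal.mk {i // (f i : ℂ) = t} = Module.rank ℂ (formEigenspace J t)) :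
    ∃ b : HilbertBasis ι ℂ V, ∀ i, b i ∈ formEigenspace J (f i) := by
  have key : ∀ t : ℂ, ∃ B : {i // (f i : ℂ) = t} → V, Orthonormal ℂ B ∧
      Submodule.span ℂ (Set.range B) = formEigenspace J t := by
    intro t
    have := formEigenspace_finiteDimensional hJ t
    have h := hf t
    rw [← Module.finrank_eq_rank] at h
    obtain ⟨e⟩ := Cardinal.mk_eq_nat_iff.1 h
    let o := stdOrthonormalBasis ℂ (formEigenspace J t)
    refine ⟨fun i => (o (e i) : V), ?_, ?_⟩
    · exact (o.orthonormal.comp_linearIsometry (formEigenspace J t).subtypeₗᵢ).comp e e.injective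
    · have h1 : Set.range (fun i => (o (e i) : V)) = (formEigenspace J t).subtype '' Set.range o := by
        rw [← Set.range_comp, ← e.surjective.range_comp]
        rfl
      have h2 : Submodule.span ℂ (Set.range o) = ⊤ := by
        simpa using o.toBasis.span_eq
      rw [h1, Submodule.span_image, h2, Submodule.map_top, Submodule.range_subtype]
  choose B hB1 hB2 using key
  let b : ι → V := fun i => B (f i) ⟨i, rfl⟩
  have hb : ∀ i t (h : (f i : ℂ) = t), B t ⟨i, h⟩ = b i := by
    rintro i t rfl
    rfl
  have hmem : ∀ i, b i ∈ formEigenspace J (f i) := fun i => by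
    rw [← hB2]
    exact Submodule.subset_span ⟨_, rfl⟩
  have hbo : Orthonormal ℂ b := by
    refine ⟨fun i => (hB1 _).1 _, fun i j hij => ?_⟩
    by_cases h : (f j : ℂ) = f i
    · change ⟪b i, b j⟫_ℂ = 0
      rw [← hb j _ h]
      exact (hB1 _).2 (fun h => hij (congrArg Subtype.val h))
    · exact inner_of_mem_formEigenspace hn (Ne.symm h) (hmem i) (hmem j)
  have hperp : (Submodule.span ℂ (Set.range b))ᗮ = ⊥ := by
    have hS : IsCompactOperator (J.adjoint ∘L J) := by
      rw [ContinuousLinearMap.coe_comp]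
      exact hJ.clm_comp _
    have hsym : (J.adjoint ∘L J).IsSymmetric := fun u v => by
      simp [ContinuousLinearMap.adjoint_inner_left, ContinuousLinearMap.adjoint_inner_right]
    rw [eq_bot_iff, ← ContinuousLinearMap.orthogonalComplement_iSup_eigenspaces_eq_bot hS hsym]
    refine Submodule.orthogonal_le (iSup_le fun s u hu => ?_)
    rw [Module.End.mem_eigenspace_iff] at hu
    -- The kernel of `J.adjoint ∘L J` is that of `J`, hence trivial, so only nonzero `s` contribute.
    by_cases hs : s = 0
    · have h0 : J u = 0 := by
        have : ⟪J u, J u⟫_ℂ = 0 := by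
          rw [← ContinuousLinearMap.adjoint_inner_right]
          have hu' : J.adjoint (J u) = s • u := hu
          rw [hu', hs, zero_smul, inner_zero_right]
        exact inner_self_eq_zero.1 this
      rw [(map_eq_zero_iff J hinj).1 h0]
      exact zero_mem _
    · have := mem_formEigenspace_of_adjoint hs hu
      rw [← hB2] at this
      refine Submodule.span_mono ?_ this
      rintro _ ⟨⟨i, hi⟩, rfl⟩
      exact ⟨i, (hb i _ hi).symm⟩
  refine ⟨HilbertBasis.mkOfOrthogonalEqBot hbo hperp, fun i => ?_⟩
  rw [HilbertBasis.coe_mkOfOrthogonalEqBot]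
  exact hmem i

theorem exists_formEigenvalue_sequence (hJ : IsCompactOperator J)
    (hinj : Function.Injective J) (hn : ∀ u, ‖J u‖ ≤ ‖u‖) (hV : ¬ FiniteDimensional ℂ V) :
    ∃ lam : ℕ → ℝ, Monotone lam ∧
      ∀ t : ℂ, Cardinal.mk {k // (lam k : ℂ) = t} = Module.rank ℂ (formEigenspace J t) := by
  -- Non-eigenvalues contribute the empty type `Fin 0`, so the sum over all real `t` lists each
  -- eigenvalue exactly with its multiplicity.
  let ι := Σ t : ℝ, Fin (Module.finrank ℂ (formEigenspace J t))
  let f : ι → ℝ := Sigma.fst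
  have hf : ∀ t : ℂ, Cardinal.mk {i // (f i : ℂ) = t} = Module.rank ℂ (formEigenspace J t) := by
    intro t
    have := formEigenspace_finiteDimensional hJ t
    by_cases ht : ∃ r : ℝ, t = r
    · obtain ⟨r, rfl⟩ := ht
      rw [← Module.finrank_eq_rank, Cardinal.mk_eq_nat_iff]
      refine ⟨(Equiv.subtypeEquivRight fun i => ?_).trans (Equiv.sigmaSubtype r)⟩
      exact Complex.ofReal_inj
    · have h1 : formEigenspace J t = ⊥ := by
        rw [eq_bot_iff]
        intro u hu
        by_contra h0
        obtain ⟨r, -, hr⟩ := formEigenspace_eigenvalue hn hu h0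
        exact ht ⟨r, hr⟩
      rw [h1, rank_bot, Cardinal.mk_eq_zero_iff]
      exact ⟨fun i => ht ⟨_, i.2.symm⟩⟩
  obtain ⟨b, hb⟩ := exists_hilbertBasis_of_formEigenvalues hJ hinj hn hf
  have hpos : ∀ i, 0 ≤ f i := fun i => by
    obtain ⟨r, hr, h⟩ := formEigenspace_eigenvalue hn (hb i) (b.orthonormal.ne_zero i)
    rw [Complex.ofReal_inj.1 h]
    exact hr
  have : Infinite ι := by
    by_contra hfin
    have : Finite ι := not_infinite_iff_finite.1 hfin
    have := Fintype.ofFinite ι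
    exact hV (Module.Basis.finiteDimensional_of_finite b.toOrthonormalBasis.toBasis)
  obtain ⟨e, he⟩ := exists_monotone_enumeration f
    (finite_setOf_formEigenvalue_le hJ b.orthonormal hb hpos)
  refine ⟨f ∘ e, he, fun t => ?_⟩
  rw [← hf t]
  exact Cardinal.mk_congr (e.subtypeEquiv fun k => Iff.rfl)

/-! ### Parseval expansions and the two Rayleigh bounds behind min-max -/

lemma hasSum_norm_sq_inner {ι : Type*} (b : HilbertBasis ι ℂ V) (w : V) :
    HasSum (fun i => ‖⟪b i, w⟫_ℂ‖ ^ 2) (‖w‖ ^ 2) := by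
  have h := (Complex.hasSum_iff _ _).1 (b.hasSum_inner_mul_inner w w)
  convert h.1 using 1
  · funext i
    rw [← inner_conj_symm w, Complex.conj_mul', ← Complex.ofReal_pow, Complex.ofReal_re]
  · rw [inner_self_eq_norm_sq_to_K, ← RCLike.ofReal_pow]
    rfl

/-- Parseval for the pair `w`, `J.adjoint (J w)`: the eigenvalue equation divides the `i`-th
coefficient of the second vector by `1 + f i`. -/
lemma hasSum_norm_sq_embedding {ι : Type*} (b : HilbertBasis ι ℂ V) {f : ι → ℝ}
    (hb : ∀ i, b i ∈ formEigenspace J (f i)) (hf : ∀ i, 0 ≤ f i) (w : V) :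
    HasSum (fun i => ‖⟪b i, w⟫_ℂ‖ ^ 2 / (1 + f i)) (‖J w‖ ^ 2) := by
  have h := (Complex.hasSum_iff _ _).1 (b.hasSum_inner_mul_inner w ((J.adjoint ∘L J) w))
  convert h.1 using 1
  · funext i
    have h1 : ⟪b i, (J.adjoint ∘L J) w⟫_ℂ = ⟪J (b i), J w⟫_ℂ := by
      rw [ContinuousLinearMap.comp_apply, ContinuousLinearMap.adjoint_inner_right]
    have h2 := hb i w
    have h3 : (1 + (f i : ℂ)) ≠ 0 := by
      have : (1 + f i : ℝ) ≠ 0 := by linarith [hf i]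
      exact_mod_cast this
    have h4 : ⟪J w, J (b i)⟫_ℂ = ⟪w, b i⟫_ℂ / (1 + f i) := by
      rw [h2]; field_simp
    have h5 : ⟪J (b i), J w⟫_ℂ = ⟪b i, w⟫_ℂ / (1 + f i) := by
      rw [← inner_conj_symm (J (b i)), h4, map_div₀, inner_conj_symm, map_add, map_one,
        Complex.conj_ofReal]
    rw [h1, h5, ← inner_conj_symm w, mul_div_assoc', Complex.conj_mul', ← Complex.ofReal_pow,
      ← Complex.ofReal_one, ← Complex.ofReal_add, ← Complex.ofReal_div, Complex.ofReal_re]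
  · rw [ContinuousLinearMap.comp_apply, ContinuousLinearMap.adjoint_inner_right,
      inner_self_eq_norm_sq_to_K, ← RCLike.ofReal_pow]
    rfl

/-- Termwise comparison of the two Parseval series: only `j ≤ k` occur, and there `(1 + lam k) / (1
+ lam j) ≥ 1`. -/
lemma norm_sq_le_of_inner_eq_zero_above {b : HilbertBasis ℕ ℂ V} {lam : ℕ → ℝ}
    (hmono : Monotone lam) (hb : ∀ i, b i ∈ formEigenspace J (lam i)) (hl : ∀ i, 0 ≤ lam i)
    {k : ℕ} {w : V} (hw : ∀ j, k < j → ⟪b j, w⟫_ℂ = 0) :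
    ‖w‖ ^ 2 ≤ (1 + lam k) * ‖J w‖ ^ 2 := by
  refine hasSum_le (fun j => ?_) (hasSum_norm_sq_inner b w)
    ((hasSum_norm_sq_embedding b hb hl w).mul_left (1 + lam k))
  rcases lt_or_ge k j with h | h
  · simp [hw j h]
  · have h1 := hl j
    have h2 := hmono h
    rw [mul_div_assoc', le_div_iff₀ (by linarith), mul_comm]
    gcongr

/-- The opposite comparison. Vanishing against `b 0, …, b k` imposes `k + 1` conditions and leaves
only `j ≥ k + 1`, which is where the index `k + 1` in the final inequality comes from. -/
lemma le_norm_sq_of_inner_eq_zero_below {b : HilbertBasis ℕ ℂ V} {lam : ℕ → ℝ}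
    (hmono : Monotone lam) (hb : ∀ i, b i ∈ formEigenspace J (lam i)) (hl : ∀ i, 0 ≤ lam i)
    {k : ℕ} {w : V} (hw : ∀ j, j ≤ k → ⟪b j, w⟫_ℂ = 0) :
    (1 + lam (k + 1)) * ‖J w‖ ^ 2 ≤ ‖w‖ ^ 2 := by
  refine hasSum_le (fun j => ?_)
    ((hasSum_norm_sq_embedding b hb hl w).mul_left (1 + lam (k + 1))) (hasSum_norm_sq_inner b w)
  rcases le_or_gt j k with h | h
  · simp [hw j h]
  · have h1 := hl j
    have h2 := hmono (Nat.succ_le_of_lt h)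
    rw [mul_div_assoc', div_le_iff₀ (by linarith), mul_comm]
    gcongr

lemma nonneg_of_hilbertBasis_mem_formEigenspace (hn : ∀ u, ‖J u‖ ≤ ‖u‖) {ι : Type*}
    (b : HilbertBasis ι ℂ V) {f : ι → ℝ} (hb : ∀ i, b i ∈ formEigenspace J (f i)) (i : ι) :
    0 ≤ f i := by
  obtain ⟨r, hr, h⟩ := formEigenspace_eigenvalue hn (hb i) (b.orthonormal.ne_zero i)
  rw [Complex.ofReal_inj.1 h]
  exact hr

end FormEigenspace

end MixedLaplacian

noncomputable section

namespace MixedLaplacian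

variable {d : ℕ}

/-! ### Test functions and the Sobolev space -/

section Sobolev

variable {Ω : Set (Space d)}

lemma IsTestFunction.mono {A B : Set (Space d)} (hAB : A ⊆ B) {φ : Space d → ℂ}
    (h : IsTestFunction A φ) : IsTestFunction B φ :=
  ⟨h.contDiff, h.hasCompactSupport, h.tsupport_subset.trans hAB⟩

lemma IsTestFunction.add {φ ψ : Space d → ℂ} (h : IsTestFunction Ω φ) (k : IsTestFunction Ω ψ) :
    IsTestFunction Ω (φ + ψ) :=
  ⟨h.contDiff.add k.contDiff, h.hasCompactSupport.add k.hasCompactSupport,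
    (tsupport_add φ ψ).trans (Set.union_subset h.tsupport_subset k.tsupport_subset)⟩

lemma IsTestFunction.mul_left {φ ψ : Space d → ℂ} (hψ : ContDiff ℝ ∞ ψ)
    (h : IsTestFunction Ω φ) : IsTestFunction Ω (ψ * φ) :=
  ⟨hψ.mul h.contDiff, h.hasCompactSupport.mul_left,
    (tsupport_mul_subset_right).trans h.tsupport_subset⟩

lemma IsTestFunction.smul (c : ℂ) {φ : Space d → ℂ} (h : IsTestFunction Ω φ) :
    IsTestFunction Ω (c • φ) :=
  h.mul_left (ψ := fun _ => c) contDiff_const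

lemma isTestFunction_zero : IsTestFunction Ω (0 : Space d → ℂ) :=
  ⟨contDiff_zero_fun, HasCompactSupport.zero, by simp [tsupport]⟩

lemma contDiff_conj {φ : Space d → ℂ} (h : ContDiff ℝ ∞ φ) :
    ContDiff ℝ ∞ (fun x => starRingEnd ℂ (φ x)) :=
  Complex.conjCLE.contDiff.comp h

lemma IsTestFunction.conj {φ : Space d → ℂ} (h : IsTestFunction Ω φ) :
    IsTestFunction Ω (fun x => starRingEnd ℂ (φ x)) :=
  ⟨contDiff_conj h.contDiff, h.hasCompactSupport.comp_left (map_zero _),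
    (closure_mono (Function.support_comp_subset (map_zero (starRingEnd ℂ)) φ)).trans
      h.tsupport_subset⟩

lemma partialDeriv_conj {φ : Space d → ℂ} (h : ContDiff ℝ ∞ φ) (i : Fin d) :
    partialDeriv i (fun x => starRingEnd ℂ (φ x)) = fun x => starRingEnd ℂ (partialDeriv i φ x) := by
  funext x
  have h1 := (Complex.conjCLE : ℂ ≃L[ℝ] ℂ).hasFDerivAt.comp x
    (h.differentiable (by simp) x).hasFDerivAt
  have h2 : fderiv ℝ (fun x => starRingEnd ℂ (φ x)) x = _ := h1.fderiv
  simp only [partialDeriv]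
  rw [h2]
  rfl

lemma partialDeriv_mul {φ ψ : Space d → ℂ} (h : ContDiff ℝ ∞ φ) (k : ContDiff ℝ ∞ ψ) (i : Fin d)
    (x : Space d) :
    partialDeriv i (φ * ψ) x = partialDeriv i φ x * ψ x + φ x * partialDeriv i ψ x := by
  simp only [partialDeriv]
  rw [fderiv_mul (h.differentiable (by simp) x) (k.differentiable (by simp) x)]
  simp
  ring

lemma contDiff_partialDeriv {φ : Space d → ℂ} (h : ContDiff ℝ ∞ φ) (i : Fin d) :
    ContDiff ℝ ∞ (partialDeriv i φ) :=
  (h.fderiv_right (m := ∞) (by simp)).clm_apply contDiff_const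

lemma IsTestFunction.partialDeriv {φ : Space d → ℂ} (h : IsTestFunction Ω φ) (i : Fin d) :
    IsTestFunction Ω (partialDeriv i φ) :=
  ⟨contDiff_partialDeriv h.contDiff i, h.hasCompactSupport.fderiv_apply ℝ _,
    (tsupport_fderiv_apply_subset ℝ _).trans h.tsupport_subset⟩

lemma laplacian_eq_sum_partialDeriv {φ : Space d → ℂ} (h : ContDiff ℝ ∞ φ) (x : Space d) :
    Laplacian.laplacian φ x = ∑ i, partialDeriv i (partialDeriv i φ) x := by
  rw [InnerProductSpace.laplacian_eq_iteratedFDeriv_orthonormalBasis φ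
    (EuclideanSpace.basisFun (Fin d) ℝ)]
  refine Finset.sum_congr rfl fun i _ => ?_
  have h1 : DifferentiableAt ℝ (fderiv ℝ φ) x :=
    (h.fderiv_right (m := ∞) (by simp)).differentiable (by simp) x
  rw [iteratedFDeriv_two_apply]
  simp only [EuclideanSpace.basisFun_apply, Matrix.cons_val_zero, Matrix.cons_val_one]
  have h2 := (h1.hasFDerivAt.clm_apply (hasFDerivAt_const
    (EuclideanSpace.single i (1 : ℝ) : Space d) x)).fderiv
  show _ = fderiv ℝ (fun y => fderiv ℝ φ y (EuclideanSpace.single i 1)) x _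
  rw [h2]
  simp

lemma inner_L2_eq_integral (u v : L2 Ω) :
    ⟪u, v⟫_ℂ = ∫ x in Ω, v x * starRingEnd ℂ (u x) := by
  rw [L2.inner_def]
  rfl

lemma memLp_of_continuous {μ : Measure (Space d)} [IsFiniteMeasureOnCompacts μ]
    (hb : Bornology.IsBounded Ω) {φ : Space d → ℂ} (hφ : Continuous φ) :
    MemLp φ 2 (μ.restrict Ω) := by
  have hK : IsCompact (closure Ω) := hb.isCompact_closure
  obtain ⟨C, hC⟩ := (hK.image hφ).isBounded.exists_norm_le
  have : IsFiniteMeasure (μ.restrict (closure Ω)) :=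
    isFiniteMeasure_restrict.2 hK.measure_lt_top.ne
  have h : MemLp φ 2 (μ.restrict (closure Ω)) := by
    refine MemLp.of_bound hφ.aestronglyMeasurable C ?_
    filter_upwards [ae_restrict_mem isClosed_closure.measurableSet] with x hx
    exact hC _ ⟨x, hx, rfl⟩
  exact h.mono_measure (Measure.restrict_mono subset_closure le_rfl)

lemma isFiniteMeasure_of_isBounded (hb : Bornology.IsBounded Ω) :
    IsFiniteMeasure (volume.restrict Ω) :=
  isFiniteMeasure_restrict.2 hb.measure_lt_top.ne

/-! ### The Sobolev space as a closed space of jets -/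

/-- The ambient Hilbert space `L²(Ω) × L²(Ω)ᵈ` for pairs of a function and its gradient. -/
abbrev JetSpace (Ω : Set (Space d)) : Type := PiLp 2 (fun _ : Option (Fin d) => L2 Ω)

lemma inner_jet (p q : JetSpace Ω) :
    ⟪p, q⟫_ℂ = ⟪p none, q none⟫_ℂ + ∑ i, ⟪p (some i), q (some i)⟫_ℂ := by
  rw [PiLp.inner_apply, Fintype.sum_option]

lemma norm_sq_jet (p : JetSpace Ω) :
    ‖p‖ ^ 2 = ‖p none‖ ^ 2 + ∑ i, ‖p (some i)‖ ^ 2 := by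
  rw [PiLp.norm_sq_eq_of_L2, Fintype.sum_option]

/-- The projection of a jet to its function component. -/
def jetFst (Ω : Set (Space d)) : JetSpace Ω →L[ℂ] L2 Ω :=
  PiLp.proj 2 (fun _ : Option (Fin d) => L2 Ω) none

lemma norm_jetFst_le (p : JetSpace Ω) : ‖p none‖ ≤ ‖p‖ :=
  PiLp.norm_apply_le p none

lemma continuous_integral_mul {μ : Measure (Space d)} {ψ : Space d → ℂ} (hψ : MemLp ψ 2 μ) :
    Continuous fun u : Lp ℂ 2 μ => ∫ x, u x * ψ x ∂μ := by
  have hψ' : MemLp (fun x => starRingEnd ℂ (ψ x)) 2 μ := hψ.star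
  have : (fun u : Lp ℂ 2 μ => ∫ x, u x * ψ x ∂μ) = fun u => ⟪hψ'.toLp, u⟫_ℂ := by
    funext u
    rw [L2.inner_def]
    refine integral_congr_ae ?_
    filter_upwards [hψ'.coeFn_toLp] with x hx
    rw [hx]
    simp
  rw [this]
  fun_prop

/-- The Sobolev space `H¹(Ω)`, as a space of pairs of a function and its weak gradient. -/
def sobolevSpace (Ω : Set (Space d)) : Submodule ℂ (JetSpace Ω) where
  carrier := {p | HasWeakGradient Ω (p none) fun i => p (some i)}
  zero_mem' := hasWeakGradient_zero
  add_mem' := fun h k => h.add k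
  smul_mem' := fun c _ h => h.smul c

lemma mem_sobolevSpace {p : JetSpace Ω} :
    p ∈ sobolevSpace Ω ↔ HasWeakGradient Ω (p none) fun i => p (some i) := Iff.rfl

/-- For a fixed test function the weak-derivative identity is a closed condition on the jet, so
H¹(Ω) is an intersection of closed sets. This supplies its completeness. -/
lemma isClosed_sobolevSpace : IsClosed (sobolevSpace Ω : Set (JetSpace Ω)) := by
  have : (sobolevSpace Ω : Set (JetSpace Ω)) = ⋂ (φ) (_ : IsTestFunction Ω φ) (i : Fin d),
      {p : JetSpace Ω | ∫ x in Ω, (p none) x * partialDeriv i φ x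
        = -∫ x in Ω, (p (some i)) x * φ x} := by
    ext p
    simp only [Set.mem_iInter]
    rfl
  rw [this]
  refine isClosed_iInter fun φ => isClosed_iInter fun hφ => isClosed_iInter fun i => ?_
  refine isClosed_eq ?_ ?_
  · exact (continuous_integral_mul (hφ.memLp_partialDeriv i)).comp
      (PiLp.continuous_apply 2 (fun _ : Option (Fin d) => L2 Ω) none)
  · exact ((continuous_integral_mul hφ.memLp).comp
      (PiLp.continuous_apply 2 (fun _ : Option (Fin d) => L2 Ω) (some i))).neg

lemma ae_eq_zero_of_integral_test {A : Set (Space d)} (hA : IsOpen A) {f : Space d → ℂ}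
    (hf : MemLp f 2 (volume.restrict A))
    (h : ∀ φ, IsTestFunction A φ → ∫ x in A, f x * φ x = 0) : f =ᵐ[volume.restrict A] 0 := by
  have hloc : LocallyIntegrableOn f A := by
    rw [locallyIntegrableOn_iff hA.isLocallyClosed]
    intro K hKA hK
    have : IsFiniteMeasure (volume.restrict K) := isFiniteMeasure_restrict.2 hK.measure_lt_top.ne
    exact (hf.mono_measure (Measure.restrict_mono hKA le_rfl)).integrable one_le_two
  have := hA.ae_eq_zero_of_integral_contDiff_smul_eq_zero hloc fun g hg hgc hgs => by
    have hφ : IsTestFunction A fun x => (g x : ℂ) :=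
      ⟨Complex.ofRealCLM.contDiff.comp hg, hgc.comp_left Complex.ofReal_zero,
        (closure_mono (Function.support_comp_subset Complex.ofReal_zero g)).trans hgs⟩
    rw [← h _ hφ, ← setIntegral_eq_integral_of_forall_compl_eq_zero (s := A)]
    · refine integral_congr_ae (Eventually.of_forall fun x => ?_)
      simp [mul_comm]
    · intro x hx
      rw [image_eq_zero_of_notMem_tsupport fun hx' => hx (hgs hx'), zero_smul]
  rw [Filter.EventuallyEq, ae_restrict_iff' hA.measurableSet]
  exact this

/-- The test functions as a subspace of `L²`. -/
def testSpace (A : Set (Space d)) : Submodule ℂ (L2 A) where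
  carrier := {f | ∃ φ, IsTestFunction A φ ∧ f =ᵐ[volume.restrict A] φ}
  zero_mem' := ⟨0, isTestFunction_zero, Lp.coeFn_zero _ _ _⟩
  add_mem' := by
    rintro f g ⟨φ, hφ, hf⟩ ⟨ψ, hψ, hg⟩
    exact ⟨φ + ψ, hφ.add hψ, (Lp.coeFn_add f g).trans (hf.add hg)⟩
  smul_mem' := by
    rintro c f ⟨φ, hφ, hf⟩
    exact ⟨c • φ, hφ.smul c, (Lp.coeFn_smul c f).trans (hf.const_smul c)⟩

/-- The orthogonal complement is trivial by the fundamental lemma of the calculus of variations. -/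
lemma dense_testSpace {A : Set (Space d)} (hA : IsOpen A) :
    Dense (testSpace A : Set (L2 A)) := by
  rw [Submodule.dense_iff_topologicalClosure_eq_top, Submodule.topologicalClosure_eq_top_iff,
    eq_bot_iff]
  intro f hf
  refine Lp.eq_zero_iff_ae_eq_zero.2 (ae_eq_zero_of_integral_test hA (Lp.memLp f) fun φ hφ => ?_)
  have h := (Submodule.mem_orthogonal _ _).1 hf hφ.conj.memLp.toLp
    ⟨_, hφ.conj, MemLp.coeFn_toLp _⟩
  rw [← h, inner_L2_eq_integral]
  refine integral_congr_ae ?_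
  filter_upwards [hφ.conj.memLp.coeFn_toLp] with x hx
  rw [hx, Complex.conj_conj]

/-- An `L²`-norm is determined by testing with `C_c^∞`. -/
lemma norm_le_of_forall_integral_test {A : Set (Space d)} (hA : IsOpen A) (D : L2 A) {M : ℝ}
    (hM : 0 ≤ M)
    (h : ∀ φ (hφ : IsTestFunction A φ), ‖∫ x in A, D x * φ x‖ ≤ M * ‖hφ.memLp.toLp‖) :
    ‖D‖ ≤ M := by
  have h1 : ∀ f ∈ testSpace A, ‖⟪f, D⟫_ℂ‖ ≤ M * ‖f‖ := by
    rintro f ⟨φ, hφ, hf⟩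
    have h2 := h _ hφ.conj
    have h3 : ⟪f, D⟫_ℂ = ∫ x in A, D x * starRingEnd ℂ (φ x) := by
      rw [inner_L2_eq_integral]
      refine integral_congr_ae ?_
      filter_upwards [hf] with x hx
      rw [hx]
    have h4 : ‖hφ.conj.memLp.toLp‖ = ‖f‖ := by
      rw [Lp.norm_toLp, Lp.norm_def]
      congr 1
      refine eLpNorm_congr_norm_ae ?_
      filter_upwards [hf] with x hx
      rw [hx, RCLike.norm_conj]
    rwa [h3, ← h4]
  have h2 : ∀ f : L2 A, ‖⟪f, D⟫_ℂ‖ ≤ M * ‖f‖ := by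
    intro f
    have hcl : IsClosed {f : L2 A | ‖⟪f, D⟫_ℂ‖ ≤ M * ‖f‖} :=
      isClosed_le (by fun_prop) (by fun_prop)
    exact hcl.closure_subset_iff.2 h1 (dense_testSpace hA f)
  by_cases hD : ‖D‖ = 0
  · rwa [hD]
  · have h3 := h2 D
    rw [inner_self_eq_norm_sq_to_K, norm_pow, RCLike.norm_ofReal, abs_norm, sq] at h3
    exact le_of_mul_le_mul_right h3 (lt_of_le_of_ne (norm_nonneg _) (Ne.symm hD))

lemma hasWeakGradient_unique (hΩ : IsOpen Ω) {u : L2 Ω} {g k : Fin d → L2 Ω}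
    (hg : HasWeakGradient Ω u g) (hk : HasWeakGradient Ω u k) : g = k := by
  funext i
  have h := ae_eq_zero_of_integral_test hΩ (Lp.memLp (g i - k i)) fun φ hφ => by
    have h1 := hg φ hφ i
    have h2 := hk φ hφ i
    have h3 := integral_add_mul hφ.memLp (g i) ((-1 : ℂ) • k i)
    rw [integral_smul_mul] at h3
    rw [sub_eq_add_neg, ← neg_one_smul ℂ (k i), h3]
    rw [h1] at h2
    linear_combination -h2
  rw [← sub_eq_zero]
  exact Lp.eq_zero_iff_ae_eq_zero.2 h

lemma injective_sobolev_fst (hΩ : IsOpen Ω) {p q : JetSpace Ω} (hp : p ∈ sobolevSpace Ω)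
    (hq : q ∈ sobolevSpace Ω) (h : p none = q none) : p = q := by
  have h1 := mem_sobolevSpace.1 hp
  rw [h] at h1
  have h2 := hasWeakGradient_unique hΩ h1 (mem_sobolevSpace.1 hq)
  refine PiLp.ext fun j => ?_
  cases j with
  | none => exact h
  | some i => exact congrFun h2 i

/-! ### Jets of smooth functions -/

/-- The jet with function component `u` and gradient component `g`. -/
def mkJet (u : L2 Ω) (g : Fin d → L2 Ω) : JetSpace Ω :=
  WithLp.toLp 2 fun j => j.elim u g

/-- The jet of a function which is smooth on the whole space. -/
def smoothJet (hb : Bornology.IsBounded Ω) {φ : Space d → ℂ} (hφ : ContDiff ℝ ∞ φ) : JetSpace Ω :=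
  mkJet ((memLp_of_continuous (μ := volume) hb hφ.continuous).toLp φ)
    fun i => (memLp_of_continuous (μ := volume) hb (continuous_partialDeriv hφ i)).toLp
      (partialDeriv i φ)

lemma smoothJet_none (hb : Bornology.IsBounded Ω) {φ : Space d → ℂ} (hφ : ContDiff ℝ ∞ φ) :
    smoothJet hb hφ none =ᵐ[volume.restrict Ω] φ :=
  (memLp_of_continuous (μ := volume) hb hφ.continuous).coeFn_toLp

lemma smoothJet_some (hb : Bornology.IsBounded Ω) {φ : Space d → ℂ} (hφ : ContDiff ℝ ∞ φ)
    (i : Fin d) : smoothJet hb hφ (some i) =ᵐ[volume.restrict Ω] partialDeriv i φ :=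
  (memLp_of_continuous (μ := volume) hb (continuous_partialDeriv hφ i)).coeFn_toLp

lemma IsTestFunction.eq_zero_of_notMem {φ : Space d → ℂ} (h : IsTestFunction Ω φ) (x : Space d)
    (hx : x ∉ Ω) : φ x = 0 :=
  image_eq_zero_of_notMem_tsupport fun hx' => hx (h.tsupport_subset hx')

lemma setIntegral_mul_eq_integral_mul {f g ψ : Space d → ℂ} (hfg : f =ᵐ[volume.restrict Ω] g)
    (hψ : ∀ x, x ∉ Ω → ψ x = 0) : ∫ x in Ω, f x * ψ x = ∫ x, g x * ψ x := by
  refine Eq.trans (integral_congr_ae ?_)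
    (setIntegral_eq_integral_of_forall_compl_eq_zero fun x hx => ?_)
  · filter_upwards [hfg] with x hx
    rw [hx]
  · rw [hψ x hx, mul_zero]

lemma smoothJet_mem_sobolevSpace (hb : Bornology.IsBounded Ω) {φ : Space d → ℂ}
    (hφ : ContDiff ℝ ∞ φ) : smoothJet hb hφ ∈ sobolevSpace Ω := by
  intro ψ hψ i
  have h1 := setIntegral_mul_eq_integral_mul (smoothJet_none hb hφ)
    (hψ.partialDeriv i).eq_zero_of_notMem
  have h2 := setIntegral_mul_eq_integral_mul (smoothJet_some hb hφ i) hψ.eq_zero_of_notMem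
  rw [h1, h2]
  -- The test function has compact support in `Ω`, so both integrals extend to the whole space,
  -- where there is no boundary term.
  refine integral_mul_fderiv_eq_neg_fderiv_mul_of_integrable ?_ ?_ ?_
    (fun x _ => hφ.differentiable (by simp) x) (fun x _ => hψ.contDiff.differentiable (by simp) x)
  · exact ((continuous_partialDeriv hφ i).mul
      hψ.contDiff.continuous).integrable_of_hasCompactSupport hψ.hasCompactSupport.mul_left
  · exact (hφ.continuous.mul
      (continuous_partialDeriv hψ.contDiff i)).integrable_of_hasCompactSupport
      (hψ.partialDeriv i).hasCompactSupport.mul_left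
  · exact (hφ.continuous.mul
      hψ.contDiff.continuous).integrable_of_hasCompactSupport hψ.hasCompactSupport.mul_left

end Sobolev

end MixedLaplacian

end

noncomputable section

namespace MixedLaplacian

variable {d : ℕ}

/-! ### Compactness of the Sobolev embedding -/

section Rellich

/-- `J u` is orthogonal to `F` exactly when `u` is orthogonal to the span of `J.adjoint '' F`.
Composing `J` with the projection to this finite-dimensional span therefore approximates `J` in
operator norm by compact operators. -/
lemma isCompactOperator_of_forall_finite_orthogonal {V H : Type*} [NormedAddCommGroup V]
    [InnerProductSpace ℂ V] [CompleteSpace V] [NormedAddCommGroup H] [InnerProductSpace ℂ H]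
    [CompleteSpace H] (J : V →L[ℂ] H)
    (h : ∀ ε > 0, ∃ F : Set H, F.Finite ∧ ∀ u, (∀ f ∈ F, ⟪f, J u⟫_ℂ = 0) → ‖J u‖ ≤ ε * ‖u‖) :
    IsCompactOperator J := by
  have hcl : IsClosed {T : V →L[ℂ] H | IsCompactOperator T} := isClosed_setOfPred_isCompactOperator
  have hmem : J ∈ closure {T : V →L[ℂ] H | IsCompactOperator T} := by
    rw [Metric.mem_closure_iff]
    intro ε hε
    obtain ⟨F, hF, hFu⟩ := h (ε / 2) (by positivity)
    let U : Submodule ℂ V := Submodule.span ℂ (J.adjoint '' F)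
    have hfin : FiniteDimensional ℂ U := FiniteDimensional.span_of_finite ℂ (hF.image _)
    have hproper : ProperSpace U := FiniteDimensional.proper ℂ U
    refine ⟨J ∘L U.starProjection, ?_, ?_⟩
    · have h1 : IsCompactOperator (U.orthogonalProjectionOnto : V →L[ℂ] U) :=
        isCompactOperator_of_locallyCompactSpace_dom _
      have h2 := h1.clm_comp (J ∘L U.subtypeL)
      exact h2
    · rw [dist_eq_norm]
      refine lt_of_le_of_lt (ContinuousLinearMap.opNorm_le_bound _ (half_pos hε).le fun u => ?_)
        (half_lt_self hε)
      have h1 : u - U.starProjection u ∈ Uᗮ := U.sub_starProjection_mem_orthogonal u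
      have h2 : ‖u - U.starProjection u‖ ≤ ‖u‖ := by
        have h3 := Submodule.norm_sq_eq_add_norm_sq_starProjection u U
        have h4 : u - U.starProjection u = Uᗮ.starProjection u := by
          rw [Submodule.starProjection_orthogonal]
          rfl
        rw [h4]
        exact abs_le_of_sq_le_sq' (by nlinarith [sq_nonneg ‖U.starProjection u‖]) (norm_nonneg _)
          |>.2
      have h3 : (J - J ∘L U.starProjection) u = J (u - U.starProjection u) := by simp
      rw [h3]
      refine (hFu _ fun f hf => ?_).trans (by gcongr)
      rw [← ContinuousLinearMap.adjoint_inner_left]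
      exact h1 _ (Submodule.subset_span ⟨f, hf, rfl⟩)
  rw [hcl.closure_eq] at hmem
  exact hmem

variable {Ω : Set (Space d)}

/-- Near a boundary point, moving along `-z` with `z` close to `e` lowers the height faster than a
`K`-Lipschitz graph can fall. This cone condition is the only boundary regularity used for
compactness. -/
lemma exists_uniform_cone (hΩ : IsBoundedLipschitzDomain Ω) {x₀ : Space d} (hx₀ : x₀ ∈ closure Ω) :
    ∃ B : Set (Space d), IsOpen B ∧ x₀ ∈ B ∧ ∃ (e : Space d) (ρ r : ℝ), 0 < ρ ∧ 0 < r ∧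
      ∀ x ∈ Ω ∩ B, ∀ z ∈ Metric.ball e ρ, ∀ t ∈ Set.Icc 0 r, x - t • z ∈ Ω := by
  by_cases hx : x₀ ∈ Ω
  · obtain ⟨δ, hδ, hball⟩ := Metric.isOpen_iff.1 hΩ.isOpen x₀ hx
    refine ⟨Metric.ball x₀ (δ / 2), Metric.isOpen_ball, Metric.mem_ball_self (by positivity), 0, 1,
      δ / 2, one_pos, by positivity, fun x hx z hz t ht => hball ?_⟩
    have h1 := Metric.mem_ball.1 hx.2
    have h2 : ‖z‖ < 1 := by simpa using hz
    rw [Metric.mem_ball, dist_eq_norm]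
    rw [dist_eq_norm] at h1
    have h3 : ‖t • z‖ ≤ δ / 2 := by
      rw [norm_smul, Real.norm_of_nonneg ht.1]
      nlinarith [ht.1, ht.2, norm_nonneg z]
    calc ‖x - t • z - x₀‖ = ‖(x - x₀) - t • z‖ := by congr 1; abel
      _ ≤ ‖x - x₀‖ + ‖t • z‖ := norm_sub_le _ _
      _ < δ := by linarith
  · have hfr : x₀ ∈ frontier Ω := ⟨hx₀, by rwa [hΩ.isOpen.interior_eq]⟩
    obtain ⟨U, hU, hxU, e, he, K, h, hK, hgraph⟩ := hΩ.locally_graph x₀ hfr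
    obtain ⟨δ, hδ, hball⟩ := Metric.isOpen_iff.1 hU x₀ hxU
    -- The radius `1 / (K + 1)` ensures `K * ‖z - e‖ ≤ 1 - ‖z - e‖ ≤ ⟪e, z⟫`. Since `‖z‖ ≤ 2`, the
    -- length `δ / 4` keeps the segment within `δ / 2` of its start, hence inside the chart.
    refine ⟨Metric.ball x₀ (δ / 2), Metric.isOpen_ball, Metric.mem_ball_self (by positivity), e,
      1 / (K + 1), δ / 4, by positivity, by positivity, fun x hx z hz t ht => ?_⟩
    have h1 := Metric.mem_ball.1 hx.2
    rw [dist_eq_norm] at h1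
    rw [Metric.mem_ball, dist_eq_norm, lt_div_iff₀ (by positivity)] at hz
    have hze : ‖z - e‖ ≤ 1 := by nlinarith [norm_nonneg (z - e), K.2]
    have h2 : ‖z‖ ≤ 2 := by
      calc ‖z‖ = ‖(z - e) + e‖ := by congr 1; abel
        _ ≤ ‖z - e‖ + ‖e‖ := norm_add_le _ _
        _ ≤ 2 := by rw [he]; linarith
    have h3 : ‖t • z‖ ≤ δ / 2 := by
      rw [norm_smul, Real.norm_of_nonneg ht.1]
      nlinarith [ht.1, ht.2, norm_nonneg z]
    have hyU : x - t • z ∈ U := by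
      refine hball ?_
      rw [Metric.mem_ball, dist_eq_norm]
      calc ‖x - t • z - x₀‖ = ‖(x - x₀) - t • z‖ := by congr 1; abel
        _ ≤ ‖x - x₀‖ + ‖t • z‖ := norm_sub_le _ _
        _ < δ := by linarith
    have hxU' : x ∈ U := hball (Metric.ball_subset_ball (by linarith) hx.2)
    rw [hgraph _ hyU]
    have h4 := (hgraph _ hxU').1 hx.1
    set P := (ℝ ∙ e)ᗮ.orthogonalProjectionOnto with hP
    have h5 : P e = 0 := Submodule.orthogonalProjectionOnto_orthogonalComplement_singleton_eq_zero e
    have h6 : P z = P (z - e) := by rw [map_sub, h5, sub_zero]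
    have h7 : ‖P z‖ ≤ ‖z - e‖ := by
      rw [h6]; exact Submodule.norm_orthogonalProjectionOnto_apply_le _ _
    have h8 : dist (h (P (x - t • z))) (h (P x)) ≤ K * (t * ‖z - e‖) := by
      refine (hK.dist_le_mul _ _).trans ?_
      gcongr
      rw [dist_eq_norm, map_sub, map_smul, sub_sub_cancel_left, norm_neg, norm_smul,
        Real.norm_of_nonneg ht.1]
      exact mul_le_mul_of_nonneg_left h7 ht.1
    have h9 : 1 - ‖z - e‖ ≤ ⟪e, z⟫_ℝ := by
      have h10 : ⟪e, z⟫_ℝ = 1 + ⟪e, z - e⟫_ℝ := by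
        rw [inner_sub_right, real_inner_self_eq_norm_sq, he]; ring
      have h11 := abs_real_inner_le_norm e (z - e)
      rw [he, one_mul] at h11
      linarith [neg_abs_le ⟪e, z - e⟫_ℝ]
    rw [inner_sub_right, inner_smul_right]
    have h12 := abs_le.1 (Real.dist_eq (h (P (x - t • z))) (h (P x)) ▸ h8)
    have h13 : t * (1 - ‖z - e‖) ≤ t * ⟪e, z⟫_ℝ := mul_le_mul_of_nonneg_left h9 ht.1
    have h14 : 0 ≤ t * (1 - (K + 1) * ‖z - e‖) := mul_nonneg ht.1 (by nlinarith)
    nlinarith [h12.1]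

lemma IsTestFunction.translate {A : Set (Space d)} {φ : Space d → ℂ} (h : IsTestFunction A φ)
    {y : Space d} (hy : ∀ x ∈ A, x - y ∈ Ω) : IsTestFunction Ω fun x => φ (x + y) := by
  refine ⟨h.contDiff.comp (contDiff_id.add contDiff_const),
    h.hasCompactSupport.comp_homeomorph (Homeomorph.addRight y), ?_⟩
  have h1 := tsupport_comp_eq_preimage φ (Homeomorph.addRight y)
  intro x hx
  have hx' : x ∈ Homeomorph.addRight y ⁻¹' tsupport φ := by
    rw [← h1]; exact hx
  have := hy _ (h.tsupport_subset hx')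
  simpa using this

lemma fderiv_apply_eq_sum_partialDeriv (φ : Space d → ℂ) (x w : Space d) :
    fderiv ℝ φ x w = ∑ i, (w i : ℂ) * partialDeriv i φ x := by
  have hw : w = ∑ i, w i • (EuclideanSpace.single i (1 : ℝ) : Space d) := by
    have := (EuclideanSpace.basisFun (Fin d) ℝ).sum_repr w
    simpa using this.symm
  conv_lhs => rw [hw]
  rw [map_sum]
  refine Finset.sum_congr rfl fun i _ => ?_
  rw [map_smul, Complex.real_smul]
  rfl

lemma norm_integral_mul_le {μ : Measure (Space d)} {ψ : Space d → ℂ} (hψ : MemLp ψ 2 μ)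
    (u : Lp ℂ 2 μ) : ‖∫ x, u x * ψ x ∂μ‖ ≤ ‖u‖ * ‖hψ.toLp‖ := by
  have hψ' : MemLp (fun x => starRingEnd ℂ (ψ x)) 2 μ := hψ.star
  have h1 : ∫ x, u x * ψ x ∂μ = ⟪hψ'.toLp, u⟫_ℂ := by
    rw [L2.inner_def]
    refine integral_congr_ae ?_
    filter_upwards [hψ'.coeFn_toLp] with x hx
    rw [hx]
    simp
  have h2 : ‖hψ'.toLp‖ = ‖hψ.toLp‖ := by
    rw [Lp.norm_toLp, Lp.norm_toLp]
    congr 1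
    refine eLpNorm_congr_norm_ae (Eventually.of_forall fun x => ?_)
    simp
  rw [h1, ← h2, mul_comm]
  exact norm_inner_le_norm _ _

lemma norm_toLp_translate_le {A : Set (Space d)} {φ : Space d → ℂ} (h : IsTestFunction A φ)
    {y : Space d} (hy : ∀ x ∈ A, x - y ∈ Ω) :
    ‖(h.translate hy).memLp.toLp‖ ≤ ‖h.memLp.toLp‖ := by
  rw [Lp.norm_toLp, Lp.norm_toLp]
  refine ENNReal.toReal_mono h.memLp.eLpNorm_ne_top ?_
  have hmp : MeasurePreserving (fun x : Space d => x + y) volume volume :=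
    measurePreserving_add_right volume y
  calc eLpNorm (fun x => φ (x + y)) 2 (volume.restrict Ω)
      ≤ eLpNorm (fun x => φ (x + y)) 2 volume := eLpNorm_mono_measure _ Measure.restrict_le_self
    _ = eLpNorm φ 2 volume :=
        eLpNorm_comp_measurePreserving h.contDiff.continuous.aestronglyMeasurable hmp
    _ = eLpNorm φ 2 (volume.restrict A) := by
        rw [eLpNorm_restrict_eq_of_support_subset]
        exact (subset_tsupport φ).trans h.tsupport_subset

/-- The weak form of ‖u - u(· - w)‖ ≤ C‖w‖‖∇u‖. The test function is moved along `θ • w`, and the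
derivative in `θ` is passed to the weak gradient. By `hw` each translate is again a test function on
`Ω`. The factor `d` comes from bounding every coordinate of `w` by `‖w‖`. -/
lemma norm_integral_translate_sub_le (hb : Bornology.IsBounded Ω) {A : Set (Space d)}
    {p : JetSpace Ω} (hp : p ∈ sobolevSpace Ω) {w : Space d}
    (hw : ∀ x ∈ A, ∀ θ ∈ Set.Icc (0 : ℝ) 1, x - θ • w ∈ Ω) {φ : Space d → ℂ}
    (hφ : IsTestFunction A φ) :
    ‖(∫ x in Ω, p none x * φ (x + w)) - ∫ x in Ω, p none x * φ x‖ ≤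
      d * ‖w‖ * ‖p‖ * ‖hφ.memLp.toLp‖ := by
  have := isFiniteMeasure_of_isBounded hb
  have hdiff : Continuous (fderiv ℝ φ) := hφ.contDiff.continuous_fderiv (by simp)
  obtain ⟨C, hC⟩ := (hφ.hasCompactSupport.fderiv ℝ).exists_bound_of_continuous hdiff
  obtain ⟨C', hC'⟩ := hφ.hasCompactSupport.exists_bound_of_continuous hφ.contDiff.continuous
  have hu : Integrable (p none) (volume.restrict Ω) := (Lp.memLp (p none)).integrable one_le_two
  have hderiv : ∀ θ : ℝ, HasDerivAt (fun θ : ℝ => ∫ x in Ω, p none x * φ (x + θ • w))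
      (∫ x in Ω, p none x * fderiv ℝ φ (x + θ • w) w) θ := by
    intro θ
    refine (hasDerivAt_integral_of_dominated_loc_of_deriv_le
      (F := fun θ x => p none x * φ (x + θ • w))
      (F' := fun θ x => p none x * fderiv ℝ φ (x + θ • w) w)
      (bound := fun x => ‖p none x‖ * (C * ‖w‖)) univ_mem ?_ ?_ ?_ ?_ ?_ ?_).2
    · refine Eventually.of_forall fun θ => hu.aestronglyMeasurable.mul ?_
      exact (hφ.contDiff.continuous.comp (by fun_prop)).aestronglyMeasurable
    · refine hu.mul_bdd (c := C') (hφ.contDiff.continuous.comp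
        (by fun_prop)).aestronglyMeasurable (Eventually.of_forall fun x => hC' _)
    · refine hu.aestronglyMeasurable.mul ?_
      exact Continuous.aestronglyMeasurable
        ((hdiff.comp (by fun_prop : Continuous fun x : Space d => x + θ • w)).clm_apply
          continuous_const)
    · refine Eventually.of_forall fun x θ _ => ?_
      rw [norm_mul]
      gcongr
      exact (ContinuousLinearMap.le_opNorm _ _).trans (by gcongr; exact hC _)
    · exact hu.norm.mul_const _
    · refine Eventually.of_forall fun x θ _ => HasDerivAt.const_mul _ ?_
      have h1 : HasFDerivAt φ (fderiv ℝ φ (x + θ • w)) (x + θ • w) :=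
        (hφ.contDiff.differentiable (by simp) _).hasFDerivAt
      have h2 : HasDerivAt (fun θ : ℝ => x + θ • w) w θ := by
        simpa using ((hasDerivAt_id θ).smul_const w).const_add x
      exact h1.comp_hasDerivAt θ h2
  have hbound : ∀ θ ∈ Set.Ico (0 : ℝ) 1,
      ‖∫ x in Ω, p none x * fderiv ℝ φ (x + θ • w) w‖ ≤
        d * ‖w‖ * ‖p‖ * ‖hφ.memLp.toLp‖ := by
    intro θ hθ
    have hy : ∀ x ∈ A, x - θ • w ∈ Ω := fun x hx => hw x hx θ ⟨hθ.1, hθ.2.le⟩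
    have ht := hφ.translate hy
    have hpd : ∀ i x, partialDeriv i φ (x + θ • w) = partialDeriv i (fun x => φ (x + θ • w)) x := by
      intro i x
      simp only [partialDeriv]
      rw [fderiv_comp_add_right]
    have h1 : ∫ x in Ω, p none x * fderiv ℝ φ (x + θ • w) w =
        -∑ i, (w i : ℂ) * ∫ x in Ω, p (some i) x * φ (x + θ • w) := by
      have h2 : ∀ x, p none x * fderiv ℝ φ (x + θ • w) w = ∑ i, (w i : ℂ) *
          (p none x * partialDeriv i (fun x => φ (x + θ • w)) x) := by
        intro x
        rw [fderiv_apply_eq_sum_partialDeriv, Finset.mul_sum]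
        refine Finset.sum_congr rfl fun i _ => ?_
        rw [hpd]
        ring
      simp_rw [h2]
      rw [integral_finsetSum]
      · rw [← Finset.sum_neg_distrib]
        refine Finset.sum_congr rfl fun i _ => ?_
        rw [integral_const_mul, hp _ ht i]
        ring
      · intro i _
        exact ((Lp.memLp (p none)).integrable_mul (ht.memLp_partialDeriv i)).const_mul _
    rw [h1, norm_neg]
    calc ‖∑ i, (w i : ℂ) * ∫ x in Ω, p (some i) x * φ (x + θ • w)‖
        ≤ ∑ i : Fin d, ‖w‖ * (‖p‖ * ‖hφ.memLp.toLp‖) := by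
          refine norm_sum_le_of_le _ fun i _ => ?_
          rw [norm_mul, Complex.norm_real]
          refine mul_le_mul (PiLp.norm_apply_le w i) ?_ (norm_nonneg _) (norm_nonneg _)
          refine (norm_integral_mul_le ht.memLp (p (some i))).trans ?_
          exact mul_le_mul (PiLp.norm_apply_le p _) (norm_toLp_translate_le hφ hy) (norm_nonneg _)
            (norm_nonneg _)
      _ = d * ‖w‖ * ‖p‖ * ‖hφ.memLp.toLp‖ := by
          rw [Finset.sum_const, Finset.card_univ, Fintype.card_fin, nsmul_eq_mul]
          ring
  have := norm_image_sub_le_of_norm_deriv_le_segment_01'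
    (fun θ _ => (hderiv θ).hasDerivWithinAt) hbound
  simpa using this

/-- By duality against test functions on `A`, the weak bound becomes an L² bound for the difference.
-/
lemma lintegral_translate_sub_le (hb : Bornology.IsBounded Ω) {A : Set (Space d)} (hA : IsOpen A)
    {p : JetSpace Ω} (hp : p ∈ sobolevSpace Ω) {w : Space d}
    (hw : ∀ x ∈ A, ∀ θ ∈ Set.Icc (0 : ℝ) 1, x - θ • w ∈ Ω) :
    ∫⁻ x in A, ‖p none x - p none (x - w)‖ₑ ^ 2 ≤ ENNReal.ofReal ((d * ‖w‖ * ‖p‖) ^ 2) := by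
  have hAΩ : A ⊆ Ω := fun x hx => by simpa using hw x hx 0 (by simp)
  have hAw : ∀ x ∈ A, x - w ∈ Ω := fun x hx => by simpa using hw x hx 1 (by simp)
  have h1 : MemLp (p none) 2 (volume.restrict A) :=
    (Lp.memLp (p none)).mono_measure (Measure.restrict_mono hAΩ le_rfl)
  have hmp : MeasurePreserving (fun x : Space d => x - w) volume volume :=
    measurePreserving_sub_right volume w
  have hemb : MeasurableEmbedding (fun x : Space d => x - w) :=
    (Homeomorph.subRight w).measurableEmbedding
  have h2 : MemLp (fun x => p none (x - w)) 2 (volume.restrict A) := by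
    have h3 := (Lp.memLp (p none)).comp_measurePreserving
      (hmp.restrict_preimage_emb hemb Ω)
    exact h3.mono_measure (Measure.restrict_mono hAw le_rfl)
  have hD := h1.sub h2
  have hnorm : ‖hD.toLp‖ ≤ d * ‖w‖ * ‖p‖ := by
    refine norm_le_of_forall_integral_test hA _ (by positivity) fun φ hφ => ?_
    refine le_trans (le_of_eq ?_) (norm_integral_translate_sub_le hb hp hw hφ)
    rw [norm_sub_rev]
    congr 1
    have h4 : ∫ x in A, p none x * φ x = ∫ x in Ω, p none x * φ x := by
      rw [setIntegral_mul_eq_integral_mul EventuallyEq.rfl hφ.eq_zero_of_notMem,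
        setIntegral_mul_eq_integral_mul EventuallyEq.rfl (hφ.mono hAΩ).eq_zero_of_notMem]
    have h5 : ∫ x in A, p none (x - w) * φ x = ∫ x in Ω, p none x * φ (x + w) := by
      rw [setIntegral_mul_eq_integral_mul (f := fun x => p none (x - w)) EventuallyEq.rfl
        hφ.eq_zero_of_notMem, setIntegral_mul_eq_integral_mul EventuallyEq.rfl
        (hφ.translate hAw).eq_zero_of_notMem,
        ← integral_add_right_eq_self (fun x => p none (x - w) * φ x) w]
      simp
    rw [← h4, ← h5, ← integral_sub]
    · refine integral_congr_ae ?_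
      filter_upwards [hD.coeFn_toLp] with x hx
      rw [hx]
      simp [sub_mul]
    · exact h1.integrable_mul hφ.memLp
    · exact h2.integrable_mul hφ.memLp
  have h3 : ∫⁻ x in A, ‖p none x - p none (x - w)‖ₑ ^ 2
      = eLpNorm (fun x => p none x - p none (x - w)) 2 (volume.restrict A) ^ 2 := by
    rw [eLpNorm_eq_lintegral_rpow_enorm_toReal (by norm_num) (by norm_num)]
    rw [← ENNReal.rpow_natCast _ 2, ← ENNReal.rpow_mul]
    simp
  rw [h3, ENNReal.ofReal_pow (by positivity)]
  gcongr
  change eLpNorm (⇑(p none) - fun x => p none (x - w)) 2 (volume.restrict A) ≤ _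
  rw [← ENNReal.ofReal_toReal hD.eLpNorm_ne_top, ← Lp.norm_toLp _ hD]
  exact ENNReal.ofReal_le_ofReal hnorm

end Rellich

end MixedLaplacian

end

noncomputable section

namespace MixedLaplacian

variable {d : ℕ}

/-! ### Functions with vanishing local means and Rellich's theorem -/

section Rellich

variable {Ω : Set (Space d)}

/-- Expanding |a - u|², the mixed term integrates to zero and the term |u|² is dropped. -/
lemma measure_univ_mul_enorm_sq_le {α : Type*} [MeasurableSpace α] {ν : Measure α}
    [IsFiniteMeasure ν] {u : α → ℂ} (hu : MemLp u 2 ν) (h0 : ∫ y, u y ∂ν = 0) (a : ℂ) :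
    ν Set.univ * ‖a‖ₑ ^ 2 ≤ ∫⁻ y, ‖a - u y‖ₑ ^ 2 ∂ν := by
  have hint : Integrable u ν := hu.integrable one_le_two
  have hsq : Integrable (fun y => ‖a - u y‖ ^ 2) ν :=
    ((memLp_const a).sub hu).integrable_norm_pow two_ne_zero
  have hre : Integrable (fun y => (starRingEnd ℂ a * u y).re) ν := (hint.const_mul _).re
  have h1 : ∫ y, (‖a‖ ^ 2 - 2 * (starRingEnd ℂ a * u y).re) ∂ν ≤ ∫ y, ‖a - u y‖ ^ 2 ∂ν := by
    refine integral_mono ((integrable_const _).sub (hre.const_mul 2)) hsq fun y => ?_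
    have h2 := @norm_sub_sq ℂ ℂ _ _ _ a (u y)
    have h3 : RCLike.re ⟪a, u y⟫_ℂ = (starRingEnd ℂ a * u y).re := by
      rw [mul_comm]; rfl
    rw [h3] at h2
    simp only
    rw [h2]
    nlinarith [sq_nonneg ‖u y‖]
  have h4 : ∫ y, (starRingEnd ℂ a * u y).re ∂ν = 0 := by
    have h5 : ∫ y, RCLike.re (starRingEnd ℂ a * u y) ∂ν
        = RCLike.re (∫ y, starRingEnd ℂ a * u y ∂ν) := integral_re (hint.const_mul _)
    rw [integral_const_mul, h0, mul_zero] at h5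
    simpa using h5
  rw [integral_sub (integrable_const _) (hre.const_mul 2), integral_const_mul, h4, integral_const,
    mul_zero, sub_zero, smul_eq_mul] at h1
  have h6 : ∫⁻ y, ‖a - u y‖ₑ ^ 2 ∂ν = ENNReal.ofReal (∫ y, ‖a - u y‖ ^ 2 ∂ν) := by
    rw [ofReal_integral_eq_lintegral_ofReal hsq (Eventually.of_forall fun y => by positivity)]
    refine lintegral_congr fun y => ?_
    rw [ENNReal.ofReal_pow (norm_nonneg _), ofReal_norm]
  rw [h6]
  refine le_trans (le_of_eq ?_) (ENNReal.ofReal_le_ofReal h1)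
  rw [ENNReal.ofReal_mul measureReal_nonneg, ofReal_measureReal, ENNReal.ofReal_pow (norm_nonneg _),
    ofReal_norm]

lemma volume_ball_two_mul (x y : Space d) (r : ℝ) :
    volume (Metric.ball x (2 * r)) = 2 ^ d * volume (Metric.ball y r) := by
  rw [Measure.addHaar_ball_mul_of_pos volume x zero_lt_two r, finrank_euclideanSpace, Fintype.card_fin,
    Measure.addHaar_ball_center volume y, ENNReal.ofReal_pow zero_le_two]
  simp

/-- On a set satisfying a uniform cone condition, the `L²`-norm of a Sobolev function whose means
over finitely many balls vanish is small compared to its Sobolev norm. -/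
lemma lintegral_le_of_forall_mean_eq_zero (hb : Bornology.IsBounded Ω) {A : Set (Space d)}
    (hA : IsOpen A) (hAΩ : A ⊆ Ω) {e : Space d} {ρ s : ℝ} (hρ : 0 < ρ) (hs : 0 < s)
    (hcone : ∀ x ∈ A, ∀ z ∈ Metric.ball e ρ, ∀ t ∈ Set.Icc 0 s, x - t • z ∈ Ω) :
    ∃ F : Set (L2 Ω), F.Finite ∧ ∀ p ∈ sobolevSpace Ω, (∀ f ∈ F, ⟪f, p none⟫_ℂ = 0) →
      ∫⁻ x in A, ‖p none x‖ₑ ^ 2 ≤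
        ENNReal.ofReal (2 ^ d * (d * (s * (‖e‖ + ρ)) * ‖p‖) ^ 2) := by
  have hfin := isFiniteMeasure_of_isBounded hb
  have hδ : 0 < s * ρ / 2 := by positivity
  obtain ⟨t, htA, ht, hcov⟩ := Metric.finite_approx_of_totallyBounded
    ((hb.subset hAΩ).isCompact_closure.totallyBounded.subset subset_closure) _ hδ
  -- `W` collects the admissible shifts. If `x` lies within `s * ρ / 2` of `c` and `x - w ∈ B c`,
  -- then `w ∈ W`, so one ball `B c` is seen from all points near `c`. The radius of `W` is twice
  -- that of `B c`, which produces the factor `2 ^ d`.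
  let B : Space d → Set (Space d) := fun c => Metric.ball (c - s • e) (s * ρ / 2)
  let W : Set (Space d) := Metric.ball (s • e) (s * ρ)
  have hWvol : volume W = 2 ^ d * volume (Metric.ball (0 : Space d) (s * ρ / 2)) := by
    rw [← volume_ball_two_mul (s • e) 0 (s * ρ / 2), mul_div_cancel₀ _ two_ne_zero]
  have hBvol : ∀ c, volume (B c) = volume (Metric.ball (0 : Space d) (s * ρ / 2)) := fun c =>
    Measure.addHaar_ball_center _ _ _
  have hW : ∀ w ∈ W, ∀ x ∈ A, ∀ θ ∈ Set.Icc (0 : ℝ) 1, x - θ • w ∈ Ω := by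
    intro w hw x hx θ hθ
    have h1 : s⁻¹ • w ∈ Metric.ball e ρ := by
      rw [Metric.mem_ball, dist_eq_norm] at hw ⊢
      have h2 : s⁻¹ • w - e = s⁻¹ • (w - s • e) := by
        rw [smul_sub, smul_smul, inv_mul_cancel₀ hs.ne', one_smul]
      rw [h2, norm_smul, norm_inv, Real.norm_of_nonneg hs.le, inv_mul_lt_iff₀ hs]
      exact hw
    have h2 := hcone x hx _ h1 (θ * s) ⟨by have := hθ.1; positivity, by nlinarith [hθ.2]⟩
    rwa [smul_smul, mul_assoc, mul_inv_cancel₀ hs.ne', mul_one] at h2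
  have hBΩ : ∀ c ∈ t, B c ⊆ Ω := by
    intro c hc y hy
    have h1 : c - y ∈ W := by
      rw [Metric.mem_ball, dist_eq_norm] at hy ⊢
      have h2 : c - y - s • e = -(y - (c - s • e)) := by abel
      rw [h2, norm_neg]
      linarith
    have := hW _ h1 c (htA hc) 1 (by simp)
    simpa using this
  refine ⟨(fun c => indicatorConstLp 2 (μ := volume.restrict Ω) (s := B c)
    Metric.isOpen_ball.measurableSet (measure_ne_top _ _) (1 : ℂ)) '' t, ht.image _,
    fun p hp hF => ?_⟩
  have hmean : ∀ c ∈ t, ∫ y in B c, p none y = 0 := by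
    intro c hc
    have h1 := hF _ ⟨c, hc, rfl⟩
    rw [L2.inner_indicatorConstLp_one, Measure.restrict_restrict Metric.isOpen_ball.measurableSet,
      Set.inter_eq_left.2 (hBΩ c hc)] at h1
    exact h1
  -- Since the mean of `p none` over `B c` is zero, its value at `x` is controlled by its
  -- differences to the values on `B c`, rewritten with the shift `w = x - y`.
  have hpt : ∀ x ∈ A, volume (Metric.ball (0 : Space d) (s * ρ / 2)) * ‖p none x‖ₑ ^ 2 ≤
      ∫⁻ w in W, ‖p none x - p none (x - w)‖ₑ ^ 2 := by
    intro x hx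
    obtain ⟨c, hc, hxc⟩ := Set.mem_iUnion₂.1 (hcov hx)
    have hfB : IsFiniteMeasure (volume.restrict (B c)) :=
      isFiniteMeasure_restrict.2 measure_ball_lt_top.ne
    have h1 := measure_univ_mul_enorm_sq_le
      ((Lp.memLp (p none)).mono_measure (Measure.restrict_mono (hBΩ c hc) le_rfl)) (hmean c hc)
      (p none x)
    rw [Measure.restrict_apply_univ, hBvol] at h1
    refine h1.trans ?_
    rw [← lintegral_indicator Metric.isOpen_ball.measurableSet,
      ← lintegral_indicator Metric.isOpen_ball.measurableSet,
      ← lintegral_sub_left_eq_self _ x]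
    refine lintegral_mono fun w => ?_
    by_cases hw : x - w ∈ B c
    · have hwW : w ∈ W := by
        rw [Metric.mem_ball, dist_eq_norm] at hw hxc ⊢
        have h2 : w - s • e = (x - c) - (x - w - (c - s • e)) := by abel
        rw [h2]
        exact (norm_sub_le _ _).trans_lt (by linarith)
      rw [Set.indicator_of_mem hw, Set.indicator_of_mem hwW]
    · rw [Set.indicator_of_notMem hw]
      exact zero_le
  have hmeas : Measurable (p none) := (Lp.stronglyMeasurable (p none)).measurable
  have hm2 : Measurable fun z : Space d × Space d => ‖p none z.1 - p none (z.1 - z.2)‖ₑ ^ 2 := by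
    fun_prop
  have hvol0 : volume (Metric.ball (0 : Space d) (s * ρ / 2)) ≠ 0 :=
    (Metric.measure_ball_pos volume _ hδ).ne'
  have hvol1 : volume (Metric.ball (0 : Space d) (s * ρ / 2)) ≠ ⊤ := measure_ball_lt_top.ne
  -- With the ball volume restored on both sides, Tonelli puts the integral over `w` outside, and
  -- the translation estimate applies for each fixed shift.
  rw [← ENNReal.mul_le_mul_iff_right hvol0 hvol1]
  calc volume (Metric.ball (0 : Space d) (s * ρ / 2)) * ∫⁻ x in A, ‖p none x‖ₑ ^ 2
      = ∫⁻ x in A, volume (Metric.ball (0 : Space d) (s * ρ / 2)) * ‖p none x‖ₑ ^ 2 := by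
        rw [lintegral_const_mul _ (by fun_prop)]
    _ ≤ ∫⁻ x in A, ∫⁻ w in W, ‖p none x - p none (x - w)‖ₑ ^ 2 :=
        setLIntegral_mono' hA.measurableSet hpt
    _ = ∫⁻ w in W, ∫⁻ x in A, ‖p none x - p none (x - w)‖ₑ ^ 2 :=
        lintegral_lintegral_swap hm2.aemeasurable
    _ ≤ ∫⁻ _ in W, ENNReal.ofReal ((d * (s * (‖e‖ + ρ)) * ‖p‖) ^ 2) := by
        refine setLIntegral_mono' Metric.isOpen_ball.measurableSet fun w hw => ?_
        refine (lintegral_translate_sub_le hb hA hp (hW w hw)).trans (ENNReal.ofReal_le_ofReal ?_)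
        have h1 : ‖w‖ ≤ s * (‖e‖ + ρ) := by
          rw [Metric.mem_ball, dist_eq_norm] at hw
          calc ‖w‖ = ‖(w - s • e) + s • e‖ := by congr 1; abel
            _ ≤ ‖w - s • e‖ + ‖s • e‖ := norm_add_le _ _
            _ ≤ s * (‖e‖ + ρ) := by
              rw [norm_smul, Real.norm_of_nonneg hs.le]; linarith
        gcongr
    _ = _ := by
        rw [setLIntegral_const, hWvol, ENNReal.ofReal_mul (by positivity),
          ENNReal.ofReal_pow zero_le_two]
        simp only [ENNReal.ofReal_ofNat]
        ring

/-- The bound of the previous lemma tends to zero with the cone length `s`. The neighbourhood `B`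
does not depend on `ε`; only the finite set `F` does. -/
lemma exists_finite_lintegral_le (hΩ : IsBoundedLipschitzDomain Ω) {x₀ : Space d}
    (hx₀ : x₀ ∈ closure Ω) : ∃ B : Set (Space d), IsOpen B ∧ x₀ ∈ B ∧ ∀ ε > 0,
      ∃ F : Set (L2 Ω), F.Finite ∧ ∀ p ∈ sobolevSpace Ω, (∀ f ∈ F, ⟪f, p none⟫_ℂ = 0) →
        ∫⁻ x in Ω ∩ B, ‖p none x‖ₑ ^ 2 ≤ ENNReal.ofReal (ε * ‖p‖ ^ 2) := by
  obtain ⟨B, hB, hxB, e, ρ, r, hρ, hr, hcone⟩ := exists_uniform_cone hΩ hx₀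
  refine ⟨B, hB, hxB, fun ε hε => ?_⟩
  have hlim : Tendsto (fun s : ℝ => 2 ^ d * (d * (s * (‖e‖ + ρ))) ^ 2) (𝓝[>] 0) (𝓝 0) := by
    have : Continuous fun s : ℝ => 2 ^ d * (d * (s * (‖e‖ + ρ))) ^ 2 := by fun_prop
    have h := (this.tendsto 0).mono_left (nhdsWithin_le_nhds (s := Set.Ioi 0))
    simpa using h
  have h1 : ∀ᶠ s : ℝ in 𝓝[>] 0, 2 ^ d * (d * (s * (‖e‖ + ρ))) ^ 2 < ε := hlim.eventually_lt_const hε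
  have h2 : ∀ᶠ s : ℝ in 𝓝[>] 0, s ∈ Set.Ioo 0 r := Ioo_mem_nhdsGT hr
  obtain ⟨s, hsε, hs⟩ := (h1.and h2).exists
  obtain ⟨F, hF, hFp⟩ := lintegral_le_of_forall_mean_eq_zero hΩ.isBounded (hΩ.isOpen.inter hB)
    Set.inter_subset_left hρ hs.1
    (fun x hx z hz t ht => hcone x hx z hz t ⟨ht.1, ht.2.trans hs.2.le⟩)
  refine ⟨F, hF, fun p hp hpF => (hFp p hp hpF).trans (ENNReal.ofReal_le_ofReal ?_)⟩
  rw [mul_pow, ← mul_assoc]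
  gcongr

/-- Compactness of the closure patches the local estimates: having them for every `ε` is stable
under unions, by splitting `ε` and joining the finite sets. -/
lemma exists_finite_norm_le (hΩ : IsBoundedLipschitzDomain Ω) {ε : ℝ} (hε : 0 < ε) :
    ∃ F : Set (L2 Ω), F.Finite ∧ ∀ p ∈ sobolevSpace Ω, (∀ f ∈ F, ⟪f, p none⟫_ℂ = 0) →
      ‖p none‖ ≤ ε * ‖p‖ := by
  have key : ∀ ε > 0, ∃ F : Set (L2 Ω), F.Finite ∧ ∀ p ∈ sobolevSpace Ω,
      (∀ f ∈ F, ⟪f, p none⟫_ℂ = 0) →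
        ∫⁻ x in Ω ∩ closure Ω, ‖p none x‖ₑ ^ 2 ≤ ENNReal.ofReal (ε * ‖p‖ ^ 2) := by
    refine hΩ.isBounded.isCompact_closure.induction_on (p := fun S => ∀ ε > 0,
      ∃ F : Set (L2 Ω), F.Finite ∧ ∀ p ∈ sobolevSpace Ω, (∀ f ∈ F, ⟪f, p none⟫_ℂ = 0) →
        ∫⁻ x in Ω ∩ S, ‖p none x‖ₑ ^ 2 ≤ ENNReal.ofReal (ε * ‖p‖ ^ 2)) ?_ ?_ ?_ ?_
    · exact fun ε _ => ⟨∅, Set.finite_empty, fun p _ _ => by simp⟩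
    · intro S T hST hT ε hε
      obtain ⟨F, hF, hFp⟩ := hT ε hε
      exact ⟨F, hF, fun p hp hpF => (lintegral_mono_set (Set.inter_subset_inter_right _ hST)).trans
        (hFp p hp hpF)⟩
    · intro S T hS hT ε hε
      obtain ⟨F, hF, hFp⟩ := hS (ε / 2) (by positivity)
      obtain ⟨G, hG, hGp⟩ := hT (ε / 2) (by positivity)
      refine ⟨F ∪ G, hF.union hG, fun p hp hpF => ?_⟩
      rw [Set.inter_union_distrib_left]
      refine (lintegral_union_le _ _ _).trans ((add_le_add
        (hFp p hp fun f hf => hpF f (Or.inl hf)) (hGp p hp fun f hf => hpF f (Or.inr hf))).trans ?_)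
      rw [← ENNReal.ofReal_add (by positivity) (by positivity)]
      exact ENNReal.ofReal_le_ofReal (by linarith)
    · intro x hx
      obtain ⟨B, hB, hxB, h⟩ := exists_finite_lintegral_le hΩ hx
      exact ⟨B, mem_nhdsWithin_of_mem_nhds (hB.mem_nhds hxB), h⟩
  obtain ⟨F, hF, hFp⟩ := key (ε ^ 2) (by positivity)
  refine ⟨F, hF, fun p hp hpF => ?_⟩
  have h1 := hFp p hp hpF
  rw [Set.inter_eq_left.2 subset_closure, ← mul_pow] at h1
  have h2 : ENNReal.ofReal (‖p none‖ ^ 2) = ∫⁻ x in Ω, ‖p none x‖ₑ ^ 2 := by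
    rw [ENNReal.ofReal_pow (norm_nonneg _), Lp.norm_def,
      ENNReal.ofReal_toReal (Lp.memLp (p none)).eLpNorm_ne_top,
      eLpNorm_eq_lintegral_rpow_enorm_toReal (by norm_num) (by norm_num),
      ← ENNReal.rpow_natCast _ 2, ← ENNReal.rpow_mul]
    simp
  rw [← h2, ENNReal.ofReal_le_ofReal_iff (by positivity)] at h1
  exact abs_le_of_sq_le_sq' h1 (by positivity) |>.2

/-- **Rellich's theorem** on a bounded Lipschitz domain. -/
theorem isCompactOperator_sobolev_embedding (hΩ : IsBoundedLipschitzDomain Ω)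
    {V : Submodule ℂ (JetSpace Ω)} [CompleteSpace V] (hV : V ≤ sobolevSpace Ω) :
    IsCompactOperator (jetFst Ω ∘L V.subtypeL) := by
  refine isCompactOperator_of_forall_finite_orthogonal _ fun ε hε => ?_
  obtain ⟨F, hF, hFp⟩ := exists_finite_norm_le hΩ hε
  exact ⟨F, hF, fun u hu => hFp u (hV u.2) hu⟩

end Rellich

end MixedLaplacian

end

noncomputable section

namespace MixedLaplacian

variable {d : ℕ}

/-! ### The divergence theorem below a Lipschitz graph -/

section Graph

/-- The hyperplane `e^⊥`. -/
abbrev Hyperplane (e : Space d) : Submodule ℝ (Space d) := (ℝ ∙ e)ᗮ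

/-- The orthogonal projection to the hyperplane `e^⊥`. -/
abbrev projHyperplane (e : Space d) : Space d →L[ℝ] Hyperplane e :=
  (ℝ ∙ e)ᗮ.orthogonalProjectionOnto

/-- The Hausdorff measure of full dimension on the hyperplane `e^⊥`. -/
abbrev hyperplaneMeasure (e : Space d) : Measure (Hyperplane e) :=
  Measure.hausdorffMeasure (Module.finrank ℝ (Hyperplane e))

/-- The parametrization of the graph of a function on `e^⊥`. -/
def graphMap (e : Space d) (h : Hyperplane e → ℝ) (y : Hyperplane e) : Space d := y + h y • e

/-- The set of points strictly below the graph of a function on `e^⊥`. -/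
def subgraph (e : Space d) (h : Hyperplane e → ℝ) : Set (Space d) :=
  {x | ⟪e, x⟫_ℝ < h (projHyperplane e x)}

variable {e : Space d}

lemma finrank_hyperplane (he : ‖e‖ = 1) :
    (Module.finrank ℝ (Hyperplane e) : ℝ) = (d : ℝ) - 1 := by
  have h := Submodule.finrank_add_finrank_orthogonal (ℝ ∙ e)
  rw [finrank_span_singleton (by intro h; simp [h] at he), finrank_euclideanSpace,
    Fintype.card_fin] at h
  have h' : (1 : ℝ) + Module.finrank ℝ (Hyperplane e) = d := by exact_mod_cast h
  linarith

lemma projHyperplane_self : projHyperplane e e = 0 :=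
  Submodule.orthogonalProjectionOnto_orthogonalComplement_singleton_eq_zero e

lemma projHyperplane_coe (y : Hyperplane e) : projHyperplane e y = y :=
  Submodule.orthogonalProjectionOnto_mem_subspace_eq_self y

lemma inner_hyperplane (y : Hyperplane e) : ⟪e, (y : Space d)⟫_ℝ = 0 :=
  Submodule.mem_orthogonal_singleton_iff_inner_right.1 y.2

lemma projHyperplane_add_smul (y : Hyperplane e) (s : ℝ) :
    projHyperplane e ((y : Space d) + s • e) = y := by
  rw [map_add, map_smul, projHyperplane_self, projHyperplane_coe, smul_zero, add_zero]

lemma inner_add_smul (he : ‖e‖ = 1) (y : Hyperplane e) (s : ℝ) :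
    ⟪e, (y : Space d) + s • e⟫_ℝ = s := by
  rw [inner_add_right, inner_smul_right, inner_hyperplane, real_inner_self_eq_norm_sq, he]
  ring

lemma projHyperplane_add_inner_smul (he : ‖e‖ = 1) (x : Space d) :
    (projHyperplane e x : Space d) + ⟪e, x⟫_ℝ • e = x := by
  have h := (ℝ ∙ e).starProjection_add_starProjection_orthogonal x
  rw [Submodule.starProjection_unit_singleton ℝ he] at h
  rw [add_comm]
  exact h

/-- The splitting of the space into the hyperplane `e^⊥` and the direction `e`. -/
def hyperplaneSplitting (he : ‖e‖ = 1) : (Hyperplane e × ℝ) ≃L[ℝ] Space d :=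
  ContinuousLinearEquiv.equivOfInverse
    ((Hyperplane e).subtypeL.coprod ((1 : ℝ →L[ℝ] ℝ).smulRight e))
    ((projHyperplane e).prod (innerSL ℝ e))
    (fun p => by
      refine Prod.ext ?_ ?_
      · simp
      · simpa using inner_add_smul he p.1 p.2)
    (fun x => projHyperplane_add_inner_smul he x)

lemma hyperplaneSplitting_apply (he : ‖e‖ = 1) (p : Hyperplane e × ℝ) :
    hyperplaneSplitting he p = p.1 + p.2 • e := by
  simp [hyperplaneSplitting, ContinuousLinearEquiv.equivOfInverse]

/-- The constant relating Lebesgue measure to the product of Hausdorff measure on `e^⊥` and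
Lebesgue measure in the direction `e`. -/
lemma exists_integral_hyperplaneSplitting (he : ‖e‖ = 1) : ∃ c : ℝ, 0 < c ∧
    ∀ f : Space d → ℂ, Integrable f →
      Integrable (fun p : Hyperplane e × ℝ => f (p.1 + p.2 • e))
        ((hyperplaneMeasure e).prod volume) ∧
      c * ∫ x, f x = ∫ y : Hyperplane e, ∫ s : ℝ, f (y + s • e) ∂volume ∂(hyperplaneMeasure e) := by
  set m : Measure (Space d) :=
    Measure.map (hyperplaneSplitting he) ((hyperplaneMeasure e).prod volume) with hm
  -- Both are Haar measures on the same space, hence proportional; the value of the factor never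
  -- matters.
  have hc := Measure.isAddLeftInvariant_eq_smul m (volume : Measure (Space d))
  have hc0 := Measure.addHaarScalarFactor_pos_of_isAddHaarMeasure m (volume : Measure (Space d))
  set c := m.addHaarScalarFactor (volume : Measure (Space d))
  refine ⟨c, hc0, fun f hf => ?_⟩
  have hemb : MeasurableEmbedding (hyperplaneSplitting he) :=
    (hyperplaneSplitting he).toHomeomorph.measurableEmbedding
  have h1 : Integrable f m := by
    rw [hc]
    exact hf.smul_measure_nnreal
  have h2 := hemb.integrable_map_iff.1 h1
  have h3 : f ∘ hyperplaneSplitting he = fun p : Hyperplane e × ℝ => f (p.1 + p.2 • e) := by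
    funext p
    rw [Function.comp_apply, hyperplaneSplitting_apply]
  rw [h3] at h2
  refine ⟨h2, ?_⟩
  rw [← integral_prod _ h2, ← h3]
  change _ = ∫ p, f (hyperplaneSplitting he p) ∂_
  rw [← hemb.integral_map f, ← hm, hc, integral_smul_nnreal_measure, NNReal.smul_def,
    Complex.real_smul]

variable {h : Hyperplane e → ℝ} {K : ℝ≥0}

lemma measurableSet_subgraph (hh : Continuous h) : MeasurableSet (subgraph e h) :=
  (isOpen_lt (by fun_prop) (by fun_prop)).measurableSet

/-- First of two evaluations of the derivative at `t = 0` of the integral of a translated function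
over a fixed region. Equating them is the divergence theorem. -/
lemma hasDerivAt_integral_translate (A : Set (Space d))
    {φ : Space d → ℂ} (hφ : ContDiff ℝ 1 φ) (hc : HasCompactSupport φ) (τ : Space d) :
    HasDerivAt (fun t : ℝ => ∫ x in A, φ (x + t • τ)) (∫ x in A, fderiv ℝ φ x τ) 0 := by
  have hdiff : Continuous (fderiv ℝ φ) := hφ.continuous_fderiv (by simp)
  obtain ⟨C, hC⟩ := (hc.fderiv ℝ).exists_bound_of_continuous hdiff
  obtain ⟨R, hR⟩ := hc.isCompact.isBounded.exists_norm_le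
  have hC0 : 0 ≤ C := (norm_nonneg _).trans (hC 0)
  have hint : Integrable φ := hφ.continuous.integrable_of_hasCompactSupport hc
  have key := (hasDerivAt_integral_of_dominated_loc_of_deriv_le (μ := volume.restrict A)
      (F := fun (t : ℝ) x => φ (x + t • τ)) (x₀ := 0)
      (F' := fun t x => fderiv ℝ φ (x + t • τ) τ)
      -- For `|t| < 1` all translated supports lie in the ball of radius `R + ‖τ‖`.
      (bound := (Metric.closedBall (0 : Space d) (R + ‖τ‖)).indicator fun _ => C * ‖τ‖)
      (Metric.ball_mem_nhds (0 : ℝ) one_pos) ?_ ?_ ?_ ?_ ?_ ?_).2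
  · simpa using key
  · refine Eventually.of_forall fun t => ?_
    exact (hφ.continuous.comp (by fun_prop)).aestronglyMeasurable
  · simpa using hint.restrict
  · refine Continuous.aestronglyMeasurable ?_
    exact (hdiff.comp (by fun_prop)).clm_apply continuous_const
  · refine Eventually.of_forall fun x t ht => ?_
    by_cases hx : x ∈ Metric.closedBall (0 : Space d) (R + ‖τ‖)
    · rw [Set.indicator_of_mem hx]
      exact (ContinuousLinearMap.le_opNorm _ _).trans (by gcongr; exact hC _)
    · rw [Set.indicator_of_notMem hx]
      have h0 : x + t • τ ∉ tsupport φ := by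
        intro hmem
        apply hx
        rw [mem_closedBall_zero_iff]
        have h1 : ‖t • τ‖ ≤ ‖τ‖ := by
          rw [norm_smul]
          have : ‖t‖ ≤ 1 := by simpa using (mem_ball_zero_iff.1 ht).le
          nlinarith [norm_nonneg τ]
        calc ‖x‖ = ‖(x + t • τ) - t • τ‖ := by congr 1; abel
          _ ≤ ‖x + t • τ‖ + ‖t • τ‖ := norm_sub_le _ _
          _ ≤ R + ‖τ‖ := add_le_add (hR _ hmem) h1
      have h1 : fderiv ℝ φ (x + t • τ) = 0 :=
        image_eq_zero_of_notMem_tsupport fun hmem => h0 (tsupport_fderiv_subset ℝ hmem)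
      rw [h1]
      simp
  · exact ((integrable_indicator_iff Metric.isClosed_closedBall.measurableSet).2
      (integrableOn_const (isCompact_closedBall _ _).measure_lt_top.ne)).restrict
  · refine Eventually.of_forall fun x t _ => ?_
    have h1 : HasFDerivAt φ (fderiv ℝ φ (x + t • τ)) (x + t • τ) :=
      (hφ.differentiable (by simp) _).hasFDerivAt
    have h2 : HasDerivAt (fun t : ℝ => x + t • τ) τ t := by
      simpa using ((hasDerivAt_id t).smul_const τ).const_add x
    exact h1.comp_hasDerivAt t h2

/-- The primitive of a function along lines in the direction `e`. -/
def fiberIntegral (e : Space d) (φ : Space d → ℂ) (y : Hyperplane e) (r : ℝ) : ℂ :=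
  ∫ s in Set.Iic r, φ (y + s • e)

lemma integrable_fiber (he : ‖e‖ = 1) {φ : Space d → ℂ} (hφ : Continuous φ)
    (hc : HasCompactSupport φ) (y : Hyperplane e) : Integrable fun s : ℝ => φ (y + s • e) := by
  have h1 : Continuous fun s : ℝ => φ (y + s • e) := hφ.comp (by fun_prop)
  refine h1.integrable_of_hasCompactSupport ?_
  obtain ⟨R, hR⟩ := hc.isCompact.isBounded.exists_norm_le
  refine HasCompactSupport.intro (isCompact_closedBall (0 : ℝ) R) fun s hs => ?_
  refine image_eq_zero_of_notMem_tsupport fun hmem => hs ?_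
  have h2 := abs_real_inner_le_norm e ((y : Space d) + s • e)
  rw [inner_add_smul he, he, one_mul] at h2
  rw [mem_closedBall_zero_iff]
  exact h2.trans (hR _ hmem)

lemma hasDerivAt_fiberIntegral (he : ‖e‖ = 1) {φ : Space d → ℂ} (hφ : Continuous φ)
    (hc : HasCompactSupport φ) (y : Hyperplane e) (r : ℝ) :
    HasDerivAt (fiberIntegral e φ y) (φ (y + r • e)) r := by
  have h1 : Continuous fun s : ℝ => φ (y + s • e) := hφ.comp (by fun_prop)
  have h2 := integrable_fiber he hφ hc y
  have h3 : fiberIntegral e φ y =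
      fun r => (∫ s in Set.Iic (0 : ℝ), φ (y + s • e)) + ∫ s in (0 : ℝ)..r, φ (y + s • e) := by
    funext r
    rw [← intervalIntegral.integral_Iic_sub_Iic h2.integrableOn h2.integrableOn]
    simp [fiberIntegral]
  rw [h3]
  exact (h1.integral_hasStrictDerivAt 0 r).hasDerivAt.const_add _

lemma lipschitzWith_fiberIntegral (he : ‖e‖ = 1) {φ : Space d → ℂ} (hφ : Continuous φ)
    (hc : HasCompactSupport φ) {C : ℝ≥0} (hC : ∀ x, ‖φ x‖ ≤ C) (y : Hyperplane e) :
    LipschitzWith C (fiberIntegral e φ y) :=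
  lipschitzWith_of_nnnorm_deriv_le
    (fun r => (hasDerivAt_fiberIntegral he hφ hc y r).differentiableAt) fun r => by
      rw [(hasDerivAt_fiberIntegral he hφ hc y r).deriv]
      exact hC _

lemma fiberIntegral_eq_zero {φ : Space d → ℂ} {y : Hyperplane e}
    (hy : y ∉ projHyperplane e '' tsupport φ) (r : ℝ) : fiberIntegral e φ y r = 0 := by
  refine setIntegral_eq_zero_of_forall_eq_zero fun s _ => image_eq_zero_of_notMem_tsupport
    fun hmem => hy ⟨_, hmem, projHyperplane_add_smul y s⟩

/-- Translating the function is translating the region, and the fibre of the translated subgraph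
over `y` is again a half-line. After Fubini, `t` enters only through its upper end, a Lipschitz
function of `t`, so `h` is never differentiated inside the integrand. -/
lemma integral_subgraph_translate (he : ‖e‖ = 1) (hh : Continuous h) {c : ℝ}
    (hc : ∀ f : Space d → ℂ, Integrable f →
      Integrable (fun p : Hyperplane e × ℝ => f (p.1 + p.2 • e))
        ((hyperplaneMeasure e).prod volume) ∧
      c * ∫ x, f x = ∫ y : Hyperplane e, ∫ s : ℝ, f (y + s • e) ∂volume ∂(hyperplaneMeasure e))
    {φ : Space d → ℂ} (hφ : Continuous φ) (hcs : HasCompactSupport φ) (τ : Space d) (t : ℝ) :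
    Integrable (fun y => fiberIntegral e φ y
        (h (y - t • projHyperplane e τ) + t * ⟪e, τ⟫_ℝ)) (hyperplaneMeasure e) ∧
      c * ∫ x in subgraph e h, φ (x + t • τ) = ∫ y, fiberIntegral e φ y
        (h (y - t • projHyperplane e τ) + t * ⟪e, τ⟫_ℝ) ∂(hyperplaneMeasure e) := by
  have hint : Integrable φ := hφ.integrable_of_hasCompactSupport hcs
  let A : Set (Space d) := (fun x => x - t • τ) ⁻¹' subgraph e h
  have hA : MeasurableSet A := (by fun_prop : Measurable fun x : Space d => x - t • τ)
    (measurableSet_subgraph hh)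
  have h1 : ∫ x in subgraph e h, φ (x + t • τ) = ∫ x, A.indicator φ x := by
    rw [← integral_indicator (measurableSet_subgraph hh),
      ← integral_add_right_eq_self (A.indicator φ) (t • τ)]
    refine integral_congr_ae (Eventually.of_forall fun x => ?_)
    have h2 : x + t • τ ∈ A ↔ x ∈ subgraph e h := by simp [A]
    by_cases hx : x ∈ subgraph e h
    · simp only [Set.indicator_of_mem hx, Set.indicator_of_mem (h2.2 hx)]
    · simp only [Set.indicator_of_notMem hx, Set.indicator_of_notMem (fun h => hx (h2.1 h))]
  have h3 : ∀ y : Hyperplane e, ∫ s : ℝ, A.indicator φ (y + s • e) = fiberIntegral e φ y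
      (h (y - t • projHyperplane e τ) + t * ⟪e, τ⟫_ℝ) := by
    intro y
    rw [fiberIntegral, integral_Iic_eq_integral_Iio, ← integral_indicator measurableSet_Iio]
    refine integral_congr_ae (Eventually.of_forall fun s => ?_)
    have h4 : (y : Space d) + s • e ∈ A ↔
        s ∈ Set.Iio (h (y - t • projHyperplane e τ) + t * ⟪e, τ⟫_ℝ) := by
      simp only [A, subgraph, Set.mem_preimage, Set.mem_ofPred_eq, Set.mem_Iio]
      rw [inner_sub_right, inner_add_smul he, map_sub, projHyperplane_add_smul, map_smul,
        inner_smul_right, sub_lt_iff_lt_add]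
    by_cases hs : (y : Space d) + s • e ∈ A
    · simp only [Set.indicator_of_mem hs, Set.indicator_of_mem (h4.1 hs)]
    · simp only [Set.indicator_of_notMem hs, Set.indicator_of_notMem (fun h => hs (h4.2 h))]
  obtain ⟨h5, h6⟩ := hc (A.indicator φ) (hint.indicator hA)
  have h7 := h5.integral_prod_left
  simp only [h3] at h6 h7
  exact ⟨h7, by rw [h1, h6]⟩

/-- The divergence theorem on the region below a Lipschitz graph. -/
theorem exists_integral_fderiv_subgraph (he : ‖e‖ = 1) : ∃ c : ℝ, 0 < c ∧
    ∀ {K : ℝ≥0} {h : Hyperplane e → ℝ}, LipschitzWith K h → ∀ {φ : Space d → ℂ}, ContDiff ℝ 1 φ →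
      HasCompactSupport φ → ∀ τ : Space d,
      c * ∫ x in subgraph e h, fderiv ℝ φ x τ = ∫ y, φ (graphMap e h y) *
        ((⟪e, τ⟫_ℝ - fderiv ℝ h y (projHyperplane e τ) : ℝ) : ℂ) ∂(hyperplaneMeasure e) := by
  obtain ⟨c, hc0, hc⟩ := exists_integral_hyperplaneSplitting he
  refine ⟨c, hc0, fun {K h} hh {φ} hφ hcs τ => ?_⟩
  have hφc := hφ.continuous
  obtain ⟨C, hC⟩ := hcs.exists_bound_of_continuous hφc
  lift C to ℝ≥0 using (norm_nonneg _).trans (hC 0)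
  set σ := projHyperplane e τ with hσ
  have h1 := ((hasDerivAt_integral_translate (subgraph e h) hφ hcs τ).const_mul (c : ℂ)).congr_of_eventuallyEq
    (f₁ := fun t => ∫ y, fiberIntegral e φ y (h (y - t • σ) + t * ⟪e, τ⟫_ℝ) ∂(hyperplaneMeasure e))
    (Eventually.of_forall fun t =>
      (integral_subgraph_translate he hh.continuous hc hφc hcs τ t).2.symm)
  -- Second evaluation of the derivative. Domination by a Lipschitz constant needs differentiability
  -- only at `t = 0` and for almost every `y`, which is what Rademacher's theorem provides.
  have h2 := (hasDerivAt_integral_of_dominated_loc_of_lip (μ := hyperplaneMeasure e) (x₀ := (0 : ℝ))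
    (F := fun (t : ℝ) y => fiberIntegral e φ y (h (y - t • σ) + t * ⟪e, τ⟫_ℝ))
    (F' := fun y => φ (graphMap e h y) * ((⟪e, τ⟫_ℝ - fderiv ℝ h y σ : ℝ) : ℂ))
    (bound := (projHyperplane e '' tsupport φ).indicator
      fun _ => ((C * (K * ‖σ‖₊ + ‖⟪e, τ⟫_ℝ‖₊) : ℝ≥0) : ℝ))
    (s := Set.univ) univ_mem
    (Eventually.of_forall fun t =>
      (integral_subgraph_translate he hh.continuous hc hφc hcs τ t).1.aestronglyMeasurable)
    (integral_subgraph_translate he hh.continuous hc hφc hcs τ 0).1 ?_ ?_ ?_ ?_).2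
  · exact h1.unique h2
  · refine AEStronglyMeasurable.mul (Continuous.aestronglyMeasurable ?_) ?_
    · have := hh.continuous
      unfold graphMap
      fun_prop
    · refine Measurable.aestronglyMeasurable ?_
      have := measurable_fderiv_apply_const ℝ h σ
      fun_prop
  · refine Eventually.of_forall fun y => ?_
    by_cases hy : y ∈ projHyperplane e '' tsupport φ
    · rw [Set.indicator_of_mem hy, Real.nnabs_of_nonneg (NNReal.coe_nonneg _), Real.toNNReal_coe]
      refine LipschitzWith.lipschitzOnWith ?_
      refine (lipschitzWith_fiberIntegral he hφc hcs hC y).comp ?_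
      refine LipschitzWith.add ?_ ?_
      · refine hh.comp ?_
        refine LipschitzWith.of_dist_le_mul fun s t => ?_
        rw [dist_eq_norm, dist_eq_norm]
        have : y - s • σ - (y - t • σ) = -((s - t) • σ) := by rw [sub_smul]; abel
        rw [this, norm_neg, norm_smul, mul_comm]
        rfl
      · refine LipschitzWith.of_dist_le_mul fun s t => ?_
        rw [dist_eq_norm, dist_eq_norm, ← sub_mul, norm_mul, mul_comm]
        rfl
    · rw [Set.indicator_of_notMem hy]
      simp only [fiberIntegral_eq_zero hy]
      exact (LipschitzWith.const' 0).weaken bot_le |>.lipschitzOnWith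
  · have hK : IsCompact (projHyperplane e '' tsupport φ) :=
      hcs.isCompact.image (projHyperplane e).continuous
    exact (integrable_indicator_iff hK.measurableSet).2
      (integrableOn_const hK.measure_lt_top.ne)
  · filter_upwards [hh.ae_differentiableAt (μ := hyperplaneMeasure e)] with y hy
    have h3 : HasDerivAt (fun t : ℝ => h (y - t • σ) + t * ⟪e, τ⟫_ℝ)
        (⟪e, τ⟫_ℝ - fderiv ℝ h y σ) 0 := by
      have h4 : HasDerivAt (fun t : ℝ => y - t • σ) (-σ) 0 := by
        simpa using ((hasDerivAt_id (0 : ℝ)).smul_const σ).const_sub y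
      have h5 : HasFDerivAt h (fderiv ℝ h y) (y - (0 : ℝ) • σ) := by
        simpa using hy.hasFDerivAt
      have h6 := (h5.comp_hasDerivAt 0 h4).add ((hasDerivAt_id (0 : ℝ)).mul_const ⟪e, τ⟫_ℝ)
      have h7 : fderiv ℝ h y (-σ) + 1 * ⟪e, τ⟫_ℝ = ⟪e, τ⟫_ℝ - fderiv ℝ h y σ := by
        rw [map_neg]
        ring
      rw [h7] at h6
      exact h6
    have h4 : HasDerivAt (fiberIntegral e φ y) (φ (graphMap e h y))
        (h (y - (0 : ℝ) • σ) + 0 * ⟪e, τ⟫_ℝ) := by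
      have := hasDerivAt_fiberIntegral he hφc hcs y (h y)
      simpa [graphMap] using this
    have h5 := h4.scomp (0 : ℝ) h3
    rw [Complex.real_smul, mul_comm] at h5
    exact h5

end Graph

end MixedLaplacian

end

noncomputable section

namespace MixedLaplacian

variable {d : ℕ}

/-! ### The boundary in a graph chart -/

section Chart

variable {Ω : Set (Space d)} {U : Set (Space d)} {e : Space d} {K : ℝ≥0} {h : Hyperplane e → ℝ}

/-- Inside the open set `U`, the set `Ω` consists of the points below the Lipschitz graph of `h`. -/
structure IsGraphChart (Ω U : Set (Space d)) (e : Space d) (K : ℝ≥0) (h : Hyperplane e → ℝ) :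
    Prop where
  isOpen : IsOpen U
  norm_eq_one : ‖e‖ = 1
  lipschitz : LipschitzWith K h
  mem_iff : ∀ y ∈ U, (y ∈ Ω ↔ ⟪e, y⟫_ℝ < h (projHyperplane e y))

lemma projHyperplane_graphMap (y : Hyperplane e) : projHyperplane e (graphMap e h y) = y :=
  projHyperplane_add_smul y _

lemma inner_graphMap (he : ‖e‖ = 1) (y : Hyperplane e) : ⟪e, graphMap e h y⟫_ℝ = h y :=
  inner_add_smul he y _

lemma continuous_graphMap (hh : Continuous h) : Continuous (graphMap e h) := by
  unfold graphMap
  fun_prop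

lemma lipschitzWith_graphMap (he : ‖e‖ = 1) (hh : LipschitzWith K h) :
    LipschitzWith (1 + K) (graphMap e h) := by
  refine LipschitzWith.add (LipschitzWith.subtype_val _) ?_
  refine LipschitzWith.of_dist_le_mul fun x y => ?_
  rw [dist_eq_norm, ← sub_smul, norm_smul, he, mul_one, ← dist_eq_norm]
  exact hh.dist_le_mul x y

namespace IsGraphChart

lemma notMem_closure (hc : IsGraphChart Ω U e K h) {x : Space d} (hx : x ∈ U)
    (hlt : h (projHyperplane e x) < ⟪e, x⟫_ℝ) : x ∉ closure Ω := by
  have hh := hc.lipschitz.continuous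
  rw [mem_closure_iff]
  push Not
  refine ⟨U ∩ {z | h (projHyperplane e z) < ⟪e, z⟫_ℝ},
    hc.isOpen.inter (isOpen_lt (by fun_prop) (by fun_prop)), ⟨hx, hlt⟩, ?_⟩
  rw [Set.eq_empty_iff_forall_notMem]
  rintro z ⟨⟨hzU, hz⟩, hzΩ⟩
  exact lt_asymm hz ((hc.mem_iff z hzU).1 hzΩ)

lemma mem_frontier_iff (hΩ : IsOpen Ω) (hc : IsGraphChart Ω U e K h) {x : Space d} (hx : x ∈ U) :
    x ∈ frontier Ω ↔ ⟪e, x⟫_ℝ = h (projHyperplane e x) := by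
  rw [frontier, hΩ.interior_eq]
  constructor
  · rintro ⟨h1, h2⟩
    refine le_antisymm ?_ ?_
    · by_contra! h3
      exact hc.notMem_closure hx h3 h1
    · by_contra! h3
      exact h2 ((hc.mem_iff x hx).2 h3)
  · intro heq
    refine ⟨?_, fun hxΩ => ((hc.mem_iff x hx).1 hxΩ).ne heq⟩
    have hlim : Tendsto (fun s : ℝ => x - s • e) (𝓝[>] 0) (𝓝 x) := by
      have : Continuous fun s : ℝ => x - s • e := by fun_prop
      have h1 := (this.tendsto 0).mono_left (nhdsWithin_le_nhds (s := Set.Ioi 0))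
      simpa using h1
    refine mem_closure_of_tendsto hlim ?_
    filter_upwards [hlim (hc.isOpen.mem_nhds hx), self_mem_nhdsWithin] with s hs hs0
    rw [hc.mem_iff _ hs, map_sub, map_smul, projHyperplane_self, smul_zero, sub_zero,
      inner_sub_right, inner_smul_right, real_inner_self_eq_norm_sq, hc.norm_eq_one, heq]
    have : 0 < s := hs0
    linarith

lemma graphMap_mem_frontier (hΩ : IsOpen Ω) (hc : IsGraphChart Ω U e K h) {y : Hyperplane e}
    (hy : graphMap e h y ∈ U) : graphMap e h y ∈ frontier Ω := by
  rw [hc.mem_frontier_iff hΩ hy, projHyperplane_graphMap, inner_graphMap hc.norm_eq_one]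

lemma graphMap_projHyperplane (hΩ : IsOpen Ω) (hc : IsGraphChart Ω U e K h) {x : Space d}
    (hx : x ∈ U) (hxf : x ∈ frontier Ω) : graphMap e h (projHyperplane e x) = x := by
  rw [graphMap, ← (hc.mem_frontier_iff hΩ hx).1 hxf]
  exact projHyperplane_add_inner_smul hc.norm_eq_one x

/-- The projection to the hyperplane is 1-Lipschitz and inverts the graph map, so it does not
increase Hausdorff measure. -/
lemma map_graphMap_restrict_le (hΩ : IsOpen Ω) (hd : 1 ≤ d) (hc : IsGraphChart Ω U e K h) :
    (Measure.map (graphMap e h) (hyperplaneMeasure e)).restrict U ≤ surfaceMeasure Ω := by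
  refine Measure.le_intro fun B hB _ => ?_
  have hmeas : MeasurableSet (B ∩ U) := hB.inter hc.isOpen.measurableSet
  rw [Measure.restrict_apply hB,
    Measure.map_apply (continuous_graphMap hc.lipschitz.continuous).measurable hmeas,
    surfaceMeasure, Measure.restrict_apply hB]
  have hsub : graphMap e h ⁻¹' (B ∩ U) ⊆ projHyperplane e '' (B ∩ frontier Ω) := fun y hy =>
    ⟨graphMap e h y, ⟨hy.1, hc.graphMap_mem_frontier hΩ hy.2⟩, projHyperplane_graphMap y⟩
  have hd0 : (0 : ℝ) ≤ (d : ℝ) - 1 := by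
    have : (1 : ℝ) ≤ d := by exact_mod_cast hd
    linarith
  have hlip : LipschitzWith 1 (projHyperplane e) :=
    Submodule.lipschitzWith_orthogonalProjectionOnto _
  rw [hyperplaneMeasure, finrank_hyperplane hc.norm_eq_one]
  refine (measure_mono hsub).trans ((hlip.hausdorffMeasure_image_le hd0 _).trans ?_)
  simp

/-- The converse comparison: the graph map is `(1 + K)`-Lipschitz and covers the boundary inside the
chart. -/
lemma restrict_le_smul_map_graphMap (hΩ : IsOpen Ω) (hd : 1 ≤ d) (hc : IsGraphChart Ω U e K h) :
    ∃ C : ℝ≥0, (surfaceMeasure Ω).restrict U ≤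
      C • Measure.map (graphMap e h) (hyperplaneMeasure e) := by
  have hd0 : (0 : ℝ) ≤ (d : ℝ) - 1 := by
    have : (1 : ℝ) ≤ d := by exact_mod_cast hd
    linarith
  refine ⟨(1 + K) ^ ((d : ℝ) - 1), Measure.le_intro fun B hB _ => ?_⟩
  rw [Measure.restrict_apply hB, surfaceMeasure,
    Measure.restrict_apply (hB.inter hc.isOpen.measurableSet), Measure.smul_apply,
    Measure.map_apply (continuous_graphMap hc.lipschitz.continuous).measurable hB]
  have hsub : B ∩ U ∩ frontier Ω ⊆ graphMap e h '' (graphMap e h ⁻¹' B) := by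
    rintro x ⟨⟨hxB, hxU⟩, hxf⟩
    have := hc.graphMap_projHyperplane hΩ hxU hxf
    exact ⟨projHyperplane e x, by rwa [Set.mem_preimage, this], this⟩
  refine (measure_mono hsub).trans
    (((lipschitzWith_graphMap hc.norm_eq_one hc.lipschitz).hausdorffMeasure_image_le hd0 _).trans
      (le_of_eq ?_))
  rw [hyperplaneMeasure, finrank_hyperplane hc.norm_eq_one, ENNReal.smul_def, smul_eq_mul,
    ENNReal.coe_rpow_of_nonneg _ hd0]

lemma lintegral_comp_graphMap_le (hΩ : IsOpen Ω) (hd : 1 ≤ d) (hc : IsGraphChart Ω U e K h)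
    {f : Space d → ℝ≥0∞} (hf : Measurable f) (hfU : ∀ x, x ∉ U → f x = 0) :
    ∫⁻ y, f (graphMap e h y) ∂(hyperplaneMeasure e) ≤ ∫⁻ x, f x ∂(surfaceMeasure Ω) := by
  rw [← lintegral_map hf (continuous_graphMap hc.lipschitz.continuous).measurable,
    ← setLIntegral_eq_of_support_subset (s := U) (fun x hx => by_contra fun h => hx (hfU x h))]
  exact lintegral_mono' (hc.map_graphMap_restrict_le hΩ hd) le_rfl

lemma lintegral_surfaceMeasure_le (hΩ : IsOpen Ω) (hd : 1 ≤ d) (hc : IsGraphChart Ω U e K h) :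
    ∃ C : ℝ≥0, ∀ f : Space d → ℝ≥0∞, Measurable f → (∀ x, x ∉ U → f x = 0) →
    ∫⁻ x, f x ∂(surfaceMeasure Ω) ≤ C * ∫⁻ y, f (graphMap e h y) ∂(hyperplaneMeasure e) := by
  obtain ⟨C, hC⟩ := hc.restrict_le_smul_map_graphMap hΩ hd
  refine ⟨C, fun f hf hfU => ?_⟩
  rw [← lintegral_map hf (continuous_graphMap hc.lipschitz.continuous).measurable,
    ← setLIntegral_eq_of_support_subset (s := U) (μ := surfaceMeasure Ω)
      (fun x hx => by_contra fun h => hx (hfU x h))]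
  refine (lintegral_mono' hC le_rfl).trans (le_of_eq ?_)
  rw [lintegral_smul_measure, ENNReal.smul_def, smul_eq_mul]

end IsGraphChart

/-! ### The outer normal in a chart and the flux factor -/

lemma eventually_neg_of_hasDerivAt {g : ℝ → ℝ} {g' : ℝ} (hg : HasDerivAt g g' 0) (h0 : g 0 = 0)
    (hneg : g' < 0) : ∀ᶠ s in 𝓝[>] (0 : ℝ), g s < 0 := by
  have h1 := hg.tendsto_slope
  have h2 : ∀ᶠ s in 𝓝[≠] (0 : ℝ), slope g 0 s < 0 := h1.eventually_lt_const hneg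
  have h3 : 𝓝[>] (0 : ℝ) ≤ 𝓝[≠] 0 := nhdsWithin_mono _ fun s hs => ne_of_gt hs
  filter_upwards [h3 h2, self_mem_nhdsWithin] with s hs hs0
  have hs0' : 0 < s := hs0
  rw [slope_def_field, h0, sub_zero, sub_zero, div_neg_iff] at hs
  rcases hs with hs | hs
  · linarith
  · exact hs.1

/-- The (not normalized) outer normal to the subgraph of `h` over the point `y`. -/
def graphNormal (h : Hyperplane e → ℝ) (y : Hyperplane e) : Space d :=
  e - ((InnerProductSpace.toDual ℝ (Hyperplane e)).symm (fderiv ℝ h y) : Space d)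

/-- Identifies the boundary factor of the divergence theorem as the product of the direction with
the unnormalized normal. -/
lemma inner_graphNormal (y : Hyperplane e) (v : Space d) :
    ⟪graphNormal h y, v⟫_ℝ = ⟪e, v⟫_ℝ - fderiv ℝ h y (projHyperplane e v) := by
  rw [graphNormal, inner_sub_left]
  congr 1
  rw [← Submodule.inner_orthogonalProjectionOnto_eq_of_mem_left,
    InnerProductSpace.toDual_symm_apply]

/-- In the chart, `Ω` and its boundary are where the height defect `⟪e, x⟫ - h (projHyperplane e x)`
is negative and zero. Its gradient at the point is `graphNormal h y`, so its sign along the normal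
and its first-order vanishing on the boundary follow from differentiability. -/
lemma IsGraphChart.isOuterUnitNormal (hΩ : IsOpen Ω) (hc : IsGraphChart Ω U e K h)
    {y : Hyperplane e} (hy : graphMap e h y ∈ U) (hdiff : DifferentiableAt ℝ h y) :
    IsOuterUnitNormal Ω (graphMap e h y) (‖graphNormal h y‖⁻¹ • graphNormal h y) := by
  set N := graphNormal h y with hN
  set x := graphMap e h y with hx
  have he := hc.norm_eq_one
  have hPx : projHyperplane e x = y := projHyperplane_graphMap y
  have hxf : x ∈ frontier Ω := hc.graphMap_mem_frontier hΩ hy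
  -- The component along `e` is 1, so the normal is nonzero and can be normalized.
  have hNe : ⟪N, e⟫_ℝ = 1 := by
    rw [inner_graphNormal, projHyperplane_self, map_zero, real_inner_self_eq_norm_sq, he]
    norm_num
  have hN0 : N ≠ 0 := fun h0 => by simp [h0] at hNe
  have hNpos : 0 < ‖N‖ := norm_pos_iff.2 hN0
  have hside : ∀ v : Space d, ⟪N, v⟫_ℝ < 0 → ∀ᶠ s in 𝓝[>] (0 : ℝ),
      ⟪e, x + s • v⟫_ℝ - h (projHyperplane e (x + s • v)) < 0 := by
    intro v hv
    refine eventually_neg_of_hasDerivAt (g' := ⟪N, v⟫_ℝ) ?_ ?_ hv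
    · have h1 : HasDerivAt (fun s : ℝ => x + s • v) v 0 := by
        simpa using ((hasDerivAt_id (0 : ℝ)).smul_const v).const_add x
      have h2 := (innerSL ℝ e).hasFDerivAt.comp_hasDerivAt (0 : ℝ) h1
      have h3 := (projHyperplane e).hasFDerivAt.comp_hasDerivAt (0 : ℝ) h1
      have h4 : HasFDerivAt h (fderiv ℝ h y) (projHyperplane e (x + (0 : ℝ) • v)) := by
        rw [zero_smul, add_zero, hPx]
        exact hdiff.hasFDerivAt
      have h5 := h2.sub (h4.comp_hasDerivAt (0 : ℝ) h3)
      rw [hN, inner_graphNormal]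
      exact h5
    · rw [zero_smul, add_zero, hPx, hx, inner_graphMap he, sub_self]
  have hside' : ∀ v : Space d, 0 < ⟪N, v⟫_ℝ → ∀ᶠ s in 𝓝[>] (0 : ℝ),
      0 < ⟪e, x + s • v⟫_ℝ - h (projHyperplane e (x + s • v)) := by
    intro v hv
    have := eventually_neg_of_hasDerivAt (g' := -⟪N, v⟫_ℝ)
      (g := fun s : ℝ => -(⟪e, x + s • v⟫_ℝ - h (projHyperplane e (x + s • v)))) ?_ ?_ (by linarith)
    · filter_upwards [this] with s hs
      linarith
    · have h1 : HasDerivAt (fun s : ℝ => x + s • v) v 0 := by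
        simpa using ((hasDerivAt_id (0 : ℝ)).smul_const v).const_add x
      have h2 := (innerSL ℝ e).hasFDerivAt.comp_hasDerivAt (0 : ℝ) h1
      have h3 := (projHyperplane e).hasFDerivAt.comp_hasDerivAt (0 : ℝ) h1
      have h4 : HasFDerivAt h (fderiv ℝ h y) (projHyperplane e (x + (0 : ℝ) • v)) := by
        rw [zero_smul, add_zero, hPx]
        exact hdiff.hasFDerivAt
      have h5 := h2.sub (h4.comp_hasDerivAt (0 : ℝ) h3)
      rw [hN, inner_graphNormal]
      exact h5.neg
    · rw [zero_smul, add_zero, hPx, hx, inner_graphMap he, sub_self, neg_zero]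
  have hnear : ∀ v : Space d, ∀ᶠ s in 𝓝[>] (0 : ℝ), x + s • v ∈ U := by
    intro v
    have hcont : Continuous fun s : ℝ => x + s • v := by fun_prop
    have h1 := (hcont.tendsto 0).mono_left (nhdsWithin_le_nhds (s := Set.Ioi 0))
    rw [zero_smul, add_zero] at h1
    exact h1 (hc.isOpen.mem_nhds hy)
  have hNν : ⟪N, ‖N‖⁻¹ • N⟫_ℝ = ‖N‖ := by
    rw [inner_smul_right, real_inner_self_eq_norm_sq]
    field_simp
  refine ⟨hxf, ?_, ?_, ?_⟩
  · rw [norm_smul, norm_inv, norm_norm, inv_mul_cancel₀ hNpos.ne']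
  · have h1 : Tendsto (projHyperplane e) (𝓝[frontier Ω] x) (𝓝 y) := by
      have := ((projHyperplane e).continuous.tendsto x).mono_left
        (nhdsWithin_le_nhds (s := frontier Ω))
      rwa [hPx] at this
    have h2 := hdiff.hasFDerivAt.isLittleO.comp_tendsto h1
    have h3 : (fun z => projHyperplane e z - y) =O[𝓝[frontier Ω] x] fun z => z - x := by
      refine Asymptotics.IsBigO.of_bound 1 (Eventually.of_forall fun z => ?_)
      rw [← hPx, ← map_sub, one_mul]
      exact Submodule.norm_orthogonalProjectionOnto_apply_le _ _
    have h4 := h2.trans_isBigO h3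
    have h5 : (fun z => ⟪N, z - x⟫_ℝ) =o[𝓝[frontier Ω] x] fun z => z - x := by
      refine h4.congr' ?_ EventuallyEq.rfl
      filter_upwards [self_mem_nhdsWithin, nhdsWithin_le_nhds (hc.isOpen.mem_nhds hy)] with z hz hzU
      rw [hN, inner_graphNormal, inner_sub_right, (hc.mem_frontier_iff hΩ hzU).1 hz, hx,
        inner_graphMap he, map_sub, projHyperplane_graphMap]
      rfl
    simp only [inner_smul_left]
    exact h5.const_mul_left _
  · have h1 := hside (-(‖N‖⁻¹ • N)) (by rw [inner_neg_right, hNν]; linarith)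
    have h2 := hside' (‖N‖⁻¹ • N) (by rw [hNν]; exact hNpos)
    filter_upwards [h1, h2, hnear (-(‖N‖⁻¹ • N)), hnear (‖N‖⁻¹ • N)] with s hs1 hs2 hs3 hs4
    refine ⟨?_, hc.notMem_closure hs4 (by linarith)⟩
    rw [smul_neg, ← sub_eq_add_neg] at hs1 hs3
    exact (hc.mem_iff _ hs3).2 (by linarith)

lemma IsGraphChart.inner_sub_fderiv_eq_zero (hΩ : IsOpen Ω) (hc : IsGraphChart Ω U e K h)
    {Γ : Set (Space d)} {τ : Space d} (hτ : τ ∈ jointTangentSpace Ω Γ)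
    {y : Hyperplane e} (hy : graphMap e h y ∈ U) (hdiff : DifferentiableAt ℝ h y)
    (hyΓ : graphMap e h y ∈ Γ) : ⟪e, τ⟫_ℝ - fderiv ℝ h y (projHyperplane e τ) = 0 := by
  have hν := hc.isOuterUnitNormal hΩ hy hdiff
  have h1 : τ ∈ tangentHyperplane Ω (graphMap e h y) := by
    rw [jointTangentSpace] at hτ
    simp only [Submodule.mem_iInf] at hτ
    exact hτ _ ⟨hyΓ, _, hν⟩
  have h2 := (Submodule.mem_orthogonal _ _).1 h1 _ (Submodule.subset_span hν)
  rw [inner_smul_left, mul_eq_zero] at h2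
  rcases h2 with h2 | h2
  · exfalso
    have h3 := hν.norm_eq_one
    have h4 : ‖graphNormal h y‖⁻¹ = 0 := by simpa using h2
    rw [h4, zero_smul, norm_zero] at h3
    exact zero_ne_one h3
  · rwa [inner_graphNormal] at h2

lemma abs_inner_sub_fderiv_le (he : ‖e‖ = 1) (hh : LipschitzWith K h) (y : Hyperplane e)
    (τ : Space d) : |⟪e, τ⟫_ℝ - fderiv ℝ h y (projHyperplane e τ)| ≤ (1 + K) * ‖τ‖ := by
  have h1 := abs_real_inner_le_norm e τ
  rw [he, one_mul] at h1
  have h2 : |fderiv ℝ h y (projHyperplane e τ)| ≤ K * ‖τ‖ := by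
    refine (ContinuousLinearMap.le_opNorm (fderiv ℝ h y) _).trans ?_
    gcongr
    · exact norm_fderiv_le_of_lipschitz ℝ hh
    · exact Submodule.norm_orthogonalProjectionOnto_apply_le _ _
  calc _ ≤ |⟪e, τ⟫_ℝ| + |fderiv ℝ h y (projHyperplane e τ)| := abs_sub _ _
    _ ≤ _ := by linarith

lemma IsGraphChart.setIntegral_fderiv_eq (hΩ : IsOpen Ω) (hc : IsGraphChart Ω U e K h)
    {φ : Space d → ℂ} (hφU : tsupport φ ⊆ U) (τ : Space d) :
    ∫ x in Ω, fderiv ℝ φ x τ = ∫ x in subgraph e h, fderiv ℝ φ x τ := by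
  rw [← integral_indicator hΩ.measurableSet,
    ← integral_indicator (measurableSet_subgraph hc.lipschitz.continuous)]
  refine integral_congr_ae (Eventually.of_forall fun x => ?_)
  by_cases hx : x ∈ U
  · have h1 : x ∈ Ω ↔ x ∈ subgraph e h := hc.mem_iff x hx
    by_cases hxΩ : x ∈ Ω
    · simp only [Set.indicator_of_mem hxΩ, Set.indicator_of_mem (h1.1 hxΩ)]
    · simp only [Set.indicator_of_notMem hxΩ, Set.indicator_of_notMem fun h => hxΩ (h1.2 h)]
  · have h1 : fderiv ℝ φ x = 0 :=
      image_eq_zero_of_notMem_tsupport fun hmem => hx (hφU (tsupport_fderiv_subset ℝ hmem))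
    simp [Set.indicator, h1]

/-- In a chart, the integral of a derivative in a direction tangential to `Γ` is controlled by the
boundary values outside `Γ`. -/
lemma IsGraphChart.exists_enorm_setIntegral_fderiv_le (hΩ : IsOpen Ω) (hd : 1 ≤ d)
    (hc : IsGraphChart Ω U e K h) {Γ : Set (Space d)} (hΓ : MeasurableSet Γ) {τ : Space d}
    (hτ : τ ∈ jointTangentSpace Ω Γ) : ∃ C : ℝ≥0, ∀ φ : Space d → ℂ, ContDiff ℝ 1 φ →
      HasCompactSupport φ → tsupport φ ⊆ U →
      ‖∫ x in Ω, fderiv ℝ φ x τ‖ₑ ≤ C * ∫⁻ x in Γᶜ, ‖φ x‖ₑ ∂(surfaceMeasure Ω) := by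
  obtain ⟨c, hc0, hcφ⟩ := exists_integral_fderiv_subgraph hc.norm_eq_one
  refine ⟨Real.toNNReal (c⁻¹ * ((1 + K) * ‖τ‖)), fun φ hφ hcs hφU => ?_⟩
  have h1 := hcφ hc.lipschitz hφ hcs τ
  have h2 : ∫ x in Ω, fderiv ℝ φ x τ = (c⁻¹ : ℝ) • ∫ y, φ (graphMap e h y) *
      ((⟪e, τ⟫_ℝ - fderiv ℝ h y (projHyperplane e τ) : ℝ) : ℂ) ∂(hyperplaneMeasure e) := by
    rw [← h1, hc.setIntegral_fderiv_eq hΩ hφU, ← Complex.coe_smul, smul_eq_mul, ← mul_assoc,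
      Complex.ofReal_inv, inv_mul_cancel₀ (by exact_mod_cast hc0.ne'), one_mul]
  have hf : Measurable fun x => Γᶜ.indicator (fun x => ‖φ x‖ₑ) x :=
    hφ.continuous.enorm.measurable.indicator hΓ.compl
  have h3 := hc.lintegral_comp_graphMap_le hΩ hd hf fun x hx => by
    have : φ x = 0 := image_eq_zero_of_notMem_tsupport fun h => hx (hφU h)
    simp [Set.indicator, this]
  rw [lintegral_indicator hΓ.compl] at h3
  -- Wherever `h` is differentiable, the flux factor vanishes over `Γ` because `τ` is tangential
  -- there; elsewhere it is at most `(1 + K) * ‖τ‖`.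
  have h4 : ∀ᵐ y ∂(hyperplaneMeasure e), ‖φ (graphMap e h y) *
      ((⟪e, τ⟫_ℝ - fderiv ℝ h y (projHyperplane e τ) : ℝ) : ℂ)‖ₑ ≤
      ENNReal.ofReal ((1 + K) * ‖τ‖) * Γᶜ.indicator (fun x => ‖φ x‖ₑ) (graphMap e h y) := by
    filter_upwards [hc.lipschitz.ae_differentiableAt (μ := hyperplaneMeasure e)] with y hy
    by_cases hyU : graphMap e h y ∈ U
    · by_cases hyΓ : graphMap e h y ∈ Γ
      · rw [hc.inner_sub_fderiv_eq_zero hΩ hτ hyU hy hyΓ]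
        simp
      · rw [Set.indicator_of_mem (show graphMap e h y ∈ Γᶜ from hyΓ), enorm_mul, mul_comm]
        gcongr
        rw [← ofReal_norm, Complex.norm_real]
        exact ENNReal.ofReal_le_ofReal (abs_inner_sub_fderiv_le hc.norm_eq_one hc.lipschitz y τ)
    · have : φ (graphMap e h y) = 0 := image_eq_zero_of_notMem_tsupport fun h => hyU (hφU h)
      simp [this]
  rw [h2, enorm_smul]
  calc _ ≤ ‖c⁻¹‖ₑ * ∫⁻ y, ENNReal.ofReal ((1 + K) * ‖τ‖) *
        Γᶜ.indicator (fun x => ‖φ x‖ₑ) (graphMap e h y) ∂(hyperplaneMeasure e) := by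
        gcongr
        exact (enorm_integral_le_lintegral_enorm _).trans (lintegral_mono_ae h4)
    _ ≤ ‖c⁻¹‖ₑ * (ENNReal.ofReal ((1 + K) * ‖τ‖) * ∫⁻ x in Γᶜ, ‖φ x‖ₑ ∂(surfaceMeasure Ω)) := by
        rw [lintegral_const_mul' _ _ ENNReal.ofReal_ne_top]
        gcongr
    _ = _ := by
        rw [← mul_assoc, Real.enorm_of_nonneg (by positivity), ← ENNReal.ofReal_mul (by positivity)]
        rfl

/-- In a chart, the boundary integral of a nonnegative function is controlled by its derivative. -/
lemma IsGraphChart.exists_lintegral_le_enorm_setIntegral (hΩ : IsOpen Ω) (hd : 1 ≤ d)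
    (hc : IsGraphChart Ω U e K h) : ∃ C : ℝ≥0, ∀ η : Space d → ℂ, ContDiff ℝ 1 η →
      HasCompactSupport η → tsupport η ⊆ U → (∀ x, η x = ‖η x‖) →
      ∫⁻ x, ‖η x‖ₑ ∂(surfaceMeasure Ω) ≤ C * ‖∫ x in Ω, fderiv ℝ η x e‖ₑ := by
  obtain ⟨c, hc0, hcφ⟩ := exists_integral_fderiv_subgraph hc.norm_eq_one
  obtain ⟨C, hC⟩ := hc.lintegral_surfaceMeasure_le hΩ hd
  refine ⟨C * Real.toNNReal c, fun η hη hcs hηU hpos => ?_⟩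
  -- In the direction `τ = e` the flux factor is identically 1.
  have h1 := hcφ hc.lipschitz hη hcs e
  rw [projHyperplane_self, ← hc.setIntegral_fderiv_eq hΩ hηU] at h1
  simp only [map_zero, sub_zero, real_inner_self_eq_norm_sq, hc.norm_eq_one, one_pow,
    Complex.ofReal_one, mul_one] at h1
  have h2 : ∫⁻ y, ‖η (graphMap e h y)‖ₑ ∂(hyperplaneMeasure e) =
      ‖∫ y, η (graphMap e h y) ∂(hyperplaneMeasure e)‖ₑ := by
    have h3 : Integrable (fun y => η (graphMap e h y)) (hyperplaneMeasure e) := by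
      refine (hη.continuous.comp (continuous_graphMap
        hc.lipschitz.continuous)).integrable_of_hasCompactSupport ?_
      refine HasCompactSupport.intro (hcs.isCompact.image (projHyperplane e).continuous)
        fun y hy => image_eq_zero_of_notMem_tsupport (f := η) fun hmem => hy ?_
      exact ⟨_, hmem, projHyperplane_graphMap y⟩
    have h4 : ∫ y, η (graphMap e h y) ∂(hyperplaneMeasure e) =
        ((∫ y, ‖η (graphMap e h y)‖ ∂(hyperplaneMeasure e) : ℝ) : ℂ) := by
      rw [← integral_complex_ofReal]
      exact integral_congr_ae (Eventually.of_forall fun y => hpos _)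
    rw [h4, ← ofReal_norm, Complex.norm_real, Real.norm_of_nonneg
      (integral_nonneg fun y => norm_nonneg _), ofReal_integral_norm_eq_lintegral_enorm h3]
  refine (hC (fun x => ‖η x‖ₑ) hη.continuous.enorm.measurable fun x hx => ?_).trans (le_of_eq ?_)
  · rw [image_eq_zero_of_notMem_tsupport fun h => hx (hηU h), enorm_zero]
  · rw [h2, ← h1, enorm_mul, ← mul_assoc]
    congr 1
    rw [← ofReal_norm, Complex.norm_real, Real.norm_of_nonneg hc0.le]
    rfl

end Chart

end MixedLaplacian

end

noncomputable section

namespace MixedLaplacian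

variable {d : ℕ}

/-! ### Global estimates by a partition of unity -/

section Global

open scoped Manifold

variable {Ω : Set (Space d)}

lemma exists_partition_subordinate_charts (hΩ : IsBoundedLipschitzDomain Ω) :
    ∃ (ι : Type) (_ : Fintype ι) (χ : ι → Space d → ℝ), (∀ i, ContDiff ℝ ∞ (χ i)) ∧
      (∀ i, HasCompactSupport (χ i)) ∧ (∀ i x, 0 ≤ χ i x) ∧ (∀ i x, χ i x ≤ 1) ∧
      (∀ x ∈ closure Ω, ∑ i, χ i x = 1) ∧
      ∀ i, tsupport (χ i) ⊆ Ω ∨ ∃ U e K h, IsGraphChart Ω U e K h ∧ tsupport (χ i) ⊆ U := by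
  have key : ∀ x ∈ closure Ω, ∃ V : Set (Space d), IsOpen V ∧ x ∈ V ∧ Bornology.IsBounded V ∧
      (V ⊆ Ω ∨ ∃ U e K h, IsGraphChart Ω U e K h ∧ V ⊆ U) := by
    intro x hx
    by_cases hxΩ : x ∈ Ω
    · exact ⟨Ω, hΩ.isOpen, hxΩ, hΩ.isBounded, Or.inl le_rfl⟩
    · obtain ⟨U, hU, hxU, e, he, K, h, hh, hgraph⟩ :=
        hΩ.locally_graph x ⟨hx, by rwa [hΩ.isOpen.interior_eq]⟩
      -- Intersecting with a ball makes the supports of the partition compact.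
      exact ⟨U ∩ Metric.ball x 1, hU.inter Metric.isOpen_ball, ⟨hxU, Metric.mem_ball_self one_pos⟩,
        Metric.isBounded_ball.subset Set.inter_subset_right,
        Or.inr ⟨U, e, K, h, ⟨hU, he, hh, hgraph⟩, Set.inter_subset_left⟩⟩
  choose! V hVo hVx hVb hV using key
  obtain ⟨t, htc, htV⟩ := hΩ.isBounded.isCompact_closure.elim_nhds_subcover V
    fun x hx => (hVo x hx).mem_nhds (hVx x hx)
  obtain ⟨f, hf⟩ := SmoothPartitionOfUnity.exists_isSubordinate 𝓘(ℝ, Space d)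
    (isClosed_closure (s := Ω)) (fun i : t => V i) (fun i => hVo _ (htc i i.2)) (fun x hx => by
      obtain ⟨y, hy, hxy⟩ := Set.mem_iUnion₂.1 (htV hx)
      exact Set.mem_iUnion.2 ⟨⟨y, hy⟩, hxy⟩)
  refine ⟨t, inferInstance, fun i => f i, fun i => (f i).contMDiff.contDiff, fun i => ?_,
    fun i x => f.nonneg i x, fun i x => f.le_one i x, fun x hx => ?_, fun i => ?_⟩
  · exact Metric.isCompact_of_isClosed_isBounded (isClosed_tsupport _)
      ((hVb _ (htc i i.2)).subset (hf i))
  · rw [← finsum_eq_sum_of_fintype]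
    exact f.sum_eq_one hx
  · rcases hV _ (htc i i.2) with h | ⟨U, e, K, h, hc, hVU⟩
    · exact Or.inl ((hf i).trans h)
    · exact Or.inr ⟨U, e, K, h, hc, (hf i).trans hVU⟩

lemma integrable_of_continuous (hb : Bornology.IsBounded Ω) {E : Type*} [NormedAddCommGroup E]
    {f : Space d → E} (hf : Continuous f) : Integrable f (volume.restrict Ω) :=
  (hf.locallyIntegrable.integrableOn_isCompact hb.isCompact_closure).mono_set subset_closure

lemma setIntegral_fderiv_eq_zero {φ : Space d → ℂ} (hφ : IsTestFunction Ω φ) (τ : Space d) :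
    ∫ x in Ω, fderiv ℝ φ x τ = 0 := by
  have hcont : Continuous fun x => fderiv ℝ φ x τ :=
    (hφ.contDiff.continuous_fderiv (by simp)).clm_apply continuous_const
  have h1 : ∫ x in Ω, fderiv ℝ φ x τ = ∫ x, fderiv ℝ φ x τ := by
    refine setIntegral_eq_integral_of_forall_compl_eq_zero fun x hx => ?_
    have : fderiv ℝ φ x = 0 := image_eq_zero_of_notMem_tsupport fun h =>
      hx (hφ.tsupport_subset (tsupport_fderiv_subset ℝ h))
    rw [this]
    rfl
  have h2 := integral_mul_fderiv_eq_neg_fderiv_mul_of_integrable (μ := (volume : Measure (Space d)))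
    (f := fun _ => (1 : ℂ)) (g := φ) (v := τ) (by simp)
    (by
      simp only [one_mul]
      exact hcont.integrable_of_hasCompactSupport (hφ.hasCompactSupport.fderiv_apply ℝ _))
    (by
      simp only [one_mul]
      exact hφ.contDiff.continuous.integrable_of_hasCompactSupport hφ.hasCompactSupport)
    (fun x _ => differentiableAt_const _) (fun x _ => hφ.contDiff.differentiable (by simp) x)
  rw [h1]
  simpa using h2

lemma contDiff_ofReal_comp {χ : Space d → ℝ} (h : ContDiff ℝ ∞ χ) :
    ContDiff ℝ ∞ fun x => (χ x : ℂ) :=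
  Complex.ofRealCLM.contDiff.comp h

lemma tsupport_ofReal_mul_subset {χ : Space d → ℝ} {φ : Space d → ℂ} :
    tsupport (fun x => (χ x : ℂ) * φ x) ⊆ tsupport χ :=
  closure_mono fun x hx => by
    simp only [Function.mem_support, ne_eq, mul_eq_zero, not_or, Complex.ofReal_eq_zero] at hx ⊢
    exact hx.1

lemma hasCompactSupport_ofReal_mul {χ : Space d → ℝ} {φ : Space d → ℂ} (h : HasCompactSupport χ) :
    HasCompactSupport fun x => (χ x : ℂ) * φ x :=
  h.of_isClosed_subset (isClosed_tsupport _) tsupport_ofReal_mul_subset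

/-- The integral of the derivative of a smooth function in a direction which is tangential to `Γ` is
controlled by the boundary values outside `Γ`. -/
theorem exists_enorm_setIntegral_fderiv_le (hΩ : IsBoundedLipschitzDomain Ω) (hd : 1 ≤ d)
    {Γ : Set (Space d)} (hΓ : MeasurableSet Γ) {τ : Space d} (hτ : τ ∈ jointTangentSpace Ω Γ) :
    ∃ C : ℝ≥0, ∀ φ : Space d → ℂ, ContDiff ℝ ∞ φ →
      ‖∫ x in Ω, fderiv ℝ φ x τ‖ₑ ≤ C * ∫⁻ x in Γᶜ, ‖φ x‖ₑ ∂(surfaceMeasure Ω) := by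
  obtain ⟨ι, _, χ, hχ, hχc, hχ0, hχ1, hχs, hcover⟩ := exists_partition_subordinate_charts hΩ
  have key : ∀ i, ∃ C : ℝ≥0, ∀ φ : Space d → ℂ, ContDiff ℝ ∞ φ →
      ‖∫ x in Ω, fderiv ℝ (fun x => (χ i x : ℂ) * φ x) x τ‖ₑ ≤
        C * ∫⁻ x in Γᶜ, ‖φ x‖ₑ ∂(surfaceMeasure Ω) := by
    intro i
    rcases hcover i with h | ⟨U, e, K, h, hc, hU⟩
    · refine ⟨0, fun φ hφ => ?_⟩
      rw [setIntegral_fderiv_eq_zero ⟨(contDiff_ofReal_comp (hχ i)).mul hφ,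
        hasCompactSupport_ofReal_mul (hχc i), tsupport_ofReal_mul_subset.trans h⟩]
      simp
    · obtain ⟨C, hC⟩ := hc.exists_enorm_setIntegral_fderiv_le hΩ.isOpen hd hΓ hτ
      refine ⟨C, fun φ hφ => (hC _ (((contDiff_ofReal_comp (hχ i)).mul hφ).of_le (by simp))
        (hasCompactSupport_ofReal_mul (hχc i)) (tsupport_ofReal_mul_subset.trans hU)).trans ?_⟩
      gcongr with x
      rw [enorm_mul]
      refine mul_le_of_le_one_left' ?_
      rw [← ofReal_norm, Complex.norm_real, Real.norm_of_nonneg (hχ0 i x)]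
      exact ENNReal.ofReal_le_one.2 (hχ1 i x)
  choose C hC using key
  refine ⟨∑ i, C i, fun φ hφ => ?_⟩
  have hi : ∀ i, ContDiff ℝ ∞ fun x => (χ i x : ℂ) * φ x := fun i =>
    (contDiff_ofReal_comp (hχ i)).mul hφ
  have h1 : ∫ x in Ω, fderiv ℝ φ x τ =
      ∑ i, ∫ x in Ω, fderiv ℝ (fun x => (χ i x : ℂ) * φ x) x τ := by
    rw [← integral_finsetSum]
    · refine setIntegral_congr_fun hΩ.isOpen.measurableSet fun x hx => ?_
      -- The partition sums to 1 only on the closure; near a point of the open set `Ω` this suffices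
      -- to compare derivatives.
      have h2 : φ =ᶠ[𝓝 x] fun x => ∑ i, (χ i x : ℂ) * φ x := by
        filter_upwards [hΩ.isOpen.mem_nhds hx] with z hz
        rw [← Finset.sum_mul, ← Complex.ofReal_sum, hχs z (subset_closure hz), Complex.ofReal_one,
          one_mul]
      rw [h2.fderiv_eq, fderiv_fun_sum fun i _ => (hi i).differentiable (by simp) x]
      simp
    · intro i _
      exact integrable_of_continuous hΩ.isBounded
        (((hi i).continuous_fderiv (by simp)).clm_apply continuous_const)
  rw [h1]
  refine (enorm_sum_le _ _).trans ?_
  push_cast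
  rw [Finset.sum_mul]
  exact Finset.sum_le_sum fun i _ => hC i φ hφ

lemma norm_sq_eq_integral {μ : Measure (Space d)} (u : Lp ℂ 2 μ) {φ : Space d → ℂ} (h : u =ᵐ[μ] φ) :
    ‖u‖ ^ 2 = ∫ x, ‖φ x‖ ^ 2 ∂μ := by
  have h1 : ((‖u‖ ^ 2 : ℝ) : ℂ) = ((∫ x, ‖φ x‖ ^ 2 ∂μ : ℝ) : ℂ) := by
    have h2 := inner_self_eq_norm_sq_to_K (𝕜 := ℂ) u
    rw [L2.inner_def] at h2
    rw [← integral_complex_ofReal, Complex.ofReal_pow]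
    refine h2.symm.trans (integral_congr_ae ?_)
    filter_upwards [h] with x hx
    rw [hx, inner_self_eq_norm_sq_to_K]
    simp
  exact Complex.ofReal_injective h1

lemma norm_sq_smoothJet (hb : Bornology.IsBounded Ω) {φ : Space d → ℂ} (hφ : ContDiff ℝ ∞ φ) :
    ‖smoothJet hb hφ‖ ^ 2 = ∫ x in Ω, (‖φ x‖ ^ 2 + ∑ i, ‖partialDeriv i φ x‖ ^ 2) := by
  rw [norm_sq_jet, integral_add, integral_finsetSum, norm_sq_eq_integral _ (smoothJet_none hb hφ)]
  · congr 1
    exact Finset.sum_congr rfl fun i _ => norm_sq_eq_integral _ (smoothJet_some hb hφ i)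
  · intro i _
    exact integrable_of_continuous hb ((continuous_partialDeriv hφ i).norm.pow 2)
  · exact integrable_of_continuous hb (hφ.continuous.norm.pow 2)
  · exact integrable_of_continuous hb
      (continuous_finsetSum _ fun i _ => (continuous_partialDeriv hφ i).norm.pow 2)

/-- **Trace inequality**: the boundary values of smooth functions are bounded in `L²(∂Ω)` by
the Sobolev norm. -/
theorem exists_lintegral_surfaceMeasure_le (hΩ : IsBoundedLipschitzDomain Ω) (hd : 1 ≤ d) :
    ∃ C : ℝ≥0, ∀ φ : Space d → ℂ, ∀ hφ : ContDiff ℝ ∞ φ,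
      ∫⁻ x, ‖φ x‖ₑ ^ 2 ∂(surfaceMeasure Ω) ≤ C * ‖smoothJet hΩ.isBounded hφ‖ₑ ^ 2 := by
  obtain ⟨ι, _, χ, hχ, hχc, hχ0, hχ1, hχs, hcover⟩ := exists_partition_subordinate_charts hΩ
  -- The chart estimate is applied to `χ i * |φ|²`: its derivative is integrable with a bound
  -- quadratic in the jet.
  have key : ∀ i, ∃ C : ℝ≥0, ∀ φ : Space d → ℂ, ∀ hφ : ContDiff ℝ ∞ φ,
      ∫⁻ x, ‖(χ i x : ℂ) * (φ x * starRingEnd ℂ (φ x))‖ₑ ∂(surfaceMeasure Ω) ≤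
        C * ‖smoothJet hΩ.isBounded hφ‖ₑ ^ 2 := by
    intro i
    rcases hcover i with h | ⟨U, e, K, h, hc, hU⟩
    · refine ⟨0, fun φ hφ => ?_⟩
      have h1 : ∫⁻ x, ‖(χ i x : ℂ) * (φ x * starRingEnd ℂ (φ x))‖ₑ ∂(surfaceMeasure Ω) = 0 := by
        rw [surfaceMeasure]
        refine (setLIntegral_congr_fun isClosed_frontier.measurableSet fun x hx => ?_).trans
          lintegral_zero
        have hxΩ : x ∉ Ω := by
          rw [frontier, hΩ.isOpen.interior_eq] at hx
          exact hx.2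
        have : χ i x = 0 := image_eq_zero_of_notMem_tsupport fun hx' => hxΩ (h hx')
        simp [this]
      rw [h1]
      exact zero_le
    · obtain ⟨C, hC⟩ := hc.exists_lintegral_le_enorm_setIntegral hΩ.isOpen hd
      have hX := contDiff_ofReal_comp (hχ i)
      have hb : ∃ B : ℝ, ∀ j x, ‖partialDeriv j (fun x => (χ i x : ℂ)) x‖ ≤ B := by
        have hcs : HasCompactSupport fun x => (χ i x : ℂ) := (hχc i).comp_left Complex.ofReal_zero
        obtain ⟨B, hB⟩ := (hcs.fderiv ℝ).exists_bound_of_continuous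
          (hX.continuous_fderiv (by simp))
        refine ⟨B, fun j x => ((ContinuousLinearMap.le_opNorm _ _).trans ?_).trans (hB x)⟩
        simp
      obtain ⟨B, hB⟩ := hb
      -- `B` bounds the derivatives of the cutoff, the 2 covers `2 * ‖φ‖ * ‖∂ⱼφ‖` from
      -- differentiating `|φ|²`, and `d` counts the coordinates of `e`.
      refine ⟨C * Real.toNNReal (d * (B + 2)), fun φ hφ => ?_⟩
      have hφc := contDiff_conj hφ
      have hφφ : ContDiff ℝ ∞ (φ * fun x => starRingEnd ℂ (φ x)) := hφ.mul hφc
      have hη := hX.mul hφφ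
      refine (hC _ (hη.of_le (by simp)) (hasCompactSupport_ofReal_mul (hχc i))
        (tsupport_ofReal_mul_subset.trans hU) fun x => ?_).trans ?_
      · rw [Pi.mul_apply, Complex.mul_conj', ← Complex.ofReal_pow, ← Complex.ofReal_mul, Complex.norm_real,
          Real.norm_of_nonneg (mul_nonneg (hχ0 i x) (by positivity))]
      · have hpt : ∀ x, ‖fderiv ℝ ((fun x => (χ i x : ℂ)) *
            (φ * fun x => starRingEnd ℂ (φ x))) x e‖ ≤
            d * (B + 2) * (‖φ x‖ ^ 2 + ∑ j, ‖partialDeriv j φ x‖ ^ 2) := by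
          intro x
          have hB0 : ∀ j : Fin d, 0 ≤ B := fun j => (norm_nonneg _).trans (hB j x)
          rw [fderiv_apply_eq_sum_partialDeriv]
          have h1 : ∀ j, ‖(e j : ℂ) * partialDeriv j ((fun x => (χ i x : ℂ)) *
              (φ * fun x => starRingEnd ℂ (φ x))) x‖ ≤
              (B + 2) * (‖φ x‖ ^ 2 + ∑ j, ‖partialDeriv j φ x‖ ^ 2) := by
            intro j
            have he : ‖(e j : ℂ)‖ ≤ 1 := by
              rw [Complex.norm_real, ← hc.norm_eq_one]
              exact PiLp.norm_apply_le e j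
            have hχn : ‖(χ i x : ℂ)‖ ≤ 1 := by
              rw [Complex.norm_real, Real.norm_of_nonneg (hχ0 i x)]
              exact hχ1 i x
            have hj : ‖partialDeriv j φ x‖ ^ 2 ≤ ∑ j, ‖partialDeriv j φ x‖ ^ 2 :=
              Finset.single_le_sum (f := fun j => ‖partialDeriv j φ x‖ ^ 2)
                (fun _ _ => by positivity) (Finset.mem_univ j)
            rw [partialDeriv_mul hX hφφ, partialDeriv_mul hφ hφc, partialDeriv_conj hφ,
              norm_mul]
            refine (mul_le_of_le_one_left (norm_nonneg _) he).trans ?_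
            refine (norm_add_le _ _).trans ?_
            have h2 : ‖partialDeriv j (fun x => (χ i x : ℂ)) x *
                (φ * fun x => starRingEnd ℂ (φ x)) x‖ ≤ B * ‖φ x‖ ^ 2 := by
              rw [norm_mul, Pi.mul_apply, norm_mul, RCLike.norm_conj, ← sq]
              gcongr
              exact hB j x
            have h3 : ‖(χ i x : ℂ) * (partialDeriv j φ x * starRingEnd ℂ (φ x) +
                φ x * starRingEnd ℂ (partialDeriv j φ x))‖ ≤ 2 * (‖φ x‖ * ‖partialDeriv j φ x‖) := by
              rw [norm_mul]
              refine (mul_le_of_le_one_left (norm_nonneg _) hχn).trans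
                ((norm_add_le _ _).trans (le_of_eq ?_))
              rw [norm_mul, norm_mul, RCLike.norm_conj, RCLike.norm_conj]
              ring
            refine (add_le_add h2 h3).trans ?_
            have h4 : 0 ≤ B * ∑ j, ‖partialDeriv j φ x‖ ^ 2 :=
              mul_nonneg (hB0 j) (Finset.sum_nonneg fun _ _ => by positivity)
            nlinarith [sq_nonneg (‖φ x‖ - ‖partialDeriv j φ x‖), sq_nonneg ‖φ x‖,
              sq_nonneg ‖partialDeriv j φ x‖]
          refine (norm_sum_le_of_le _ fun j _ => h1 j).trans (le_of_eq ?_)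
          rw [Finset.sum_const, Finset.card_univ, Fintype.card_fin, nsmul_eq_mul, mul_assoc]
        have hN : Integrable (fun x => d * (B + 2) * (‖φ x‖ ^ 2 + ∑ j, ‖partialDeriv j φ x‖ ^ 2))
            (volume.restrict Ω) :=
          integrable_of_continuous hΩ.isBounded (continuous_const.mul ((hφ.continuous.norm.pow 2).add
            (continuous_finsetSum _ fun j _ => (continuous_partialDeriv hφ j).norm.pow 2)))
        have hle := norm_integral_le_of_norm_le hN (Eventually.of_forall hpt)
        rw [integral_const_mul, ← norm_sq_smoothJet hΩ.isBounded hφ] at hle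
        have hle' := ENNReal.ofReal_le_ofReal hle
        rw [ofReal_norm, ENNReal.ofReal_mul' (by positivity), ENNReal.ofReal_pow (norm_nonneg _),
          ofReal_norm] at hle'
        rw [ENNReal.coe_mul, mul_assoc]
        gcongr
        exact hle'
  choose C hC using key
  refine ⟨∑ i, C i, fun φ hφ => ?_⟩
  have h1 : ∀ᵐ x ∂(surfaceMeasure Ω), ‖φ x‖ₑ ^ 2 =
      ∑ i, ‖(χ i x : ℂ) * (φ x * starRingEnd ℂ (φ x))‖ₑ := by
    filter_upwards [ae_restrict_mem isClosed_frontier.measurableSet] with x hx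
    have h2 : ∀ i, ‖(χ i x : ℂ)‖ₑ = ENNReal.ofReal (χ i x) := fun i => by
      rw [← ofReal_norm, Complex.norm_real, Real.norm_of_nonneg (hχ0 i x)]
    have h3 : ‖starRingEnd ℂ (φ x)‖ₑ = ‖φ x‖ₑ := by
      rw [← ofReal_norm, RCLike.norm_conj, ofReal_norm]
    simp only [enorm_mul, h2, h3, ← sq]
    rw [← Finset.sum_mul, ← ENNReal.ofReal_sum_of_nonneg fun i _ => hχ0 i x,
      hχs x (frontier_subset_closure hx), ENNReal.ofReal_one, one_mul]
  rw [lintegral_congr_ae h1, lintegral_finsetSum]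
  · push_cast
    rw [Finset.sum_mul]
    exact Finset.sum_le_sum fun i _ => hC i φ hφ
  · intro i _
    have := (hχ i).continuous
    have := hφ.continuous
    exact (by fun_prop : Continuous fun x => (χ i x : ℂ) * (φ x * starRingEnd ℂ (φ x))).enorm.measurable

/-- The trace inequality applied to the constant 1. -/
lemma isFiniteMeasure_surfaceMeasure (hΩ : IsBoundedLipschitzDomain Ω) (hd : 1 ≤ d) :
    IsFiniteMeasure (surfaceMeasure Ω) := by
  obtain ⟨C, hC⟩ := exists_lintegral_surfaceMeasure_le hΩ hd
  have h := hC (fun _ => 1) contDiff_const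
  simp only [enorm_one, one_pow, lintegral_one] at h
  exact ⟨h.trans_lt (ENNReal.mul_lt_top ENNReal.coe_lt_top (ENNReal.pow_lt_top enorm_lt_top))⟩

/-- Read in a chart, the piece contains the graph over a nonempty open subset of the hyperplane.
This later keeps plane waves out of the form domain of the mixed problem. -/
lemma surfaceMeasure_pos (hΩ : IsBoundedLipschitzDomain Ω) (hd : 1 ≤ d) {Γ : Set (Space d)}
    (hΓ : IsRelOpenInBoundary Ω Γ) (hne : Γ.Nonempty) : 0 < surfaceMeasure Ω Γ := by
  obtain ⟨W, hW, rfl⟩ := hΓ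
  obtain ⟨x, hxW, hxf⟩ := hne
  obtain ⟨U, hU, hxU, e, he, K, h, hh, hgraph⟩ := hΩ.locally_graph x hxf
  have hc : IsGraphChart Ω U e K h := ⟨hU, he, hh, hgraph⟩
  have h1 := hc.map_graphMap_restrict_le hΩ.isOpen hd W
  have hcont := continuous_graphMap hh.continuous (e := e)
  rw [Measure.restrict_apply hW.measurableSet,
    Measure.map_apply hcont.measurable (hW.inter hU).measurableSet] at h1
  have h2 : 0 < hyperplaneMeasure e (graphMap e h ⁻¹' (W ∩ U)) := by
    refine ((hW.inter hU).preimage hcont).measure_pos _ ⟨projHyperplane e x, ?_⟩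
    rw [Set.mem_preimage, hc.graphMap_projHyperplane hΩ.isOpen hxU hxf]
    exact ⟨hxW, hxU⟩
  refine (h2.trans_le h1).trans_le (le_of_eq ?_)
  rw [surfaceMeasure, Measure.restrict_apply hW.measurableSet,
    Measure.restrict_apply (hW.measurableSet.inter isClosed_frontier.measurableSet),
    Set.inter_assoc, Set.inter_self]

end Global

end MixedLaplacian

end

noncomputable section

namespace MixedLaplacian

variable {d : ℕ}

/-! ### The trace operator -/

section Trace

variable {Ω Γ : Set (Space d)}

lemma memLp_surfaceMeasure (hΩ : IsBoundedLipschitzDomain Ω) (hd : 1 ≤ d) {φ : Space d → ℂ}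
    (hφ : Continuous φ) : MemLp φ 2 (surfaceMeasure Ω) := by
  have := isFiniteMeasure_surfaceMeasure hΩ hd
  have hK : IsCompact (frontier Ω) :=
    Metric.isCompact_of_isClosed_isBounded isClosed_frontier
      (hΩ.isBounded.closure.subset frontier_subset_closure)
  obtain ⟨C, hC⟩ := (hK.image hφ).isBounded.exists_norm_le
  refine MemLp.of_bound hφ.aestronglyMeasurable C ?_
  filter_upwards [ae_restrict_mem isClosed_frontier.measurableSet] with x hx
  exact hC _ ⟨x, hx, rfl⟩

/-- The jets of smooth functions together with their boundary values. -/
def smoothTraceGraph (Ω : Set (Space d)) :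
    Submodule ℂ (JetSpace Ω × Lp ℂ 2 (surfaceMeasure Ω)) where
  carrier := {q | ∃ φ : Space d → ℂ, ContDiff ℝ ∞ φ ∧ q.1 none =ᵐ[volume.restrict Ω] φ ∧
    (∀ i, q.1 (some i) =ᵐ[volume.restrict Ω] partialDeriv i φ) ∧ q.2 =ᵐ[surfaceMeasure Ω] φ}
  zero_mem' := by
    refine ⟨0, contDiff_zero_fun, Lp.coeFn_zero _ _ _, fun i => ?_, Lp.coeFn_zero _ _ _⟩
    have : partialDeriv i (0 : Space d → ℂ) = 0 := by
      funext x
      simp [partialDeriv]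
    rw [this]
    exact Lp.coeFn_zero _ _ _
  add_mem' := by
    rintro p q ⟨φ, hφ, h1, h2, h3⟩ ⟨ψ, hψ, k1, k2, k3⟩
    refine ⟨φ + ψ, hφ.add hψ, (Lp.coeFn_add _ _).trans (h1.add k1), fun i => ?_,
      (Lp.coeFn_add _ _).trans (h3.add k3)⟩
    rw [partialDeriv_add hφ hψ]
    exact (Lp.coeFn_add _ _).trans ((h2 i).add (k2 i))
  smul_mem' := by
    rintro c p ⟨φ, hφ, h1, h2, h3⟩
    refine ⟨c • φ, contDiff_const.smul hφ, (Lp.coeFn_smul c _).trans (h1.const_smul c),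
      fun i => ?_, (Lp.coeFn_smul c _).trans (h3.const_smul c)⟩
    rw [partialDeriv_smul c hφ]
    exact (Lp.coeFn_smul c _).trans ((h2 i).const_smul c)

/-- The graph of the trace operator. -/
def traceGraph (Ω : Set (Space d)) : Submodule ℂ (JetSpace Ω × Lp ℂ 2 (surfaceMeasure Ω)) :=
  (smoothTraceGraph Ω).topologicalClosure

lemma mem_smoothTraceGraph_iff (hb : Bornology.IsBounded Ω)
    {q : JetSpace Ω × Lp ℂ 2 (surfaceMeasure Ω)} : q ∈ smoothTraceGraph Ω ↔
      ∃ (φ : Space d → ℂ) (hφ : ContDiff ℝ ∞ φ), q.1 = smoothJet hb hφ ∧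
        q.2 =ᵐ[surfaceMeasure Ω] φ := by
  constructor
  · rintro ⟨φ, hφ, h1, h2, h3⟩
    refine ⟨φ, hφ, PiLp.ext fun j => ?_, h3⟩
    cases j with
    | none => exact Lp.ext (h1.trans (smoothJet_none hb hφ).symm)
    | some i => exact Lp.ext ((h2 i).trans (smoothJet_some hb hφ i).symm)
  · rintro ⟨φ, hφ, h1, h2⟩
    refine ⟨φ, hφ, ?_, fun i => ?_, h2⟩
    · rw [h1]
      exact smoothJet_none hb hφ
    · rw [h1]
      exact smoothJet_some hb hφ i

lemma closure_smoothTraceGraph_subset {s : Set (JetSpace Ω × Lp ℂ 2 (surfaceMeasure Ω))}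
    (hs : IsClosed s) (h : (smoothTraceGraph Ω : Set _) ⊆ s) {q} (hq : q ∈ traceGraph Ω) : q ∈ s :=
  closure_minimal h hs hq

lemma fst_mem_sobolevSpace (hb : Bornology.IsBounded Ω)
    {q : JetSpace Ω × Lp ℂ 2 (surfaceMeasure Ω)} (hq : q ∈ traceGraph Ω) :
    q.1 ∈ sobolevSpace Ω := by
  refine closure_smoothTraceGraph_subset (s := Prod.fst ⁻¹' (sobolevSpace Ω : Set (JetSpace Ω)))
    (isClosed_sobolevSpace.preimage continuous_fst) (fun p hp => ?_) hq
  obtain ⟨φ, hφ, h1, -⟩ := (mem_smoothTraceGraph_iff hb).1 hp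
  rw [Set.mem_preimage, h1]
  exact smoothJet_mem_sobolevSpace hb hφ

lemma tendsto_jet {p : ℕ → JetSpace Ω} {q : JetSpace Ω} :
    Tendsto p atTop (𝓝 q) ↔ ∀ j, Tendsto (fun n => p n j) atTop (𝓝 (q j)) := by
  constructor
  · intro h j
    exact ((PiLp.continuous_apply 2 (fun _ : Option (Fin d) => L2 Ω) j).tendsto q).comp h
  · intro h
    have h1 : Tendsto (fun n => WithLp.ofLp (p n)) atTop (𝓝 (WithLp.ofLp q)) :=
      tendsto_pi_nhds.2 h
    exact ((PiLp.continuous_toLp 2 (fun _ : Option (Fin d) => L2 Ω)).tendsto _).comp h1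

/-- Replaces approximating sequences by membership in one closed subspace, so that inequalities and
identities need checking only on smooth functions. -/
theorem hasTrace_iff (hΩ : IsBoundedLipschitzDomain Ω) (hd : 1 ≤ d) {u : L2 Ω}
    {w : Lp ℂ 2 (surfaceMeasure Ω)} :
    HasTrace Ω u w ↔ ∃ p : JetSpace Ω, p none = u ∧ (p, w) ∈ traceGraph Ω := by
  have hb := hΩ.isBounded
  constructor
  · rintro ⟨g, hg, φ, hφ, h1, h2, h3⟩
    refine ⟨mkJet u g, rfl, ?_⟩
    refine mem_closure_of_tendsto (b := atTop) (f := fun n => (smoothJet hb (hφ n),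
      (memLp_surfaceMeasure hΩ hd (hφ n).continuous).toLp (φ n))) ?_
      (Eventually.of_forall fun n => (mem_smoothTraceGraph_iff hb).2
        ⟨φ n, hφ n, rfl,
          (memLp_surfaceMeasure hΩ hd (hφ n).continuous).coeFn_toLp⟩)
    refine Tendsto.prodMk_nhds (tendsto_jet.2 fun j => ?_) ?_
    · cases j with
      | none =>
        refine (Lp.tendsto_Lp_iff_tendsto_eLpNorm' _ _).2 (h1.congr fun n => ?_)
        exact eLpNorm_congr_ae ((smoothJet_none hb (hφ n)).symm.sub EventuallyEq.rfl)
      | some i =>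
        refine (Lp.tendsto_Lp_iff_tendsto_eLpNorm' _ _).2 ((h2 i).congr fun n => ?_)
        exact eLpNorm_congr_ae ((smoothJet_some hb (hφ n) i).symm.sub EventuallyEq.rfl)
    · refine (Lp.tendsto_Lp_iff_tendsto_eLpNorm' _ _).2 (h3.congr fun n => ?_)
      exact eLpNorm_congr_ae
        ((memLp_surfaceMeasure hΩ hd (hφ n).continuous).coeFn_toLp.symm.sub EventuallyEq.rfl)
  · rintro ⟨p, rfl, hp⟩
    obtain ⟨q, hq, hlim⟩ := mem_closure_iff_seq_limit.1 hp
    choose φ hφ h1 h2 h3 using hq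
    refine ⟨fun i => p (some i), fst_mem_sobolevSpace hb hp, φ, hφ, ?_, fun i => ?_, ?_⟩
    · have h := (Lp.tendsto_Lp_iff_tendsto_eLpNorm' _ _).1
        (tendsto_jet.1 ((continuous_fst.tendsto _).comp hlim) none)
      exact h.congr fun n => eLpNorm_congr_ae ((h1 n).sub EventuallyEq.rfl)
    · have h := (Lp.tendsto_Lp_iff_tendsto_eLpNorm' _ _).1
        (tendsto_jet.1 ((continuous_fst.tendsto _).comp hlim) (some i))
      exact h.congr fun n => eLpNorm_congr_ae ((h2 n i).sub EventuallyEq.rfl)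
    · have h := (Lp.tendsto_Lp_iff_tendsto_eLpNorm' _ _).1
        ((continuous_snd.tendsto _).comp hlim)
      exact h.congr fun n => eLpNorm_congr_ae ((h3 n).sub EventuallyEq.rfl)

/-- The trace inequality survives closure. Hence `traceGraph` is the graph of a bounded operator,
and in particular the trace is unique. -/
theorem exists_norm_snd_le (hΩ : IsBoundedLipschitzDomain Ω) (hd : 1 ≤ d) :
    ∃ C : ℝ≥0, ∀ q ∈ traceGraph Ω, ‖q.2‖ ≤ C * ‖q.1‖ := by
  obtain ⟨C, hC⟩ := exists_lintegral_surfaceMeasure_le hΩ hd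
  refine ⟨NNReal.sqrt C, fun q hq => ?_⟩
  refine closure_smoothTraceGraph_subset (s := {q | ‖q.2‖ ≤ NNReal.sqrt C * ‖q.1‖})
    (isClosed_le (by fun_prop) (by fun_prop)) (fun p hp => ?_) hq
  obtain ⟨φ, hφ, h1, h2⟩ := (mem_smoothTraceGraph_iff hΩ.isBounded).1 hp
  have h3 := hC φ hφ
  rw [← h1] at h3
  have h4 : ‖p.2‖ₑ ^ 2 = ∫⁻ x, ‖φ x‖ₑ ^ 2 ∂(surfaceMeasure Ω) := by
    rw [Lp.enorm_def, eLpNorm_congr_ae h2,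
      eLpNorm_eq_lintegral_rpow_enorm_toReal (p := 2) (by simp) (by simp)]
    rw [← ENNReal.rpow_natCast, ← ENNReal.rpow_mul]
    simp
  rw [← h4] at h3
  have h5 : ‖p.2‖ ^ 2 ≤ C * ‖p.1‖ ^ 2 := by
    rw [← ofReal_norm, ← ofReal_norm, ← ENNReal.ofReal_pow (norm_nonneg _),
      ← ENNReal.ofReal_pow (norm_nonneg _), ← ENNReal.ofReal_coe_nnreal,
      ← ENNReal.ofReal_mul C.coe_nonneg] at h3
    exact (ENNReal.ofReal_le_ofReal_iff (by positivity)).1 h3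
  change ‖p.2‖ ≤ NNReal.sqrt C * ‖p.1‖
  refine le_of_sq_le_sq ?_ (by positivity)
  rw [mul_pow, Real.coe_sqrt, Real.sq_sqrt C.coe_nonneg]
  exact h5

lemma snd_eq_of_fst_eq (hΩ : IsBoundedLipschitzDomain Ω) (hd : 1 ≤ d) {p : JetSpace Ω}
    {w z : Lp ℂ 2 (surfaceMeasure Ω)} (hw : (p, w) ∈ traceGraph Ω) (hz : (p, z) ∈ traceGraph Ω) :
    w = z := by
  obtain ⟨C, hC⟩ := exists_norm_snd_le hΩ hd
  have h := hC _ (sub_mem hw hz)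
  simp only [Prod.mk_sub_mk, sub_self, norm_zero, mul_zero] at h
  exact sub_eq_zero.1 (norm_le_zero_iff.1 h)

/-! ### Functions whose trace vanishes on part of the boundary -/

/-- The restriction of square-integrable functions on the boundary to a part of the boundary. -/
def boundaryRestrict (Ω Γ : Set (Space d)) :
    Lp ℂ 2 (surfaceMeasure Ω) →L[ℂ] Lp ℂ 2 ((surfaceMeasure Ω).restrict Γ) :=
  LpToLpRestrictCLM (Space d) ℂ ℂ (surfaceMeasure Ω) 2 Γ

lemma boundaryRestrict_coeFn (Γ : Set (Space d)) (w : Lp ℂ 2 (surfaceMeasure Ω)) :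
    boundaryRestrict Ω Γ w =ᵐ[(surfaceMeasure Ω).restrict Γ] w :=
  LpToLpRestrictCLM_coeFn ℂ Γ w

lemma boundaryRestrict_eq_zero_iff (hΓ : MeasurableSet Γ) {w : Lp ℂ 2 (surfaceMeasure Ω)} :
    boundaryRestrict Ω Γ w = 0 ↔ ∀ᵐ x ∂(surfaceMeasure Ω), x ∈ Γ → w x = 0 := by
  rw [Lp.eq_zero_iff_ae_eq_zero, ← ae_restrict_iff' hΓ]
  constructor
  · intro h
    filter_upwards [h, boundaryRestrict_coeFn Γ w] with x h1 h2
    rw [← h2, h1, Pi.zero_apply]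
  · intro h
    filter_upwards [h, boundaryRestrict_coeFn Γ w] with x h1 h2
    rw [h2, h1, Pi.zero_apply]

/-- The functions in `H¹(Ω)` whose trace vanishes on `Γ`. -/
def traceVanishingSpace (Ω Γ : Set (Space d)) : Submodule ℂ (JetSpace Ω) where
  carrier := {p | p ∈ sobolevSpace Ω ∧ TraceVanishesOn Ω Γ (p none)}
  zero_mem' := ⟨zero_mem _, traceVanishesOn_zero Γ⟩
  add_mem' := fun h k => ⟨add_mem h.1 k.1, h.2.add k.2⟩
  smul_mem' := fun c _ h => ⟨Submodule.smul_mem _ c h.1, h.2.smul c⟩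

lemma traceVanishingSpace_le_sobolevSpace : traceVanishingSpace Ω Γ ≤ sobolevSpace Ω :=
  fun _ h => h.1

lemma mem_traceVanishingSpace_iff (hΩ : IsBoundedLipschitzDomain Ω) (hd : 1 ≤ d)
    {p : JetSpace Ω} : p ∈ traceVanishingSpace Ω Γ ↔
      ∃ w, (p, w) ∈ traceGraph Ω ∧ ∀ᵐ x ∂(surfaceMeasure Ω), x ∈ Γ → w x = 0 := by
  constructor
  · rintro ⟨hp, w, hw, h0⟩
    obtain ⟨q, hq, hqw⟩ := (hasTrace_iff hΩ hd).1 hw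
    have := injective_sobolev_fst hΩ.isOpen (fst_mem_sobolevSpace hΩ.isBounded hqw) hp hq
    exact ⟨w, this ▸ hqw, h0⟩
  · rintro ⟨w, hw, h0⟩
    exact ⟨fst_mem_sobolevSpace hΩ.isBounded hw, w, (hasTrace_iff hΩ hd).2 ⟨p, rfl, hw⟩, h0⟩

/-- The space is the projection of a closed subspace of `traceGraph`. The trace bound controls the
graph norm by the norm of the jet, so this projection is bounded below and has closed range. -/
theorem isClosed_traceVanishingSpace (hΩ : IsBoundedLipschitzDomain Ω) (hd : 1 ≤ d)
    (hΓ : MeasurableSet Γ) : IsClosed (traceVanishingSpace Ω Γ : Set (JetSpace Ω)) := by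
  let N : Submodule ℂ (JetSpace Ω × Lp ℂ 2 (surfaceMeasure Ω)) :=
    traceGraph Ω ⊓ (boundaryRestrict Ω Γ ∘L ContinuousLinearMap.snd ℂ _ _).ker
  have hN : IsClosed (N : Set (JetSpace Ω × Lp ℂ 2 (surfaceMeasure Ω))) :=
    (Submodule.isClosed_topologicalClosure _).inter (ContinuousLinearMap.isClosed_ker _)
  have hNc : CompleteSpace N := hN.completeSpace_coe
  let f : N →L[ℂ] JetSpace Ω := ContinuousLinearMap.fst ℂ _ _ ∘L N.subtypeL
  obtain ⟨C, hC⟩ := exists_norm_snd_le hΩ hd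
  have hf : AntilipschitzWith (max 1 C) f := by
    refine AddMonoidHomClass.antilipschitz_of_bound f fun q => ?_
    have h := hC _ q.2.1
    have h1 : ‖q‖ = max ‖q.1.1‖ ‖q.1.2‖ := rfl
    have h2 : ‖f q‖ = ‖q.1.1‖ := rfl
    rw [h1, h2, NNReal.coe_max, NNReal.coe_one]
    refine max_le ?_ (h.trans ?_)
    · exact le_mul_of_one_le_left (norm_nonneg _) (le_max_left _ _)
    · exact mul_le_mul_of_nonneg_right (le_max_right _ _) (norm_nonneg _)
  have hr : (traceVanishingSpace Ω Γ : Set (JetSpace Ω)) = Set.range f := by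
    ext p
    rw [SetLike.mem_coe, mem_traceVanishingSpace_iff hΩ hd]
    constructor
    · rintro ⟨w, hw, h0⟩
      exact ⟨⟨(p, w), hw, (boundaryRestrict_eq_zero_iff hΓ).2 h0⟩, rfl⟩
    · rintro ⟨⟨⟨q, w⟩, hw, h0⟩, rfl⟩
      exact ⟨w, hw, (boundaryRestrict_eq_zero_iff hΓ).1 h0⟩
  rw [hr]
  exact hf.isClosed_range f.uniformContinuous

lemma smoothJet_mem_traceVanishingSpace_iff (hΩ : IsBoundedLipschitzDomain Ω) (hd : 1 ≤ d)
    {φ : Space d → ℂ} (hφ : ContDiff ℝ ∞ φ) :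
    smoothJet hΩ.isBounded hφ ∈ traceVanishingSpace Ω Γ ↔
      ∀ᵐ x ∂(surfaceMeasure Ω), x ∈ Γ → φ x = 0 := by
  have hm := memLp_surfaceMeasure hΩ hd hφ.continuous
  have h : (smoothJet hΩ.isBounded hφ, hm.toLp φ) ∈ traceGraph Ω :=
    Submodule.le_topologicalClosure _ ((mem_smoothTraceGraph_iff hΩ.isBounded).2
      ⟨φ, hφ, rfl, hm.coeFn_toLp⟩)
  rw [mem_traceVanishingSpace_iff hΩ hd]
  constructor
  · rintro ⟨w, hw, h0⟩
    rw [snd_eq_of_fst_eq hΩ hd hw h] at h0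
    filter_upwards [h0, hm.coeFn_toLp] with x h1 h2 hx
    rw [← h2, h1 hx]
  · intro h0
    refine ⟨_, h, ?_⟩
    filter_upwards [h0, hm.coeFn_toLp] with x h1 h2 hx
    rw [h2, h1 hx]

lemma smoothJet_mem_traceVanishingSpace (hΩ : IsBoundedLipschitzDomain Ω) (hd : 1 ≤ d)
    {φ : Space d → ℂ} (hφ : IsTestFunction Ω φ) :
    smoothJet hΩ.isBounded hφ.contDiff ∈ traceVanishingSpace Ω Γ := by
  rw [smoothJet_mem_traceVanishingSpace_iff hΩ hd]
  filter_upwards [ae_restrict_mem isClosed_frontier.measurableSet] with x hx _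
  rw [frontier, hΩ.isOpen.interior_eq] at hx
  exact hφ.eq_zero_of_notMem x hx.2

lemma IsRelOpenInBoundary.measurableSet (h : IsRelOpenInBoundary Ω Γ) : MeasurableSet Γ := by
  obtain ⟨U, hU, rfl⟩ := h
  exact hU.measurableSet.inter isClosed_frontier.measurableSet

/-! ### Integration by parts under mixed boundary conditions -/

variable {ΓD ΓN : Set (Space d)}

lemma IsBoundaryDecomposition.ae_mem_union (h : IsBoundaryDecomposition Ω ΓD ΓN) :
    ∀ᵐ x ∂(surfaceMeasure Ω), x ∈ frontier Ω ∧ (x ∈ ΓD ∨ x ∈ ΓN) := by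
  filter_upwards [ae_restrict_mem isClosed_frontier.measurableSet,
    measure_eq_zero_iff_ae_notMem.1 h.measure_rest] with x h1 h2
  refine ⟨h1, ?_⟩
  by_contra h3
  exact h2 ⟨h1, h3⟩

/-- Makes the test space in the Neumann condition on Γ_N the same as the form domain. A relatively
open set disjoint from Γ_N misses its closure, and what the two sets do not share is null. -/
lemma IsBoundaryDecomposition.traceVanishesOn_iff (h : IsBoundaryDecomposition Ω ΓD ΓN)
    {u : L2 Ω} : TraceVanishesOn Ω (frontier Ω \ closure ΓN) u ↔ TraceVanishesOn Ω ΓD u := by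
  have h1 : ΓD ⊆ frontier Ω \ closure ΓN := by
    obtain ⟨U, hU, hD⟩ := h.isRelOpen_D
    obtain ⟨W, hW, hN⟩ := h.isRelOpen_N
    intro x hx
    rw [hD] at hx
    refine ⟨hx.2, fun hxN => ?_⟩
    obtain ⟨y, hyU, hyN⟩ := mem_closure_iff.1 hxN U hU hx.1
    refine Set.disjoint_left.1 h.disjoint ?_ hyN
    rw [hD]
    rw [hN] at hyN
    exact ⟨hyU, hyN.2⟩
  constructor
  · rintro ⟨w, hw, h0⟩
    refine ⟨w, hw, ?_⟩
    filter_upwards [h0] with x hx hxD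
    exact hx (h1 hxD)
  · rintro ⟨w, hw, h0⟩
    refine ⟨w, hw, ?_⟩
    filter_upwards [h0, h.ae_mem_union] with x hx h2 h3
    rcases h2.2 with h4 | h4
    · exact hx h4
    · exact absurd (subset_closure h4) h3.2

lemma sum_inner_smoothJet_eq_setIntegral (hb : Bornology.IsBounded Ω) {φ ψ : Space d → ℂ}
    (hφ : ContDiff ℝ ∞ φ) (hψ : ContDiff ℝ ∞ ψ) (τ : Space d) :
    ∑ i, (τ i : ℂ) * (⟪smoothJet hb hψ none, smoothJet hb hφ (some i)⟫_ℂ +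
      ⟪smoothJet hb hψ (some i), smoothJet hb hφ none⟫_ℂ) =
      ∫ x in Ω, fderiv ℝ (φ * fun x => starRingEnd ℂ (ψ x)) x τ := by
  have hψc := contDiff_conj hψ
  have hφψ : ContDiff ℝ ∞ (φ * fun x => starRingEnd ℂ (ψ x)) := hφ.mul hψc
  have ha : ∀ i, Continuous fun x => partialDeriv i φ x * starRingEnd ℂ (ψ x) := fun i =>
    (continuous_partialDeriv hφ i).mul hψc.continuous
  have hc : ∀ i, Continuous fun x => φ x * starRingEnd ℂ (partialDeriv i ψ x) := fun i =>
    hφ.continuous.mul (contDiff_conj (contDiff_partialDeriv hψ i)).continuous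
  simp only [fderiv_apply_eq_sum_partialDeriv]
  rw [integral_finsetSum _ fun i _ => (integrable_of_continuous hb
    (continuous_partialDeriv hφψ i)).const_mul _]
  refine Finset.sum_congr rfl fun i _ => ?_
  rw [integral_const_mul, inner_L2_eq_integral, inner_L2_eq_integral]
  congr 1
  rw [integral_congr_ae (g := fun x => partialDeriv i φ x * starRingEnd ℂ (ψ x)),
    integral_congr_ae (f := fun x => smoothJet hb hφ none x * _)
      (g := fun x => φ x * starRingEnd ℂ (partialDeriv i ψ x)),
    ← integral_add (integrable_of_continuous hb (ha i)) (integrable_of_continuous hb (hc i))]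
  · refine integral_congr_ae (Eventually.of_forall fun x => ?_)
    simp only
    rw [partialDeriv_mul hφ hψc, partialDeriv_conj hψ]
  · filter_upwards [smoothJet_none hb hφ, smoothJet_some hb hψ i] with x k1 k2
    rw [k1, k2]
  · filter_upwards [smoothJet_none hb hψ, smoothJet_some hb hφ i] with x k1 k2
    rw [k1, k2]

lemma setLIntegral_mul_conj_le (hΩ : IsBoundedLipschitzDomain Ω) (hd : 1 ≤ d) (Γ : Set (Space d))
    {φ ψ : Space d → ℂ} (hφ : Continuous φ) (hψ : Continuous ψ)
    {w : Lp ℂ 2 (surfaceMeasure Ω)} (hw : w =ᵐ[surfaceMeasure Ω] φ) :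
    ∫⁻ x in Γ, ‖φ x * starRingEnd ℂ (ψ x)‖ₑ ∂(surfaceMeasure Ω) ≤
      ‖boundaryRestrict Ω Γ w‖ₑ * ‖(memLp_surfaceMeasure hΩ hd hψ).toLp‖ₑ := by
  have h1 : eLpNorm (fun x => starRingEnd ℂ (ψ x)) 2 ((surfaceMeasure Ω).restrict Γ) ≤
      ‖(memLp_surfaceMeasure hΩ hd hψ).toLp‖ₑ := by
    rw [Lp.enorm_def, eLpNorm_congr_ae (memLp_surfaceMeasure hΩ hd hψ).coeFn_toLp]
    refine (eLpNorm_mono_measure _ Measure.restrict_le_self).trans (le_of_eq ?_)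
    exact eLpNorm_congr_norm_ae (Eventually.of_forall fun x => RCLike.norm_conj _)
  have h2 : ‖boundaryRestrict Ω Γ w‖ₑ = eLpNorm φ 2 ((surfaceMeasure Ω).restrict Γ) := by
    rw [Lp.enorm_def]
    exact eLpNorm_congr_ae ((boundaryRestrict_coeFn Γ w).trans (ae_restrict_of_ae hw))
  have hψc : Continuous fun x => starRingEnd ℂ (ψ x) := Complex.continuous_conj.comp hψ
  have h3 : eLpNorm (φ • fun x => starRingEnd ℂ (ψ x)) 1 ((surfaceMeasure Ω).restrict Γ) ≤ _ :=
    eLpNorm_smul_le_mul_eLpNorm (p := 2) (q := 2) (r := 1) hψc.aestronglyMeasurable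
      hφ.aestronglyMeasurable
  rw [eLpNorm_one_eq_lintegral_enorm] at h3
  refine h3.trans ?_
  rw [h2]
  gcongr

/-- Integration by parts in a direction which is tangential to the part of the boundary on which
the trace does not vanish. -/
theorem sum_inner_add_inner_eq_zero (hΩ : IsBoundedLipschitzDomain Ω) (hd : 1 ≤ d)
    (hΓ : IsBoundaryDecomposition Ω ΓD ΓN) {τ : Space d} (hτ : τ ∈ jointTangentSpace Ω ΓN)
    {ψ : Space d → ℂ} (hψ : ContDiff ℝ ∞ ψ) {p : JetSpace Ω} (hp : p ∈ traceVanishingSpace Ω ΓD) :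
    ∑ i, (τ i : ℂ) * (⟪smoothJet hΩ.isBounded hψ none, p (some i)⟫_ℂ +
      ⟪smoothJet hΩ.isBounded hψ (some i), p none⟫_ℂ) = 0 := by
  have hb := hΩ.isBounded
  obtain ⟨w, hw, h0⟩ := (mem_traceVanishingSpace_iff hΩ hd).1 hp
  have hN := hΓ.isRelOpen_N.measurableSet
  -- Up to a null set the complement of Γ_N in the boundary is Γ_D, where the trace vanishes.
  have hw0 : boundaryRestrict Ω ΓNᶜ w = 0 := by
    rw [boundaryRestrict_eq_zero_iff hN.compl]
    filter_upwards [h0, hΓ.ae_mem_union] with x h1 h2 h3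
    exact h1 (h2.2.resolve_right h3)
  obtain ⟨C, hC⟩ := exists_enorm_setIntegral_fderiv_le hΩ hd hN hτ
  have hψc := contDiff_conj hψ
  let M := ‖(memLp_surfaceMeasure hΩ hd hψ.continuous).toLp‖
  -- The boundary term is bounded by the trace off Γ_N alone. The inequality is closed in `q`, so it
  -- passes from smooth functions to the whole graph; no approximation by functions vanishing on Γ_D
  -- is required.
  have key : ∀ q ∈ traceGraph Ω,
      ‖∑ i, (τ i : ℂ) * (⟪smoothJet hb hψ none, q.1 (some i)⟫_ℂ +
        ⟪smoothJet hb hψ (some i), q.1 none⟫_ℂ)‖ ≤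
      (C * M) * ‖boundaryRestrict Ω ΓNᶜ q.2‖ := by
    intro q hq
    refine closure_smoothTraceGraph_subset (s := {q | ‖∑ i, (τ i : ℂ) *
        (⟪smoothJet hb hψ none, q.1 (some i)⟫_ℂ + ⟪smoothJet hb hψ (some i), q.1 none⟫_ℂ)‖ ≤
      (C * M) * ‖boundaryRestrict Ω ΓNᶜ q.2‖}) ?_ (fun r hr => ?_) hq
    · have hj : ∀ j, Continuous fun q : JetSpace Ω × Lp ℂ 2 (surfaceMeasure Ω) => q.1 j := fun j =>
        (PiLp.continuous_apply 2 (fun _ : Option (Fin d) => L2 Ω) j).comp continuous_fst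
      exact isClosed_le (continuous_finsetSum _ fun i _ => continuous_const.mul
        ((continuous_const.inner (hj _)).add (continuous_const.inner (hj _)))).norm
        (by fun_prop)
    · obtain ⟨φ, hφ, h1, h2⟩ := (mem_smoothTraceGraph_iff hb).1 hr
      have h3 := hC (φ * fun x => starRingEnd ℂ (ψ x)) (hφ.mul hψc)
      have h4 : ∑ i, (τ i : ℂ) * (⟪smoothJet hb hψ none, r.1 (some i)⟫_ℂ +
          ⟪smoothJet hb hψ (some i), r.1 none⟫_ℂ) =
          ∫ x in Ω, fderiv ℝ (φ * fun x => starRingEnd ℂ (ψ x)) x τ := by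
        rw [h1]
        exact sum_inner_smoothJet_eq_setIntegral hb hφ hψ τ
      rw [← h4] at h3
      have h5 := setLIntegral_mul_conj_le hΩ hd ΓNᶜ hφ.continuous hψ.continuous h2
      have h6 := h3.trans (mul_le_mul_right h5 (C : ℝ≥0∞))
      rw [← ofReal_norm, ← ofReal_norm, ← ofReal_norm, ← ENNReal.ofReal_mul (norm_nonneg _),
        ← ENNReal.ofReal_coe_nnreal, ← ENNReal.ofReal_mul C.coe_nonneg] at h6
      have h7 := (ENNReal.ofReal_le_ofReal_iff (by positivity)).1 h6
      refine h7.trans (le_of_eq ?_)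
      ring
  have h := key _ hw
  simp only [hw0, norm_zero, mul_zero] at h
  exact norm_le_zero_iff.1 h

end Trace

end MixedLaplacian

end

noncomputable section

namespace MixedLaplacian

variable {d : ℕ}

/-! ### Comparison of the spectra of two forms -/

section Comparison

variable {E H : Type} [NormedAddCommGroup E] [InnerProductSpace ℂ E]
  [NormedAddCommGroup H] [InnerProductSpace ℂ H] [CompleteSpace H]

/-- If the form domain `V` can be enlarged inside the form domain `U` by a vector `e` on which the
form behaves as on an eigenvector to the eigenvalue `lam k`, then the eigenvalues `mu` of the form
on `U` satisfy `mu (k + 1) ≤ lam k`. -/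
theorem formEigenvalue_succ_le {J : E →L[ℂ] H} {V U : Submodule ℂ E} [CompleteSpace V]
    [CompleteSpace U] (hVU : V ≤ U) (hinj : ∀ u ∈ U, J u = 0 → u = 0)
    {b : HilbertBasis ℕ ℂ V} {c : HilbertBasis ℕ ℂ U} {lam mu : ℕ → ℝ}
    (hlam : Monotone lam) (hmu : Monotone mu) (hlam0 : ∀ i, 0 ≤ lam i) (hmu0 : ∀ i, 0 ≤ mu i)
    (hb : ∀ i, b i ∈ formEigenspace (J ∘L V.subtypeL) (lam i))
    (hc : ∀ i, c i ∈ formEigenspace (J ∘L U.subtypeL) (mu i)) {k : ℕ} {e : E} (heU : e ∈ U)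
    (heV : e ∉ V) (he : ∀ p ∈ V, ⟪e, p⟫_ℂ = (1 + lam k) * ⟪J e, J p⟫_ℂ)
    (hee : ⟪e, e⟫_ℂ = (1 + lam k) * ⟪J e, J e⟫_ℂ) : mu (k + 1) ≤ lam k := by
  let P : (Fin (k + 1) → ℂ) →ₗ[ℂ] V := Fintype.linearCombination ℂ fun j : Fin (k + 1) => b j
  let F : (Fin (k + 1) → ℂ) × ℂ →ₗ[ℂ] U :=
    (Submodule.inclusion hVU ∘ₗ P).coprod (LinearMap.toSpanSingleton ℂ U ⟨e, heU⟩)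
  let Q : U →ₗ[ℂ] (Fin (k + 1) → ℂ) := LinearMap.pi fun j => (innerSL ℂ (c j)).toLinearMap
  -- `k + 2` parameters (the eigenvectors `b 0, …, b k` and `e`) against `k + 1` orthogonality
  -- conditions (to `c 0, …, c k`).
  have hker : (Q ∘ₗ F).ker ≠ ⊥ := by
    refine LinearMap.ker_ne_bot_of_finrank_lt ?_
    simp
  obtain ⟨⟨a, s⟩, hx, hx0⟩ := Submodule.exists_mem_ne_zero_of_ne_bot hker
  have hF : ((F (a, s) : U) : E) = P a + s • e := by
    simp [F]
  have hQ : ∀ j ≤ k, ⟪c j, F (a, s)⟫_ℂ = 0 := fun j hj =>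
    congrFun (LinearMap.mem_ker.1 hx) ⟨j, Nat.lt_succ_of_le hj⟩
  -- Injectivity of the parametrization: `e ∉ V` forces `s = 0`, and then independence of the `b j`
  -- forces `a = 0`.
  have hw0 : F (a, s) ≠ 0 := by
    intro h0
    rw [h0, Submodule.coe_zero] at hF
    have hs : s = 0 := by
      by_contra hs
      refine heV ?_
      have h1 : e = s⁻¹ • (-(P a : E)) := by
        rw [← eq_neg_of_add_eq_zero_right hF.symm, smul_smul, inv_mul_cancel₀ hs, one_smul]
      rw [h1]
      exact V.smul_mem _ (V.neg_mem (P a).2)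
    have hPa : P a = 0 := by
      rw [hs, zero_smul, add_zero] at hF
      exact Subtype.ext hF.symm
    have hli : LinearIndependent ℂ fun j : Fin (k + 1) => b j :=
      (b.orthonormal.comp _ Fin.val_injective).linearIndependent
    have ha : a = 0 := funext fun j => Fintype.linearIndependent_iff.1 hli a hPa j
    exact hx0 (by rw [ha, hs]; rfl)
  have hPn : ‖P a‖ ^ 2 ≤ (1 + lam k) * ‖J (P a)‖ ^ 2 := by
    refine norm_sq_le_of_inner_eq_zero_above (J := J ∘L V.subtypeL) hlam hb hlam0 fun j hj => ?_
    have h1 : P a = ∑ i, a i • b i := rfl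
    rw [h1, inner_sum]
    refine Finset.sum_eq_zero fun i _ => ?_
    rw [inner_smul_right, b.orthonormal.2 (by have := i.2; omega), mul_zero]
  have h1 := le_norm_sq_of_inner_eq_zero_below (J := J ∘L U.subtypeL) hmu hc hmu0 hQ
  have h2 : ‖F (a, s)‖ ^ 2 ≤ (1 + lam k) * ‖J (F (a, s))‖ ^ 2 := by
    rw [← Submodule.norm_coe, hF, map_add, map_smul, norm_add_sq (𝕜 := ℂ), norm_add_sq (𝕜 := ℂ)]
    -- The cross term carries the same factor `1 + lam k` as the two squares, so the bound for `P a`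
    -- extends to the sum.
    have h3 : RCLike.re ⟪(P a : E), s • e⟫_ℂ =
        (1 + lam k) * RCLike.re ⟪J (P a), s • J e⟫_ℂ := by
      rw [inner_re_symm, inner_re_symm (J (P a)), inner_smul_left, inner_smul_left, he _ (P a).2,
        mul_left_comm, ← Complex.ofReal_one, ← Complex.ofReal_add]
      exact RCLike.re_ofReal_mul _ _
    have h4 : ‖s • e‖ ^ 2 = (1 + lam k) * ‖s • J e‖ ^ 2 := by
      rw [inner_self_eq_norm_sq_to_K, inner_self_eq_norm_sq_to_K] at hee
      have h5 : ‖e‖ ^ 2 = (1 + lam k) * ‖J e‖ ^ 2 :=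
        Complex.ofReal_injective (by push_cast; exact hee)
      rw [norm_smul, norm_smul, mul_pow, mul_pow, h5]
      ring
    rw [h3, h4]
    rw [← Submodule.norm_coe] at hPn
    linarith
  have h3 : 0 < ‖J (F (a, s))‖ ^ 2 := by
    refine pow_pos (norm_pos_iff.2 fun h => hw0 ?_) 2
    exact Subtype.ext (hinj _ (F (a, s)).2 h)
  have h4 := le_of_mul_le_mul_right (h1.trans h2) h3
  linarith

end Comparison

/-! ### The operators associated with the Dirichlet form -/

section Operators

variable {Ω : Set (Space d)}

lemma inner_smoothJet_none (hb : Bornology.IsBounded Ω) {φ : Space d → ℂ} (hφ : ContDiff ℝ ∞ φ)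
    (u : L2 Ω) : ⟪smoothJet hb hφ none, u⟫_ℂ = ∫ x in Ω, u x * starRingEnd ℂ (φ x) := by
  rw [inner_L2_eq_integral]
  refine integral_congr_ae ?_
  filter_upwards [smoothJet_none hb hφ] with x hx
  rw [hx]

lemma inner_smoothJet_some (hb : Bornology.IsBounded Ω) {φ : Space d → ℂ} (hφ : ContDiff ℝ ∞ φ)
    (i : Fin d) (u : L2 Ω) :
    ⟪smoothJet hb hφ (some i), u⟫_ℂ = ∫ x in Ω, u x * starRingEnd ℂ (partialDeriv i φ x) := by
  rw [inner_L2_eq_integral]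
  refine integral_congr_ae ?_
  filter_upwards [smoothJet_some hb hφ i] with x hx
  rw [hx]

/-- Links the operator eigenvalue equation to `formEigenspace`; the shift by 1 is the L² part of the
jet inner product. -/
lemma normalDerivPairing_eq (p q : JetSpace Ω) (t : ℂ) :
    normalDerivPairing (fun i => p (some i)) (-(t • p none)) (q none) (fun i => q (some i)) =
      ⟪q, p⟫_ℂ - (1 + t) * ⟪q none, p none⟫_ℂ := by
  rw [normalDerivPairing, inner_jet, inner_neg_right, inner_smul_right]
  ring

/-- Green's identity against test functions already contains the distributional equation, so a form
eigenvector belongs to the operator domain. -/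
lemma hasWeakLaplacian_of_forall_normalDerivPairing (hb : Bornology.IsBounded Ω)
    {V : Submodule ℂ (JetSpace Ω)}
    (hV : ∀ φ (hφ : IsTestFunction Ω φ), smoothJet hb hφ.contDiff ∈ V) {p : JetSpace Ω}
    (hp : p ∈ sobolevSpace Ω) {f : L2 Ω}
    (h : ∀ q ∈ V, normalDerivPairing (fun i => p (some i)) f (q none) (fun i => q (some i)) = 0) :
    HasWeakLaplacian Ω (p none) f := by
  intro φ hφ
  -- The pairing conjugates its test argument, whereas `HasWeakLaplacian` does not; hence the
  -- conjugate of `φ`.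
  have h1 := h _ (hV _ hφ.conj)
  rw [normalDerivPairing, inner_smoothJet_none] at h1
  simp only [inner_smoothJet_some, partialDeriv_conj hφ.contDiff, Complex.conj_conj] at h1
  have h2 : ∫ x in Ω, (p none) x * Laplacian.laplacian φ x =
      ∑ i, ∫ x in Ω, (p none) x * partialDeriv i (partialDeriv i φ) x := by
    rw [← integral_finsetSum]
    · refine integral_congr_ae (Eventually.of_forall fun x => ?_)
      simp only [laplacian_eq_sum_partialDeriv hφ.contDiff, Finset.mul_sum]
    · intro i _
      exact (Lp.memLp (p none)).integrable_mul ((hφ.partialDeriv i).partialDeriv i).memLp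
  rw [h2, Finset.sum_congr rfl fun i _ => hp _ (hφ.partialDeriv i) i, Finset.sum_neg_distrib]
  linear_combination -h1

/-- The graph `G` is that of the operator associated with the Dirichlet form on `V`. -/
def IsFormOperator (V : Submodule ℂ (JetSpace Ω)) (G : Submodule ℂ (L2 Ω × L2 Ω)) : Prop :=
  ∀ u f, (u, f) ∈ G ↔ HasWeakLaplacian Ω u (-f) ∧ ∃ p ∈ V, p none = u ∧
    ∀ q ∈ V, normalDerivPairing (fun i => p (some i)) (-f) (q none) (fun i => q (some i)) = 0

variable {V : Submodule ℂ (JetSpace Ω)}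

/-- The embedding of a form domain into `L²(Ω)`. -/
abbrev formEmbedding (V : Submodule ℂ (JetSpace Ω)) : V →L[ℂ] L2 Ω := jetFst Ω ∘L V.subtypeL

lemma formEmbedding_injective (hΩ : IsOpen Ω) (hV : V ≤ sobolevSpace Ω) :
    Function.Injective (formEmbedding V) := fun p q h =>
  Subtype.ext (injective_sobolev_fst hΩ (hV p.2) (hV q.2) h)

lemma norm_formEmbedding_le (p : V) : ‖formEmbedding V p‖ ≤ ‖p‖ :=
  norm_jetFst_le (p : JetSpace Ω)

/-- The embedding maps the form eigenspace bijectively onto the operator eigenspace, so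
multiplicities agree. -/
lemma rank_eigenspace_eq [CompleteSpace V] (hΩ : IsOpen Ω) (hb : Bornology.IsBounded Ω)
    (hV : V ≤ sobolevSpace Ω)
    (hVt : ∀ φ (hφ : IsTestFunction Ω φ), smoothJet hb hφ.contDiff ∈ V)
    {G : Submodule ℂ (L2 Ω × L2 Ω)} (hG : IsFormOperator V G) (t : ℂ) :
    Module.rank ℂ (eigenspace G t) = Module.rank ℂ (formEigenspace (formEmbedding V) t) := by
  have h : eigenspace G t =
      (formEigenspace (formEmbedding V) t).map (formEmbedding V).toLinearMap := by
    ext u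
    have h1 : u ∈ eigenspace G t ↔ (u, t • u) ∈ G := Iff.rfl
    rw [h1, hG, Submodule.mem_map]
    constructor
    · rintro ⟨-, p, hp, rfl, h⟩
      refine ⟨⟨p, hp⟩, fun q => ?_, rfl⟩
      have h2 := h q q.2
      rw [normalDerivPairing_eq] at h2
      exact sub_eq_zero.1 h2
    · rintro ⟨p, hp, rfl⟩
      have h2 : ∀ q ∈ V, normalDerivPairing (fun i => (p : JetSpace Ω) (some i))
          (-(t • (p : JetSpace Ω) none)) (q none) (fun i => q (some i)) = 0 := fun q hq => by
        rw [normalDerivPairing_eq]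
        exact sub_eq_zero.2 (hp ⟨q, hq⟩)
      exact ⟨hasWeakLaplacian_of_forall_normalDerivPairing hb hVt (hV p.2) h2, p, p.2, rfl, h2⟩
  rw [h]
  exact (Submodule.equivMapOfInjective (formEmbedding V).toLinearMap
    (formEmbedding_injective hΩ hV) _).rank_eq.symm

/-- Bump functions in infinitely many disjoint open subsets of `Ω` are nonzero and orthogonal in L².
-/
lemma not_finiteDimensional_of_testFunctions (hΩ : IsOpen Ω) (hne : Ω.Nonempty) (hd : 1 ≤ d)
    (hb : Bornology.IsBounded Ω)
    (hVt : ∀ φ (hφ : IsTestFunction Ω φ), smoothJet hb hφ.contDiff ∈ V) :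
    ¬ FiniteDimensional ℂ V := by
  intro hfin
  have : Nontrivial (Space d) := by
    have : Nonempty (Fin d) := ⟨⟨0, hd⟩⟩
    infer_instance
  have hinf : Ω.Infinite := by
    obtain ⟨x, hx⟩ := hne
    exact infinite_of_mem_nhds x (hΩ.mem_nhds hx)
  have : Infinite Ω := hinf.to_subtype
  obtain ⟨U, hUi, hUo, hUd⟩ := exists_seq_infinite_isOpen_pairwise_disjoint Ω
  choose x hx using fun n => (hUi n).nonempty
  have hWo : ∀ n, IsOpen (Subtype.val '' U n) := fun n => hΩ.isOpenMap_subtype_val _ (hUo n)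
  have hW : ∀ n, Subtype.val '' U n ⊆ Ω := fun n => Subtype.coe_image_subset _ _
  choose f hf hfc hfs _ hf1 using fun n =>
    exists_contDiff_tsupport_subset (n := (⊤ : ℕ∞)) ((hWo n).mem_nhds ⟨x n, hx n, rfl⟩)
  have hφ' : ∀ n, IsTestFunction (Subtype.val '' U n) fun y => (f n y : ℂ) := fun n =>
    ⟨Complex.ofRealCLM.contDiff.comp (hfs n), (hfc n).comp_left Complex.ofReal_zero,
      (closure_mono (Function.support_comp_subset Complex.ofReal_zero (f n))).trans (hf n)⟩
  have hφ := fun n => (hφ' n).mono (hW n)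
  let p : ℕ → V := fun n => ⟨smoothJet hb (hφ n).contDiff, hVt _ (hφ n)⟩
  have hli : LinearIndependent ℂ fun n => formEmbedding V (p n) := by
    refine linearIndependent_of_ne_zero_of_inner_eq_zero (𝕜 := ℂ) (fun n h0 => ?_) fun m n hmn => ?_
    · have h1 : (fun y => (f n y : ℂ)) =ᵐ[volume.restrict Ω] 0 :=
        (smoothJet_none hb (hφ n).contDiff).symm.trans (Lp.eq_zero_iff_ae_eq_zero.1 h0)
      have hopen : IsOpen ({y | f n y ≠ 0} ∩ Ω) :=
        (isOpen_ne_fun (hfs n).continuous continuous_const).inter hΩ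
      refine (hopen.measure_pos volume ⟨x n, ?_, (x n).2⟩).ne' ?_
      · change f n (x n) ≠ 0
        rw [hf1]
        exact one_ne_zero
      · rw [← Measure.restrict_apply' hΩ.measurableSet]
        refine measure_mono_null (fun y hy => ?_) h1
        simpa using hy
    · change ⟪smoothJet hb (hφ m).contDiff none, smoothJet hb (hφ n).contDiff none⟫_ℂ = 0
      rw [inner_smoothJet_none]
      refine integral_eq_zero_of_ae ?_
      filter_upwards [smoothJet_none hb (hφ n).contDiff] with y hy
      rw [hy, Pi.zero_apply]
      by_cases hym : y ∈ Subtype.val '' U m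
      · have hyn : y ∉ Subtype.val '' U n := fun hyn => Set.disjoint_left.1
          ((Set.disjoint_image_iff Subtype.val_injective).2 (hUd hmn)) hym hyn
        rw [(hφ' n).eq_zero_of_notMem y hyn, zero_mul]
      · rw [(hφ' m).eq_zero_of_notMem y hym, map_zero, mul_zero]
  have hli' : LinearIndependent ℂ p := hli.of_comp (formEmbedding V).toLinearMap
  have := hli'.finite
  exact not_finite ℕ

theorem exists_isEigenvalueSequence [CompleteSpace V] (hΩ : IsOpen Ω) (hne : Ω.Nonempty)
    (hd : 1 ≤ d) (hb : Bornology.IsBounded Ω) (hV : V ≤ sobolevSpace Ω)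
    (hVc : IsCompactOperator (formEmbedding V))
    (hVt : ∀ φ (hφ : IsTestFunction Ω φ), smoothJet hb hφ.contDiff ∈ V)
    {G : Submodule ℂ (L2 Ω × L2 Ω)} (hG : IsFormOperator V G) :
    ∃ lam, IsEigenvalueSequence G lam := by
  obtain ⟨lam, h1, h2⟩ := exists_formEigenvalue_sequence hVc (formEmbedding_injective hΩ hV)
    norm_formEmbedding_le (not_finiteDimensional_of_testFunctions hΩ hne hd hb hVt)
  exact ⟨lam, h1, fun t => (h2 t).trans (rank_eigenspace_eq hΩ hb hV hVt hG t).symm⟩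

theorem isFormOperator_neumannLaplacian (Ω : Set (Space d)) :
    IsFormOperator (sobolevSpace Ω) (neumannLaplacian Ω) := by
  intro u f
  constructor
  · rintro ⟨h1, g, hg, h2⟩
    exact ⟨h1, mkJet u g, hg, rfl, fun q hq => h2 _ _ hq⟩
  · rintro ⟨h1, p, hp, rfl, h2⟩
    exact ⟨h1, fun i => p (some i), hp, fun v gv hv => h2 (mkJet v gv) hv⟩

theorem isFormOperator_mixedLaplacian {ΓD ΓN : Set (Space d)}
    (hΓ : IsBoundaryDecomposition Ω ΓD ΓN) :
    IsFormOperator (traceVanishingSpace Ω ΓD) (mixedLaplacian Ω ΓD ΓN) := by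
  intro u f
  constructor
  · rintro ⟨h0, h1, g, hg, h2⟩
    exact ⟨h1, mkJet u g, ⟨hg, h0⟩, rfl,
      fun q hq => h2 _ _ hq.1 (hΓ.traceVanishesOn_iff.2 hq.2)⟩
  · rintro ⟨h1, p, hp, rfl, h2⟩
    exact ⟨hp.2, h1, fun i => p (some i), hp.1,
      fun v gv hv hv0 => h2 (mkJet v gv) ⟨hv, hΓ.traceVanishesOn_iff.1 hv0⟩⟩

end Operators

/-! ### Plane waves -/

section PlaneWave

variable {Ω : Set (Space d)}

/-- The plane wave `x ↦ exp(i τ·x)`. -/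
def planeWave (τ x : Space d) : ℂ := Complex.exp ((⟪τ, x⟫_ℝ : ℂ) * Complex.I)

lemma contDiff_planeWave (τ : Space d) : ContDiff ℝ ∞ (planeWave τ) := by
  have h : ContDiff ℝ ∞ fun x : Space d => (⟪τ, x⟫_ℝ : ℂ) :=
    Complex.ofRealCLM.contDiff.comp (contDiff_const.inner ℝ contDiff_id)
  exact (h.mul contDiff_const).cexp

lemma norm_planeWave (τ x : Space d) : ‖planeWave τ x‖ = 1 :=
  Complex.norm_exp_ofReal_mul_I _

lemma partialDeriv_planeWave (τ : Space d) (i : Fin d) :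
    partialDeriv i (planeWave τ) = fun x => (Complex.I * τ i) * planeWave τ x := by
  funext x
  have h1 : HasFDerivAt (fun y : Space d => (⟪τ, y⟫_ℝ : ℂ))
      (Complex.ofRealCLM ∘L innerSL ℝ τ) x :=
    (Complex.ofRealCLM ∘L innerSL ℝ τ).hasFDerivAt
  have h2 := ((h1.mul_const Complex.I).cexp).fderiv
  change fderiv ℝ (fun y => Complex.exp ((⟪τ, y⟫_ℝ : ℂ) * Complex.I)) x _ = _
  rw [h2]
  have h3 : ⟪τ, EuclideanSpace.single i 1⟫_ℝ = τ i := by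
    rw [EuclideanSpace.inner_single_right]
    simp
  simp only [smul_apply, ContinuousLinearMap.comp_apply, innerSL_apply_apply, h3, planeWave,
    Complex.ofRealCLM_apply, smul_eq_mul]
  ring

lemma smoothJet_planeWave_some (hb : Bornology.IsBounded Ω) (τ : Space d) (i : Fin d) :
    smoothJet hb (contDiff_planeWave τ) (some i) =
      (Complex.I * τ i) • smoothJet hb (contDiff_planeWave τ) none := by
  refine Lp.ext ?_
  filter_upwards [smoothJet_some hb (contDiff_planeWave τ) i, smoothJet_none hb
    (contDiff_planeWave τ), Lp.coeFn_smul (Complex.I * (τ i : ℂ))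
      (smoothJet hb (contDiff_planeWave τ) none)] with x h1 h2 h3
  rw [h1, h3, Pi.smul_apply, h2, partialDeriv_planeWave, smul_eq_mul]

lemma sum_coe_sq (τ : Space d) : ∑ i, (τ i : ℂ) ^ 2 = ((‖τ‖ ^ 2 : ℝ) : ℂ) := by
  rw [EuclideanSpace.real_norm_sq_eq]
  push_cast
  rfl

lemma inner_planeWave_self (hb : Bornology.IsBounded Ω) (τ : Space d) :
    ⟪smoothJet hb (contDiff_planeWave τ), smoothJet hb (contDiff_planeWave τ)⟫_ℂ =
      (1 + ((‖τ‖ ^ 2 : ℝ) : ℂ)) * ⟪smoothJet hb (contDiff_planeWave τ) none,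
        smoothJet hb (contDiff_planeWave τ) none⟫_ℂ := by
  rw [inner_jet, add_mul, one_mul, ← sum_coe_sq, Finset.sum_mul]
  congr 1
  refine Finset.sum_congr rfl fun i _ => ?_
  rw [smoothJet_planeWave_some, inner_smul_left, inner_smul_right, map_mul, Complex.conj_I,
    Complex.conj_ofReal]
  linear_combination (-(τ i : ℂ) ^ 2 * ⟪smoothJet hb (contDiff_planeWave τ) none,
        smoothJet hb (contDiff_planeWave τ) none⟫_ℂ) * Complex.I_sq

/-- The plane wave acts as an eigenvector with eigenvalue `‖τ‖ ^ 2` when tested against the form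
domain of the mixed problem, although it does not satisfy its boundary condition on Γ_D.
Tangentiality of `τ` along Γ_N enters here. -/
theorem inner_planeWave (hΩ : IsBoundedLipschitzDomain Ω) (hd : 1 ≤ d) {ΓD ΓN : Set (Space d)}
    (hΓ : IsBoundaryDecomposition Ω ΓD ΓN) {τ : Space d} (hτ : τ ∈ jointTangentSpace Ω ΓN)
    {p : JetSpace Ω} (hp : p ∈ traceVanishingSpace Ω ΓD) :
    ⟪smoothJet hΩ.isBounded (contDiff_planeWave τ), p⟫_ℂ = (1 + ((‖τ‖ ^ 2 : ℝ) : ℂ)) *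
      ⟪smoothJet hΩ.isBounded (contDiff_planeWave τ) none, p none⟫_ℂ := by
  have h := sum_inner_add_inner_eq_zero hΩ hd hΓ hτ (contDiff_planeWave τ) hp
  rw [inner_jet, add_mul, one_mul, ← sum_coe_sq, Finset.sum_mul]
  congr 1
  -- The difference of the two sides is `-i` times the tangential integration by parts identity.
  rw [← sub_eq_zero, ← Finset.sum_sub_distrib, ← mul_zero (-Complex.I), ← h, Finset.mul_sum]
  refine Finset.sum_congr rfl fun i _ => ?_
  rw [smoothJet_planeWave_some, inner_smul_left, inner_smul_left, map_mul, Complex.conj_I,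
    Complex.conj_ofReal]
  linear_combination (-(τ i : ℂ) ^ 2 * ⟪smoothJet hΩ.isBounded (contDiff_planeWave τ) none,
        p none⟫_ℂ) * Complex.I_sq

/-- The plane wave has modulus 1 everywhere, so its trace cannot vanish on a set of positive surface
measure. -/
lemma planeWave_notMem_traceVanishingSpace (hΩ : IsBoundedLipschitzDomain Ω) (hd : 1 ≤ d)
    {Γ : Set (Space d)} (hΓ : IsRelOpenInBoundary Ω Γ) (hne : Γ.Nonempty) (τ : Space d) :
    smoothJet hΩ.isBounded (contDiff_planeWave τ) ∉ traceVanishingSpace Ω Γ := by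
  rw [smoothJet_mem_traceVanishingSpace_iff hΩ hd]
  intro h
  refine (surfaceMeasure_pos hΩ hd hΓ hne).ne' (measure_eq_zero_iff_ae_notMem.2 ?_)
  filter_upwards [h] with x hx hxΓ
  have h1 := norm_planeWave τ x
  rw [hx hxΓ, norm_zero] at h1
  exact zero_ne_one h1

end PlaneWave

lemma exists_mem_norm_sq_eq {S : Submodule ℝ (Space d)} (hS : 1 ≤ Module.finrank ℝ S) {r : ℝ}
    (hr : 0 ≤ r) : ∃ τ ∈ S, ‖τ‖ ^ 2 = r := by
  have : Nontrivial S := Module.nontrivial_of_finrank_pos (R := ℝ) hS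
  obtain ⟨τ, hτ⟩ := exists_norm_eq S (Real.sqrt_nonneg r)
  exact ⟨τ, τ.2, by rw [Submodule.norm_coe, hτ, Real.sq_sqrt hr]⟩

end MixedLaplacian

end

/-! ### The eigenvalue inequality -/

theorem theorem3p1 (d : ℕ) (hd : 2 ≤ d) (Ω ΓD ΓN : Set (MixedLaplacian.Space d))
    (hΩ : MixedLaplacian.IsBoundedLipschitzDomain Ω)
    (hΓ : MixedLaplacian.IsBoundaryDecomposition Ω ΓD ΓN)
    (hS : 1 ≤ Module.finrank ℝ (MixedLaplacian.jointTangentSpace Ω ΓN)) :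
    (∃ μ : ℕ → ℝ,
      MixedLaplacian.IsEigenvalueSequence (MixedLaplacian.neumannLaplacian Ω) μ) ∧
    (∃ lam : ℕ → ℝ,
      MixedLaplacian.IsEigenvalueSequence (MixedLaplacian.mixedLaplacian Ω ΓD ΓN) lam) ∧
    ∀ μ lam : ℕ → ℝ,
      MixedLaplacian.IsEigenvalueSequence (MixedLaplacian.neumannLaplacian Ω) μ →
      MixedLaplacian.IsEigenvalueSequence (MixedLaplacian.mixedLaplacian Ω ΓD ΓN) lam →
      ∀ k : ℕ, μ (k + 1) ≤ lam k := by
  open MixedLaplacian in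
  have hd1 : 1 ≤ d := one_le_two.trans hd
  have hb := hΩ.isBounded
  have hne := hΩ.isConnected.nonempty
  let U := sobolevSpace Ω
  let V := traceVanishingSpace Ω ΓD
  have hVU : V ≤ U := traceVanishingSpace_le_sobolevSpace
  have hUc : CompleteSpace U := isClosed_sobolevSpace.completeSpace_coe
  have hVc : CompleteSpace V :=
    (isClosed_traceVanishingSpace hΩ hd1 hΓ.isRelOpen_D.measurableSet).completeSpace_coe
  have hUt : ∀ φ (hφ : IsTestFunction Ω φ), smoothJet hb hφ.contDiff ∈ U := fun φ hφ =>
    smoothJet_mem_sobolevSpace hb hφ.contDiff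
  have hVt : ∀ φ (hφ : IsTestFunction Ω φ), smoothJet hb hφ.contDiff ∈ V := fun φ hφ =>
    smoothJet_mem_traceVanishingSpace hΩ hd1 hφ
  have hUJ : IsCompactOperator (formEmbedding U) := isCompactOperator_sobolev_embedding hΩ le_rfl
  have hVJ : IsCompactOperator (formEmbedding V) := isCompactOperator_sobolev_embedding hΩ hVU
  have hUG := isFormOperator_neumannLaplacian Ω
  have hVG := isFormOperator_mixedLaplacian hΓ
  refine ⟨exists_isEigenvalueSequence hΩ.isOpen hne hd1 hb le_rfl hUJ hUt hUG,
    exists_isEigenvalueSequence hΩ.isOpen hne hd1 hb hVU hVJ hVt hVG, ?_⟩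
  intro μ lam hμ hlam k
  -- The sequences are arbitrary; their multiplicity property alone provides eigenbases indexed in
  -- the same order.
  obtain ⟨c, hc⟩ := exists_hilbertBasis_of_formEigenvalues hUJ
    (formEmbedding_injective hΩ.isOpen le_rfl) norm_formEmbedding_le fun t =>
      (hμ.multiplicity t).trans (rank_eigenspace_eq hΩ.isOpen hb le_rfl hUt hUG t)
  obtain ⟨b, hbV⟩ := exists_hilbertBasis_of_formEigenvalues hVJ
    (formEmbedding_injective hΩ.isOpen hVU) norm_formEmbedding_le fun t =>
      (hlam.multiplicity t).trans (rank_eigenspace_eq hΩ.isOpen hb hVU hVt hVG t)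
  have hlam0 := nonneg_of_hilbertBasis_mem_formEigenspace norm_formEmbedding_le b hbV
  have hμ0 := nonneg_of_hilbertBasis_mem_formEigenspace norm_formEmbedding_le c hc
  -- The frequency is tuned to `k`; nonnegativity of `lam k` makes it a squared length in the
  -- nontrivial tangent space.
  obtain ⟨τ, hτ, hτk⟩ := exists_mem_norm_sq_eq hS (hlam0 k)
  refine formEigenvalue_succ_le (J := jetFst Ω) hVU (fun u hu h => ?_) hlam.monotone hμ.monotone
    hlam0 hμ0 hbV hc (smoothJet_mem_sobolevSpace hb (contDiff_planeWave τ))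
    (planeWave_notMem_traceVanishingSpace hΩ hd1 hΓ.isRelOpen_D hΓ.nonempty_D τ)
    (fun p hp => ?_) ?_
  · exact injective_sobolev_fst hΩ.isOpen hu (zero_mem _) h
  · rw [← hτk]
    exact inner_planeWave hΩ hd1 hΓ hτ hp
  · rw [← hτk]
    exact inner_planeWave_self hb τ
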